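/- Setting. For a finite set of noncommuting selfadjoint indeterminates $\underline X$, let $\mathbb C\langle\underline X\rangle$ be the $\star$-algebra of noncommutative polynomials ($\star$ is conjugate linear, reverses words and fixes the letters), and $\mathbb C\langle\underline X\rangle_d$ the span of the words of length at most $d$. A linear functional $\tau$ on $\mathbb C\langle\underline X\rangle$ is a faithful positive bounded trace if $\tau(1)=1$, $\tau(f^\star f)\ge 0$ with equality only for $f=0$, $\tau(fg)=\tau(gf)$, and there is $R>0$ with $|\tau(w)|<R^d$ for all $d\ge1$ and all words $w$ of length at most $d$. Let $\underline a_\tau$ be the tuple of selfadjoint operators on $L^2(\tau)$ given by the GNS construction; for $\mathbf P\in\mathbb M_k(\mathbb C\langle\underline X\rangle)$ the norm $\|\mathbf P(\underline a_\tau)\|$ is the operator norm on $L^2(\tau)^k$, and $\|\mathbf P\|_{L^2({\rm tr}_k\otimes\tau)}=({\rm tr}_k\otimes\tau)(\mathbf P^\star\mathbf P)^{1/2}$, with ${\rm tr}_k$ the normalized trace. For $\mathfrak C\in[1,\infty)$, $\tau$ satisfies the $\mathfrak C$-Bernstein–Markov property with constants $M(\tau)_d\ge 0$ ($d\ge1$;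 they may depend on $k$) if for each $k\ge1$ one has $\|\mathbf P(\underline a_\tau)\|\le M(\tau)_d\,\|\mathbf P\|_{L^2({\rm tr}_k\otimes\tau)}$ for all $\mathbf P\in\mathbb M_k(\mathbb C\langle\underline X\rangle)$ of degree $d$, and $\limsup_{d\to\infty}M(\tau)_d^{1/d}=\mathfrak C$. For $\mathbf P=\sum_w c_w\otimes w$ and a tuple $\underline A$ of $k\times k$ complex matrices put $\mathbf P(\underline A)(I_k)=\sum_w c_w\underline A^w$, and define $$\Phi^2_{\tau,d}(\underline A)=\sup\,{\rm tr}_k\big(\mathbf P(\underline A)(I_k)^\star\mathbf P(\underline A)(I_k)\big),\qquad \Phi^\infty_{\tau,d}(\underline A)=\sup\,\|\mathbf P(\underline A)(I_k)\|^2,$$ both suprema over $\mathbf P\in\mathbb M_k(\mathbb C\langle\underline X\rangle_d)$ with $\|\mathbf P(\underline a_\tau)\|\le1$. For $\bullet\in\{2,\infty\}$ let $$\Phi^\bullet_\tau=\Big[\limsup_{d\to\infty}(\Phi^\bullet_{\tau,d})^{1/d}\Big]^*,\qquad \Sigma^\bullet_\tau=\Big[\sup_{d\ge1}(\Phi^\bullet_{\tau,d})^{1/d}\Big]^*,$$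 functions with values in $[0,\infty]$, where $f^*(z)=\limsup_{\zeta\to z}f(\zeta)$ is the upper semicontinuous regularization on the space of all tuples of $k\times k$ complex matrices. A property holds quasi-everywhere (q.e.) if it holds off a pluripolar set, i.e. a set which near each of its points is contained in the $-\infty$-set of a plurisubharmonic function. Theorem. Let $n,m\ge1$, $\underline X_1=(X_1,\dots,X_n)$, $\underline X_2=(X_{n+1},\dots,X_{n+m})$, let $\tau_1,\tau_2$ be faithful positive bounded traces on $\mathbb C\langle\underline X_1\rangle$, $\mathbb C\langle\underline X_2\rangle$, and let $\tau=\tau_1*\tau_2$ be their free product on $\mathbb C\langle\underline X_1,\underline X_2\rangle$, i.e. the unique linear functional that extends $\tau_1$ and $\tau_2$ and vanishes on every nonempty alternating product of elements $p\in\mathbb C\langle\underline X_1\rangle$ with $\tau_1(p)=0$ and elements $q\in\mathbb C\langle\underline X_2\rangle$ with $\tau_2(q)=0$. Suppose that $\tau_j$ satisfies the $\mathfrak C_j$-Bernstein–Markov property for some $\mathfrak C_j\in[1,\infty)$, with constants $M(\tau_j)_d$, $j=1,2$. Then for each $k\ge1$: (1) for all $(\underline A_1,\underline A_2)\in\mathbb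 M_k(\mathbb C)^n\times\mathbb M_k(\mathbb C)^m$, $$\max\{\Sigma^\infty_{\tau_1}(\underline A_1),\Sigma^\infty_{\tau_2}(\underline A_2)\}\le\Sigma^\infty_\tau(\underline A_1,\underline A_2)\le(m+n)^2\max_{j=1,2}\Big\{\Sigma^\infty_{\tau_j}(\underline A_j)\sup_{q\ge1}M(\tau_j)_q^{2/q}\Big\};$$ (2) for all tuples $(\underline A_1,\underline A_2)$ of selfadjoint matrices in $\mathbb M_k(\mathbb C)^n\times\mathbb M_k(\mathbb C)^m$, $$\max\{\Phi^\infty_{\tau_1}(\underline A_1),\Phi^\infty_{\tau_2}(\underline A_2)\}\le\Phi^\infty_\tau(\underline A_1,\underline A_2)\le(m+n)^2\max_{j=1,2}\Big\{\Phi^\infty_{\tau_j}(\underline A_j)\sup_{q\ge1}M(\tau_j)_q^{2/q}\Big\};$$ (3) each of the four functions $\Sigma^\infty_\tau,\Sigma^2_\tau,\Phi^2_\tau,\Phi^\infty_\tau$ on $\mathbb M_k(\mathbb C)^n\times\mathbb M_k(\mathbb C)^m$ is nontrivial, i.e. takes a value greater than $1$; and if $\Phi^\infty_{\tau_1}$ and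 $\Phi^\infty_{\tau_2}$ are finite q.e. on $\mathbb M_k(\mathbb C)^n$ and $\mathbb M_k(\mathbb C)^m$ respectively, then all four functions are finite q.e. -/

import Mathlib

open Filter Topology MeasureTheory
open scoped ENNReal Matrix

noncomputable section

namespace NCSiciak

/-! ### Noncommutative polynomials and traces -/

/-- The algebra `ℂ⟨X⟩` of polynomials in noncommuting indeterminates indexed by `ι`: the complex
vector space spanned by the free monoid of words, multiplied by juxtaposition. -/
abbrev NCPoly (ι : Type*) : Type _ := MonoidAlgebra ℂ (FreeMonoid ι)

/-- The monomial given by a word. -/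
def monomial {ι : Type*} (w : FreeMonoid ι) : NCPoly ι := MonoidAlgebra.single w 1

/-- The conjugate linear involution of `ℂ⟨X⟩` that fixes the letters and reverses words. -/
def ncStar {ι : Type*} (p : NCPoly ι) : NCPoly ι :=
  p.coeff.sum fun w c => MonoidAlgebra.single (star w) (star c)

/-- A faithful, positive, bounded, tracial state on `ℂ⟨X⟩`. -/
structure IsFaithfulBoundedTrace {ι : Type*} (τ : NCPoly ι →ₗ[ℂ] ℂ) : Prop where
  map_one : τ 1 = 1
  nonneg : ∀ p, 0 ≤ (τ (ncStar p * p)).re ∧ (τ (ncStar p * p)).im = 0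
  tracial : ∀ p q, τ (p * q) = τ (q * p)
  faithful : ∀ p, τ (ncStar p * p) = 0 → p = 0
  bounded : ∃ R : ℝ, 0 < R ∧ ∀ d : ℕ, 1 ≤ d → ∀ w : FreeMonoid ι, w.length ≤ d →
    ‖τ (monomial w)‖ < R ^ d

/-! ### Free products -/

section FreeProduct

variable {ι₁ ι₂ : Type*}

/-- The inclusion `ℂ⟨X₁⟩ → ℂ⟨X₁, X₂⟩`. -/
def inclLeft : NCPoly ι₁ →ₐ[ℂ] NCPoly (ι₁ ⊕ ι₂) :=
  MonoidAlgebra.mapDomainAlgHom ℂ ℂ (FreeMonoid.map (Sum.inl : ι₁ → ι₁ ⊕ ι₂))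

/-- The inclusion `ℂ⟨X₂⟩ → ℂ⟨X₁, X₂⟩`. -/
def inclRight : NCPoly ι₂ →ₐ[ℂ] NCPoly (ι₁ ⊕ ι₂) :=
  MonoidAlgebra.mapDomainAlgHom ℂ ℂ (FreeMonoid.map (Sum.inr : ι₂ → ι₁ ⊕ ι₂))

/-- `τ` is the free product of `τ₁` and `τ₂`: it extends both, and it vanishes on every nonempty
alternating product of centred elements of `ℂ⟨X₁⟩` and `ℂ⟨X₂⟩`. -/
structure IsFreeProduct (τ₁ : NCPoly ι₁ →ₗ[ℂ] ℂ) (τ₂ : NCPoly ι₂ →ₗ[ℂ] ℂ)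
    (τ : NCPoly (ι₁ ⊕ ι₂) →ₗ[ℂ] ℂ) : Prop where
  left : ∀ p, τ (inclLeft p) = τ₁ p
  right : ∀ p, τ (inclRight p) = τ₂ p
  free : ∀ l : List (NCPoly ι₁ ⊕ NCPoly ι₂), l ≠ [] →
    l.IsChain (fun a b => a.isLeft ≠ b.isLeft) →
    (∀ a ∈ l, Sum.elim (fun p => τ₁ p) (fun p => τ₂ p) a = 0) →
    τ (l.map (Sum.elim (fun p => inclLeft p) (fun p => inclRight p))).prod = 0

/-- The value of the given functionals on a word in letters of one kind. -/
def monoVal (τ₁ : NCPoly ι₁ →ₗ[ℂ] ℂ) (τ₂ : NCPoly ι₂ →ₗ[ℂ] ℂ) (w : List (ι₁ ⊕ ι₂)) : ℂ :=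
  if w.all Sum.isLeft then τ₁ (monomial (FreeMonoid.ofList (w.filterMap Sum.getLeft?)))
  else τ₂ (monomial (FreeMonoid.ofList (w.filterMap Sum.getRight?)))

/-- The action of a letter on the basis of centred alternating words (auxiliary construction). -/
def letterOp (φ : List (ι₁ ⊕ ι₂) → ℂ) (x : ι₁ ⊕ ι₂) :
    Module.End ℂ (List (ι₁ ⊕ ι₂) →₀ ℂ) :=
  Finsupp.linearCombination ℂ fun w =>
    let u := w.takeWhile fun y => y.isLeft == x.isLeft
    let v := w.dropWhile fun y => y.isLeft == x.isLeft
    if u = [] then Finsupp.single (x :: w) 1 + φ [x] • Finsupp.single w 1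
    else Finsupp.single (x :: w) 1 + (φ (x :: u) - φ u * φ [x]) • Finsupp.single v 1
      - φ u • Finsupp.single (x :: v) 1

/-- The action of polynomials on the basis of centred alternating words. -/
def polyOp (φ : List (ι₁ ⊕ ι₂) → ℂ) :
    NCPoly (ι₁ ⊕ ι₂) →ₐ[ℂ] Module.End ℂ (List (ι₁ ⊕ ι₂) →₀ ℂ) :=
  MonoidAlgebra.lift ℂ _ _ (FreeMonoid.lift (letterOp φ))

/-- Span of the words whose first letter has colour `b`. -/
def headSpan (ι₁ ι₂ : Type*) (b : Bool) : Submodule ℂ (List (ι₁ ⊕ ι₂) →₀ ℂ) :=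
  Submodule.span ℂ {f | ∃ x w, Sum.isLeft x = b ∧ f = Finsupp.single (x :: w) 1}

theorem wordOp_apply (φ : List (ι₁ ⊕ ι₂) → ℂ) (hφ : φ [] = 1) (b : Bool) (w : List (ι₁ ⊕ ι₂))
    (hw : ∀ y ∈ w.head?, y.isLeft ≠ b) (u : List (ι₁ ⊕ ι₂)) (hu : ∀ y ∈ u, y.isLeft = b) :
    FreeMonoid.lift (letterOp φ) (FreeMonoid.ofList u) (Finsupp.single w 1)
      - φ u • Finsupp.single w (1 : ℂ) ∈ headSpan ι₁ ι₂ b ∧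
    (u ≠ [] → FreeMonoid.lift (letterOp φ) (FreeMonoid.ofList u) (Finsupp.single w 1)
      = Finsupp.single (u ++ w) 1 + φ u • Finsupp.single w (1 : ℂ)) := by
  have hT : w.takeWhile (fun y => y.isLeft == b) = [] := by
    cases w with
    | nil => rfl
    | cons y w => simp_all
  have hD : w.dropWhile (fun y => y.isLeft == b) = w := by
    cases w with
    | nil => rfl
    | cons y w => simp_all
  have key : u ≠ [] → FreeMonoid.lift (letterOp φ) (FreeMonoid.ofList u) (Finsupp.single w 1)
      = Finsupp.single (u ++ w) 1 + φ u • Finsupp.single w (1 : ℂ) := by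
    induction u with
    | nil => simp
    | cons x v ih =>
      intro _
      have hx : x.isLeft = b := hu x (by simp)
      have hv : ∀ y ∈ v, y.isLeft = b := fun y hy => hu y (by simp [hy])
      have hs : letterOp φ x (Finsupp.single w 1)
          = Finsupp.single (x :: w) 1 + φ [x] • Finsupp.single w 1 := by
        simp only [letterOp, Finsupp.linearCombination_single, one_smul, hx, hT, if_true]
      rw [FreeMonoid.ofList_cons, map_mul, FreeMonoid.lift_eval_of, Module.End.mul_apply]
      by_cases hv0 : v = []
      · subst hv0
        rw [FreeMonoid.ofList_nil, map_one, Module.End.one_apply, hs]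
        rfl
      · rw [ih hv hv0, map_add, map_smul, hs]
        have h1 : (v ++ w).takeWhile (fun y => y.isLeft == b) = v := by
          rw [List.takeWhile_append_of_pos (by simpa using hv), hT, List.append_nil]
        have h2 : (v ++ w).dropWhile (fun y => y.isLeft == b) = w := by
          rw [List.dropWhile_append_of_pos (by simpa using hv), hD]
        have h3 : letterOp φ x (Finsupp.single (v ++ w) 1)
            = Finsupp.single (x :: (v ++ w)) 1 + (φ (x :: v) - φ v * φ [x]) • Finsupp.single w 1
              - φ v • Finsupp.single (x :: w) 1 := by
          simp only [letterOp, Finsupp.linearCombination_single, one_smul, hx, h1, h2, hv0,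
            if_false]
        rw [h3, List.cons_append]
        module
  refine ⟨?_, key⟩
  by_cases h0 : u = []
  · subst h0
    simp [hφ]
  · rw [key h0, add_sub_cancel_right]
    refine Submodule.subset_span ?_
    cases u with
    | nil => exact absurd rfl h0
    | cons x v => exact ⟨x, v ++ w, hu x (by simp), rfl⟩

theorem monoVal_nil (τ₁ : NCPoly ι₁ →ₗ[ℂ] ℂ) (τ₂ : NCPoly ι₂ →ₗ[ℂ] ℂ) (h₁ : τ₁ 1 = 1) :
    monoVal τ₁ τ₂ [] = 1 := by
  simpa [monoVal, monomial, MonoidAlgebra.one_def] using h₁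

theorem monoVal_left (τ₁ : NCPoly ι₁ →ₗ[ℂ] ℂ) (τ₂ : NCPoly ι₂ →ₗ[ℂ] ℂ) (u : List ι₁) :
    monoVal τ₁ τ₂ (u.map Sum.inl) = τ₁ (monomial (FreeMonoid.ofList u)) := by
  have h : (u.map (Sum.inl : ι₁ → ι₁ ⊕ ι₂)).filterMap Sum.getLeft? = u := by
    induction u <;> simp_all
  simp [monoVal, h]

theorem monoVal_right (τ₁ : NCPoly ι₁ →ₗ[ℂ] ℂ) (τ₂ : NCPoly ι₂ →ₗ[ℂ] ℂ) (h₁ : τ₁ 1 = 1)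
    (h₂ : τ₂ 1 = 1) (u : List ι₂) :
    monoVal τ₁ τ₂ (u.map Sum.inr) = τ₂ (monomial (FreeMonoid.ofList u)) := by
  have h : (u.map (Sum.inr : ι₂ → ι₁ ⊕ ι₂)).filterMap Sum.getRight? = u := by
    induction u <;> simp_all
  cases u with
  | nil =>
    rw [List.map_nil, monoVal_nil τ₁ τ₂ h₁]
    simpa [monomial, MonoidAlgebra.one_def] using h₂.symm
  | cons x u =>
    rw [monoVal, if_neg (by simp), h]

theorem polyOp_left (τ₁ : NCPoly ι₁ →ₗ[ℂ] ℂ) (τ₂ : NCPoly ι₂ →ₗ[ℂ] ℂ) (h₁ : τ₁ 1 = 1)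
    (w : List (ι₁ ⊕ ι₂)) (hw : ∀ y ∈ w.head?, y.isLeft ≠ true) (p : NCPoly ι₁) :
    polyOp (monoVal τ₁ τ₂) (inclLeft p) (Finsupp.single w 1) - τ₁ p • Finsupp.single w (1 : ℂ)
      ∈ headSpan ι₁ ι₂ true := by
  induction p using MonoidAlgebra.induction_linear with
  | zero => simp
  | add p q hp hq =>
    have := Submodule.add_mem _ hp hq
    convert this using 1
    simp only [map_add, LinearMap.add_apply]
    module
  | single u c =>
    have h := (wordOp_apply (monoVal τ₁ τ₂) (monoVal_nil τ₁ τ₂ h₁) true w hw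
      (u.toList.map Sum.inl) (by simp)).1
    rw [monoVal_left] at h
    have := Submodule.smul_mem _ c h
    convert this using 1
    have e : (MonoidAlgebra.single u c : NCPoly ι₁) = c • monomial u := by simp [monomial]
    rw [e, map_smul, map_smul, map_smul, LinearMap.smul_apply]
    have e2 : polyOp (monoVal τ₁ τ₂) (inclLeft (ι₂ := ι₂) (monomial u))
        = FreeMonoid.lift (letterOp (monoVal τ₁ τ₂))
          (FreeMonoid.ofList (u.toList.map Sum.inl)) := by
      simp [polyOp, inclLeft, monomial, FreeMonoid.ofList_map]
    rw [e2, FreeMonoid.ofList_toList]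
    module

theorem polyOp_right (τ₁ : NCPoly ι₁ →ₗ[ℂ] ℂ) (τ₂ : NCPoly ι₂ →ₗ[ℂ] ℂ) (h₁ : τ₁ 1 = 1)
    (h₂ : τ₂ 1 = 1)
    (w : List (ι₁ ⊕ ι₂)) (hw : ∀ y ∈ w.head?, y.isLeft ≠ false) (p : NCPoly ι₂) :
    polyOp (monoVal τ₁ τ₂) (inclRight p) (Finsupp.single w 1) - τ₂ p • Finsupp.single w (1 : ℂ)
      ∈ headSpan ι₁ ι₂ false := by
  induction p using MonoidAlgebra.induction_linear with
  | zero => simp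
  | add p q hp hq =>
    have := Submodule.add_mem _ hp hq
    convert this using 1
    simp only [map_add, LinearMap.add_apply]
    module
  | single u c =>
    have h := (wordOp_apply (monoVal τ₁ τ₂) (monoVal_nil τ₁ τ₂ h₁) false w hw
      (u.toList.map Sum.inr) (by simp)).1
    rw [monoVal_right τ₁ τ₂ h₁ h₂] at h
    have := Submodule.smul_mem _ c h
    convert this using 1
    have e : (MonoidAlgebra.single u c : NCPoly ι₂) = c • monomial u := by simp [monomial]
    rw [e, map_smul, map_smul, map_smul, LinearMap.smul_apply]
    have e2 : polyOp (monoVal τ₁ τ₂) (inclRight (ι₁ := ι₁) (monomial u))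
        = FreeMonoid.lift (letterOp (monoVal τ₁ τ₂))
          (FreeMonoid.ofList (u.toList.map Sum.inr)) := by
      simp [polyOp, inclRight, monomial, FreeMonoid.ofList_map]
    rw [e2, FreeMonoid.ofList_toList]
    module

theorem headSpan_apply_nil (b : Bool) (f : List (ι₁ ⊕ ι₂) →₀ ℂ) (hf : f ∈ headSpan ι₁ ι₂ b) :
    f [] = 0 := by
  have : headSpan ι₁ ι₂ b ≤ LinearMap.ker (Finsupp.lapply (R := ℂ) []) := by
    refine Submodule.span_le.2 ?_
    rintro f ⟨x, w, -, rfl⟩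
    simp
  exact this hf

theorem headSpan_step (T : Module.End ℂ (List (ι₁ ⊕ ι₂) →₀ ℂ)) (b : Bool)
    (hT : ∀ w : List (ι₁ ⊕ ι₂), (∀ y ∈ w.head?, y.isLeft ≠ b) →
      T (Finsupp.single w 1) ∈ headSpan ι₁ ι₂ b)
    (f : List (ι₁ ⊕ ι₂) →₀ ℂ) (hf : f ∈ headSpan ι₁ ι₂ (!b)) : T f ∈ headSpan ι₁ ι₂ b := by
  have : headSpan ι₁ ι₂ (!b) ≤ (headSpan ι₁ ι₂ b).comap T := by
    refine Submodule.span_le.2 ?_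
    rintro f ⟨x, w, hx, rfl⟩
    exact hT _ (by simp [hx])
  exact this hf

/-- The free product of two unital functionals exists. -/
theorem exists_isFreeProduct (τ₁ : NCPoly ι₁ →ₗ[ℂ] ℂ) (τ₂ : NCPoly ι₂ →ₗ[ℂ] ℂ)
    (h₁ : τ₁ 1 = 1) (h₂ : τ₂ 1 = 1) : ∃ τ, IsFreeProduct τ₁ τ₂ τ := by
  let e : List (ι₁ ⊕ ι₂) →₀ ℂ := Finsupp.single [] 1
  let Λ := polyOp (monoVal τ₁ τ₂)
  let τ : NCPoly (ι₁ ⊕ ι₂) →ₗ[ℂ] ℂ :=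
    Finsupp.lapply [] ∘ₗ LinearMap.applyₗ e ∘ₗ Λ.toLinearMap
  have hτ : ∀ p, τ p = (Λ p e) [] := fun p => rfl
  refine ⟨τ, ⟨fun p => ?_, fun p => ?_, fun l hl hc h0 => ?_⟩⟩
  · have := headSpan_apply_nil _ _ (polyOp_left τ₁ τ₂ h₁ [] (by simp) p)
    rw [hτ]
    simpa [sub_eq_zero] using this
  · have := headSpan_apply_nil _ _ (polyOp_right τ₁ τ₂ h₁ h₂ [] (by simp) p)
    rw [hτ]
    simpa [sub_eq_zero] using this
  · let inc : NCPoly ι₁ ⊕ NCPoly ι₂ → NCPoly (ι₁ ⊕ ι₂) :=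
      Sum.elim (fun p => inclLeft p) (fun p => inclRight p)
    have hstep : ∀ a : NCPoly ι₁ ⊕ NCPoly ι₂,
        Sum.elim (fun p => τ₁ p) (fun p => τ₂ p) a = 0 →
        ∀ w : List (ι₁ ⊕ ι₂), (∀ y ∈ w.head?, y.isLeft ≠ a.isLeft) →
          Λ (inc a) (Finsupp.single w 1) ∈ headSpan ι₁ ι₂ a.isLeft := by
      rintro (p | p) ha w hw
      · have := polyOp_left τ₁ τ₂ h₁ w hw p
        rw [show τ₁ p = 0 from ha, zero_smul, sub_zero] at this
        exact this
      · have := polyOp_right τ₁ τ₂ h₁ h₂ w hw p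
        rw [show τ₂ p = 0 from ha, zero_smul, sub_zero] at this
        exact this
    have main : ∀ l : List (NCPoly ι₁ ⊕ NCPoly ι₂),
        l.IsChain (fun a b => a.isLeft ≠ b.isLeft) →
        (∀ a ∈ l, Sum.elim (fun p => τ₁ p) (fun p => τ₂ p) a = 0) →
        ∀ a ∈ l.head?, Λ (l.map inc).prod e ∈ headSpan ι₁ ι₂ a.isLeft := by
      intro l
      induction l with
      | nil => simp
      | cons a l ih =>
        intro hc h0 a' ha'
        obtain rfl : a = a' := by simpa using ha'
        rw [List.map_cons, List.prod_cons, map_mul, Module.End.mul_apply]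
        have ha := hstep a (h0 a (by simp))
        cases l with
        | nil => simpa using ha [] (by simp)
        | cons c l =>
          rw [List.isChain_cons_cons] at hc
          have hb := ih hc.2 (fun x hx => h0 x (by simp [hx])) c (by simp)
          refine headSpan_step _ _ ha _ ?_
          have : c.isLeft = !a.isLeft := by
            rcases hc with ⟨hne, -⟩
            revert hne
            cases a.isLeft <;> cases c.isLeft <;> simp
          rwa [this] at hb
    cases l with
    | nil => exact absurd rfl hl
    | cons a l => exact headSpan_apply_nil _ _ (main (a :: l) hc h0 a (by simp))

/-- The free product of two unital functionals is unique. -/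
theorem IsFreeProduct.unique {τ₁ : NCPoly ι₁ →ₗ[ℂ] ℂ} {τ₂ : NCPoly ι₂ →ₗ[ℂ] ℂ}
    (h₁ : τ₁ 1 = 1) (h₂ : τ₂ 1 = 1) {τ τ' : NCPoly (ι₁ ⊕ ι₂) →ₗ[ℂ] ℂ}
    (h : IsFreeProduct τ₁ τ₂ τ) (h' : IsFreeProduct τ₁ τ₂ τ') : τ = τ' := by
  let inc : NCPoly ι₁ ⊕ NCPoly ι₂ → NCPoly (ι₁ ⊕ ι₂) :=
    Sum.elim (fun p => inclLeft p) (fun p => inclRight p)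
  let G : Set (NCPoly (ι₁ ⊕ ι₂)) := {f | ∃ l : List (NCPoly ι₁ ⊕ NCPoly ι₂),
    l.IsChain (fun a b => a.isLeft ≠ b.isLeft) ∧
    (∀ a ∈ l, Sum.elim (fun p => τ₁ p) (fun p => τ₂ p) a = 0) ∧ f = (l.map inc).prod}
  let S := Submodule.span ℂ G
  have hone : (1 : NCPoly (ι₁ ⊕ ι₂)) ∈ S :=
    Submodule.subset_span ⟨[], .nil, by simp, by simp⟩
  have hEq : ∀ f ∈ S, τ f = τ' f := by
    intro f hf
    have hle : S ≤ LinearMap.eqLocus τ τ' := by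
      refine Submodule.span_le.2 ?_
      rintro f ⟨l, hc, h0, rfl⟩
      by_cases hl : l = []
      · subst hl
        have e1 := h.left 1
        have e2 := h'.left 1
        rw [map_one] at e1 e2
        simpa using e1.trans e2.symm
      · exact (h.free l hl hc h0).trans (h'.free l hl hc h0).symm
    exact hle hf
  -- one-step absorption of a polynomial of one kind
  have hcentL : ∀ p : NCPoly ι₁, τ₁ (p - τ₁ p • 1) = 0 := by
    intro p; simp [h₁]
  have hcentR : ∀ p : NCPoly ι₂, τ₂ (p - τ₂ p • 1) = 0 := by
    intro p; simp [h₂]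
  have habs : ∀ a : NCPoly ι₁ ⊕ NCPoly ι₂, ∀ l : List (NCPoly ι₁ ⊕ NCPoly ι₂),
      l.IsChain (fun a b => a.isLeft ≠ b.isLeft) →
      (∀ a ∈ l, Sum.elim (fun p => τ₁ p) (fun p => τ₂ p) a = 0) →
      (∀ c ∈ l.head?, a.isLeft ≠ c.isLeft) → inc a * (l.map inc).prod ∈ S := by
    intro a l hc h0 hd
    have aux : ∀ a' : NCPoly ι₁ ⊕ NCPoly ι₂, ∀ z : ℂ, a'.isLeft = a.isLeft →
        Sum.elim (fun p => τ₁ p) (fun p => τ₂ p) a' = 0 → inc a = inc a' + z • 1 →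
        inc a * (l.map inc).prod ∈ S := by
      intro a' z ha' hz he
      rw [he, add_mul, smul_mul_assoc, one_mul]
      refine Submodule.add_mem _ (Submodule.subset_span ⟨a' :: l, ?_, ?_, by simp⟩)
        (Submodule.smul_mem _ _ (Submodule.subset_span ⟨l, hc, h0, rfl⟩))
      · cases l with
        | nil => exact .singleton _
        | cons c l =>
          rw [List.isChain_cons_cons]
          exact ⟨by rw [ha']; exact hd c (by simp), hc⟩
      · intro x hx
        rcases List.mem_cons.1 hx with rfl | hx
        · exact hz
        · exact h0 x hx
    cases a with
    | inl p =>
      refine aux (Sum.inl (p - τ₁ p • 1)) (τ₁ p) rfl (hcentL p) ?_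
      simp [inc]
    | inr p =>
      refine aux (Sum.inr (p - τ₂ p • 1)) (τ₂ p) rfl (hcentR p) ?_
      simp [inc]
  have hmul : ∀ a : NCPoly ι₁ ⊕ NCPoly ι₂, ∀ f ∈ S, inc a * f ∈ S := by
    intro a f hf
    have hle : S ≤ S.comap (LinearMap.mulLeft ℂ (inc a)) := by
      refine Submodule.span_le.2 ?_
      rintro f ⟨l, hc, h0, rfl⟩
      change inc a * _ ∈ S
      cases l with
      | nil => exact habs a [] .nil (by simp) (by simp)
      | cons c l =>
        by_cases hd : a.isLeft = c.isLeft
        · have hl : l.IsChain (fun a b => a.isLeft ≠ b.isLeft) := hc.tail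
          have hh : ∀ x ∈ l.head?, c.isLeft ≠ x.isLeft := by
            cases l with
            | nil => simp
            | cons x l =>
              rw [List.isChain_cons_cons] at hc
              simpa using hc.1
          rw [List.map_cons, List.prod_cons, ← mul_assoc]
          cases a with
          | inl p =>
            cases c with
            | inl q =>
              have := habs (Sum.inl (p * q)) l hl (fun x hx => h0 x (by simp [hx])) hh
              simpa [inc] using this
            | inr q => simp at hd
          | inr p =>
            cases c with
            | inl q => simp at hd
            | inr q =>
              have := habs (Sum.inr (p * q)) l hl (fun x hx => h0 x (by simp [hx])) hh
              simpa [inc] using this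
        · exact habs a (c :: l) hc h0 (by simpa using hd)
    exact hle hf
  have hword : ∀ w : List (ι₁ ⊕ ι₂), monomial (FreeMonoid.ofList w) ∈ S := by
    intro w
    induction w with
    | nil => exact hone
    | cons x w ih =>
      have e : monomial (FreeMonoid.ofList (x :: w))
          = monomial (FreeMonoid.of x) * monomial (FreeMonoid.ofList w) := by
        simp [monomial, FreeMonoid.ofList_cons]
      rw [e]
      cases x with
      | inl i =>
        have := hmul (Sum.inl (monomial (FreeMonoid.of i))) _ ih
        simpa [inc, inclLeft, monomial] using this
      | inr i =>
        have := hmul (Sum.inr (monomial (FreeMonoid.of i))) _ ih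
        simpa [inc, inclRight, monomial] using this
  refine LinearMap.ext fun p => hEq p ?_
  induction p using MonoidAlgebra.induction_linear with
  | zero => exact Submodule.zero_mem _
  | add p q hp hq => exact Submodule.add_mem _ hp hq
  | single w c =>
    have := Submodule.smul_mem S c (hword w.toList)
    simpa [monomial] using this

/-- The free product `τ₁ * τ₂` of two unital functionals: the unique functional satisfying
`IsFreeProduct τ₁ τ₂`. -/
def freeProduct (τ₁ : NCPoly ι₁ →ₗ[ℂ] ℂ) (τ₂ : NCPoly ι₂ →ₗ[ℂ] ℂ)
    (h₁ : τ₁ 1 = 1) (h₂ : τ₂ 1 = 1) : NCPoly (ι₁ ⊕ ι₂) →ₗ[ℂ] ℂ :=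
  (exists_isFreeProduct τ₁ τ₂ h₁ h₂).choose

theorem isFreeProduct_freeProduct (τ₁ : NCPoly ι₁ →ₗ[ℂ] ℂ) (τ₂ : NCPoly ι₂ →ₗ[ℂ] ℂ)
    (h₁ : τ₁ 1 = 1) (h₂ : τ₂ 1 = 1) : IsFreeProduct τ₁ τ₂ (freeProduct τ₁ τ₂ h₁ h₂) :=
  (exists_isFreeProduct τ₁ τ₂ h₁ h₂).choose_spec

end FreeProduct

/-! ### Matrix-valued polynomials: degree, evaluation, norms -/

section Siciak

variable {ι : Type*} {k : ℕ}

/-- `P ∈ M_k(ℂ⟨X⟩_d)`: only words of length at most `d` occur. -/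
def HasDegreeLE (P : Matrix (Fin k) (Fin k) (NCPoly ι)) (d : ℕ) : Prop :=
  ∀ i j, ∀ w : FreeMonoid ι, (P i j).coeff w ≠ 0 → w.length ≤ d

/-- `P` has degree exactly `d`. -/
def HasDegreeEq (P : Matrix (Fin k) (Fin k) (NCPoly ι)) (d : ℕ) : Prop :=
  HasDegreeLE P d ∧ ∃ i j, ∃ w : FreeMonoid ι, (P i j).coeff w ≠ 0 ∧ w.length = d

/-- The value of a scalar polynomial at a tuple of matrices. -/
def evalTuple (A : ι → Matrix (Fin k) (Fin k) ℂ) :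
    NCPoly ι →ₐ[ℂ] Matrix (Fin k) (Fin k) ℂ :=
  MonoidAlgebra.lift ℂ _ _ (FreeMonoid.lift A)

/-- The value `P(A)(C) = ∑_w c_w C A^w` of `P = ∑_w c_w ⊗ w`; here `P` is written as
`∑_{i,j} e_{ij} ⊗ P_{ij}` with matrix units `e_{ij}`. -/
def evalAt (P : Matrix (Fin k) (Fin k) (NCPoly ι)) (A : ι → Matrix (Fin k) (Fin k) ℂ)
    (C : Matrix (Fin k) (Fin k) ℂ) : Matrix (Fin k) (Fin k) ℂ :=
  ∑ i, ∑ j, Matrix.single i j 1 * C * evalTuple A (P i j)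

/-- The operator norm of a complex matrix, acting on the Euclidean space `ℂ^k`. -/
def matNorm (B : Matrix (Fin k) (Fin k) ℂ) : ℝ :=
  ‖Matrix.toEuclideanCLM (n := Fin k) (𝕜 := ℂ) B‖

/-- The norm of a vector of `ℂ⟨X⟩^k ⊆ L²(τ)^k`. -/
def vecL2Norm (τ : NCPoly ι →ₗ[ℂ] ℂ) (ξ : Fin k → NCPoly ι) : ℝ :=
  √(∑ i, (τ (ncStar (ξ i) * ξ i)).re)

/-- The norm `‖P(a_τ)‖` in `M_k(W^*(τ))`. The von Neumann algebra `W^*(τ)` of the GNS construction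
acts on `L²(τ)`, the Hilbert space in which `ℂ⟨X⟩` with the form `(u, v) ↦ τ(v^⋆ u)` is dense,
and the tuple `a_τ` acts by left multiplication by the indeterminates. Hence `P(a_τ)` acts on
`L²(τ)^k`, and on the dense subspace `ℂ⟨X⟩^k` it is `ξ ↦ P ξ`. Its operator norm is the supremum
of `‖P ξ‖` over the vectors `ξ` of norm at most one in this subspace. -/
def opNorm (τ : NCPoly ι →ₗ[ℂ] ℂ) (P : Matrix (Fin k) (Fin k) (NCPoly ι)) : ℝ≥0∞ :=
  ⨆ (ξ : Fin k → NCPoly ι) (_ : vecL2Norm τ ξ ≤ 1), ENNReal.ofReal (vecL2Norm τ (P *ᵥ ξ))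

/-- The norm `‖P‖_{L²(tr_k ⊗ τ)}`, that is `(tr_k ⊗ τ)(P^⋆ P)^{1/2}`, where `tr_k` is the
normalized trace and the `(i, i)` entry of `P^⋆ P` is `∑_j P_{ji}^⋆ P_{ji}`. -/
def l2Norm (τ : NCPoly ι →ₗ[ℂ] ℂ) (P : Matrix (Fin k) (Fin k) (NCPoly ι)) : ℝ :=
  √((∑ i, ∑ j, (τ (ncStar (P j i) * P j i)).re) / k)

/-- `τ` satisfies the `C`-Bernstein–Markov property with constants `M_d = M k d` (for matrix
size `k` and degree `d`). -/
def HasBernsteinMarkov (τ : NCPoly ι →ₗ[ℂ] ℂ) (C : ℝ) (M : ℕ → ℕ → ℝ) : Prop :=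
  ∀ k : ℕ, 1 ≤ k →
    (∀ d : ℕ, 1 ≤ d → 0 ≤ M k d ∧ ∀ P : Matrix (Fin k) (Fin k) (NCPoly ι), HasDegreeEq P d →
      opNorm τ P ≤ ENNReal.ofReal (M k d * l2Norm τ P)) ∧
    limsup (fun d : ℕ => ENNReal.ofReal (M k d) ^ (1 / (d : ℝ))) atTop = ENNReal.ofReal C

/-! ### Siciak extremal functions -/

/-- The function `Φ²_{τ,d}`. -/
def phiTwoDeg (τ : NCPoly ι →ₗ[ℂ] ℂ) (d : ℕ) (A : ι → Matrix (Fin k) (Fin k) ℂ) : ℝ≥0∞ :=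
  ⨆ (P : Matrix (Fin k) (Fin k) (NCPoly ι)) (_ : HasDegreeLE P d) (_ : opNorm τ P ≤ 1),
    ENNReal.ofReal (((evalAt P A 1)ᴴ * evalAt P A 1).trace.re / k)

/-- The function `Φ^∞_{τ,d}`. -/
def phiInfDeg (τ : NCPoly ι →ₗ[ℂ] ℂ) (d : ℕ) (A : ι → Matrix (Fin k) (Fin k) ℂ) : ℝ≥0∞ :=
  ⨆ (P : Matrix (Fin k) (Fin k) (NCPoly ι)) (_ : HasDegreeLE P d) (_ : opNorm τ P ≤ 1),
    ENNReal.ofReal (matNorm (evalAt P A 1) ^ 2)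

/-- The upper semicontinuous regularization, the smallest upper semicontinuous majorant. -/
def uscReg {E : Type*} [TopologicalSpace E] (f : E → ℝ≥0∞) (z : E) : ℝ≥0∞ :=
  limsup f (𝓝 z)

/-- The function `Φ²_τ`. -/
def phiTwo (τ : NCPoly ι →ₗ[ℂ] ℂ) : (ι → Matrix (Fin k) (Fin k) ℂ) → ℝ≥0∞ :=
  uscReg fun A => limsup (fun d : ℕ => phiTwoDeg τ d A ^ (1 / (d : ℝ))) atTop

/-- The function `Φ^∞_τ`. -/
def phiInf (τ : NCPoly ι →ₗ[ℂ] ℂ) : (ι → Matrix (Fin k) (Fin k) ℂ) → ℝ≥0∞ :=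
  uscReg fun A => limsup (fun d : ℕ => phiInfDeg τ d A ^ (1 / (d : ℝ))) atTop

/-- The function `Σ²_τ`. -/
def sigmaTwo (τ : NCPoly ι →ₗ[ℂ] ℂ) : (ι → Matrix (Fin k) (Fin k) ℂ) → ℝ≥0∞ :=
  uscReg fun A => ⨆ (d : ℕ) (_ : 1 ≤ d), phiTwoDeg τ d A ^ (1 / (d : ℝ))

/-- The function `Σ^∞_τ`. -/
def sigmaInf (τ : NCPoly ι →ₗ[ℂ] ℂ) : (ι → Matrix (Fin k) (Fin k) ℂ) → ℝ≥0∞ :=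
  uscReg fun A => ⨆ (d : ℕ) (_ : 1 ≤ d), phiInfDeg τ d A ^ (1 / (d : ℝ))

/-- The constant `sup_q M_q^{2/q}`. -/
def bmSup (M : ℕ → ℝ) : ℝ≥0∞ :=
  ⨆ (q : ℕ) (_ : 1 ≤ q), ENNReal.ofReal (M q) ^ (2 / (q : ℝ))

end Siciak

/-! ### Plurisubharmonic functions and pluripolar sets -/

section Pluripotential

variable {E : Type*} [AddCommGroup E] [Module ℂ E] [TopologicalSpace E]

/-- The mean of `u` over the circle `{z + e^{iθ} b}`, as the mean of the positive part minus the
mean of the negative part. -/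
def circleMean (u : E → EReal) (z b : E) : EReal :=
  ((laverage (volume.restrict (Set.Ioc (-Real.pi) Real.pi)) fun θ : ℝ =>
      (u (z + Complex.exp (θ * Complex.I) • b)).toENNReal : ℝ≥0∞) : EReal)
    - ((laverage (volume.restrict (Set.Ioc (-Real.pi) Real.pi)) fun θ : ℝ =>
      (-u (z + Complex.exp (θ * Complex.I) • b)).toENNReal : ℝ≥0∞) : EReal)

/-- `u : D → [-∞, ∞)` is plurisubharmonic on the domain `D`: it is upper semicontinuous, not
identically `-∞`, and satisfies the sub-mean value inequality on every closed disc
`{z + ζ b : |ζ| ≤ 1}` contained in `D`. -/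
structure IsPlurisubharmonicOn (D : Set E) (u : E → EReal) : Prop where
  lt_top : ∀ z ∈ D, u z < ⊤
  usc : UpperSemicontinuousOn u D
  not_bot : ∃ z ∈ D, u z ≠ ⊥
  le_mean : ∀ z ∈ D, ∀ b : E, (∀ ζ : ℂ, ‖ζ‖ ≤ 1 → z + ζ • b ∈ D) → u z ≤ circleMean u z b

/-- `F` is pluripolar: near each of its points it is contained in the `-∞` set of a
plurisubharmonic function. -/
def IsPluripolar (F : Set E) : Prop :=
  ∀ a ∈ F, ∃ W : Set E, IsOpen W ∧ IsPreconnected W ∧ a ∈ W ∧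
    ∃ v : E → EReal, IsPlurisubharmonicOn W v ∧ F ∩ W ⊆ {z | v z = ⊥}

/-- `f` is finite quasi-everywhere: off a pluripolar set. -/
def FiniteQE (f : E → ℝ≥0∞) : Prop :=
  ∃ F : Set E, IsPluripolar F ∧ ∀ z ∉ F, f z < ⊤

end Pluripotential

end NCSiciak

end

/-! Write s = m + n. In each factor choose polynomials e_i that are orthonormal for τ_j and
orthogonal to everything of lower degree, hence centred. By freeness the alternating products of the
e_i, with neighbours from different factors, are orthonormal for τ. Those of total degree at most d
span the polynomials of degree at most d, so there are at most 1 + s + … + s^d ≤ s^{2d} of them.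

Upper bounds. Let P = ∑_a c_a ⊗ w_a be expanded in alternating products, with ‖P(a_τ)‖ ≤ 1. Applying
P to the vectors ∑_a x_a w_a^⋆ and reading off the component along 1 shows that the row (c_a) is a
contraction (`FreeSystem.sqNorm_sum_mulVec_le`), hence ‖P(A)(I)‖² ≤ ∑_a ‖w_a(A)‖². By the
Bernstein–Markov inequality e_i / M_{deg i} has operator norm at most 1, so it competes in the
extremal problem of its factor and ‖e_i(A)‖² ≤ M_{deg i}² Φ^∞_{deg i}(A). If these quantities are at
most L^{deg i}, then ‖w_a(A)‖² ≤ L^d for every a, and the count gives Φ^∞_{τ,d}(A) ≤ (s² L)^d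
(`FreeSystem.phiInfDeg_le`). For Σ^∞ any L above max_j Σ^∞_{τ_j} sup_q M_q^{2/q} will do.

Lower bounds. As a left module over one factor, the polynomials split orthogonally into copies of
that factor, indexed by the alternating words that do not start in it. Norms of matrix polynomials
therefore do not grow when they are viewed in the free product
(`FreeSystem.vecL2Norm_map_mulVec_le`), and every competitor for τ_j is one for τ.

Selfadjoint tuples. Φ^∞ only sees high degrees. At a selfadjoint A the powers (p^⋆ p)^N and the
C⋆-identity recover a bound on ‖p(A)‖ for each single p (`MulBound.matNorm_sq_le_limsup`). The
regularization needs bounds at all matrices near A: continuity serves the finitely many low degrees,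
a Hartogs lemma (`IsPolyEnvelope.hartogs`) the high ones.

Finiteness. Each Φ^∞_{τ_j,d} is an upper envelope of squared moduli of polynomials of degree at most
d. By Baire and Bernstein–Walsh, if Φ^∞_{τ_j} is finite at one point then Σ^∞_{τ_j} is finite
everywhere (`sigmaInf_lt_top`), and the upper bound transfers this to τ. -/

noncomputable section

namespace NCSiciak

/-! ### The involution -/

section Star

variable {ι : Type*}

theorem ncStar_single (w : FreeMonoid ι) (c : ℂ) :
    ncStar (MonoidAlgebra.single w c) = MonoidAlgebra.single (star w) (star c) := by
  simp [ncStar]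

theorem ncStar_zero : ncStar (0 : NCPoly ι) = 0 := by
  simp [ncStar]

theorem ncStar_add (p q : NCPoly ι) : ncStar (p + q) = ncStar p + ncStar q := by
  classical
  simp only [ncStar, MonoidAlgebra.coeff_add]
  rw [Finsupp.sum_add_index']
  · simp
  · intro w a b
    simp

theorem ncStar_smul (c : ℂ) (p : NCPoly ι) : ncStar (c • p) = star c • ncStar p := by
  induction p using MonoidAlgebra.induction_linear with
  | zero => simp [ncStar_zero]
  | add p q hp hq => rw [smul_add, ncStar_add, hp, hq, ncStar_add, smul_add]
  | single w a => simp [ncStar_single]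

theorem ncStar_sub (p q : NCPoly ι) : ncStar (p - q) = ncStar p - ncStar q := by
  have h : p - q = p + (-1 : ℂ) • q := by module
  rw [h, ncStar_add, ncStar_smul]
  simp [sub_eq_add_neg]

theorem ncStar_sum {α : Type*} (s : Finset α) (f : α → NCPoly ι) :
    ncStar (∑ a ∈ s, f a) = ∑ a ∈ s, ncStar (f a) := by
  classical
  induction s using Finset.induction_on with
  | empty => simp [ncStar_zero]
  | insert a s ha ih => rw [Finset.sum_insert ha, ncStar_add, ih, Finset.sum_insert ha]

theorem ncStar_one : ncStar (1 : NCPoly ι) = 1 := by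
  rw [MonoidAlgebra.one_def, ncStar_single]
  simp

theorem ncStar_mul (p q : NCPoly ι) : ncStar (p * q) = ncStar q * ncStar p := by
  induction p using MonoidAlgebra.induction_linear with
  | zero => simp [ncStar_zero]
  | add p p' hp hp' => rw [add_mul, ncStar_add, hp, hp', ncStar_add, mul_add]
  | single w a =>
    induction q using MonoidAlgebra.induction_linear with
    | zero => simp [ncStar_zero]
    | add q q' hq hq' => rw [mul_add, ncStar_add, hq, hq', ncStar_add, add_mul]
    | single v b => simp [ncStar_single, mul_comm]

theorem ncStar_ncStar (p : NCPoly ι) : ncStar (ncStar p) = p := by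
  induction p using MonoidAlgebra.induction_linear with
  | zero => simp [ncStar_zero]
  | add p p' hp hp' => rw [ncStar_add, ncStar_add, hp, hp']
  | single w a => simp [ncStar_single]

theorem star_freeMonoid_map {κ : Type*} (f : ι → κ) (w : FreeMonoid ι) :
    star (FreeMonoid.map f w) = FreeMonoid.map f (star w) := by
  induction w using FreeMonoid.inductionOn' with
  | one => simp
  | of_mul x w ih => simp [ih]

theorem ncStar_mapDomain {κ : Type*} (f : ι → κ) (p : NCPoly ι) :
    ncStar (MonoidAlgebra.mapDomainAlgHom ℂ ℂ (FreeMonoid.map f) p)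
      = MonoidAlgebra.mapDomainAlgHom ℂ ℂ (FreeMonoid.map f) (ncStar p) := by
  induction p using MonoidAlgebra.induction_linear with
  | zero => simp [ncStar_zero]
  | add p p' hp hp' => rw [map_add, ncStar_add, ncStar_add, hp, hp', map_add]
  | single w a => simp [ncStar_single, star_freeMonoid_map]

theorem ncStar_inclLeft {ι₁ ι₂ : Type*} (p : NCPoly ι₁) :
    ncStar (inclLeft p : NCPoly (ι₁ ⊕ ι₂)) = inclLeft (ncStar p) :=
  ncStar_mapDomain _ p

theorem ncStar_inclRight {ι₁ ι₂ : Type*} (p : NCPoly ι₂) :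
    ncStar (inclRight p : NCPoly (ι₁ ⊕ ι₂)) = inclRight (ncStar p) :=
  ncStar_mapDomain _ p

end Star

/-! ### Polynomials of bounded degree -/

section Degree

variable {ι : Type*}

/-- The space `ℂ⟨X⟩_d` of polynomials of degree at most `d`. -/
def degLE (ι : Type*) (d : ℕ) : Submodule ℂ (NCPoly ι) :=
  Submodule.span ℂ (monomial '' {w : FreeMonoid ι | w.length ≤ d})

theorem monomial_mem_degLE {w : FreeMonoid ι} {d : ℕ} (h : w.length ≤ d) :
    monomial w ∈ degLE ι d :=
  Submodule.subset_span ⟨w, h, rfl⟩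

/-- The span form suits inductions and dimension counts, the coefficient form matches `HasDegreeLE`.
-/
theorem mem_degLE {p : NCPoly ι} {d : ℕ} :
    p ∈ degLE ι d ↔ ∀ w : FreeMonoid ι, p.coeff w ≠ 0 → w.length ≤ d := by
  constructor
  · intro hp
    induction hp using Submodule.span_induction with
    | mem x hx =>
      classical
      obtain ⟨v, hv, rfl⟩ := hx
      intro w hw
      by_cases h : v = w
      · exact h ▸ hv
      · simp [monomial, h] at hw
    | zero => simp
    | add x y _ _ hx hy =>
      intro w hw
      by_cases h : x.coeff w = 0
      · exact hy w (by simpa [h] using hw)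
      · exact hx w h
    | smul c x _ hx =>
      intro w hw
      exact hx w (fun h => hw (by simp [h]))
  · intro h
    have e : p = ∑ w ∈ p.coeff.support, p.coeff w • monomial w := by
      apply MonoidAlgebra.coeff_injective
      rw [MonoidAlgebra.coeff_sum]
      conv_lhs => rw [← Finsupp.sum_single p.coeff]
      simp [Finsupp.sum, monomial]
    rw [e]
    exact Submodule.sum_mem _ fun w hw =>
      Submodule.smul_mem _ _ (monomial_mem_degLE (h w (by simpa using hw)))

theorem degLE_mono : Monotone (degLE ι) := fun _ _ h =>
  Submodule.span_mono (Set.image_mono fun _ hw => le_trans hw h)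

theorem mul_mem_degLE {p q : NCPoly ι} {a b : ℕ} (hp : p ∈ degLE ι a) (hq : q ∈ degLE ι b) :
    p * q ∈ degLE ι (a + b) := by
  have h := Submodule.mul_mem_mul hp hq
  rw [degLE, degLE, Submodule.span_mul_span] at h
  refine Submodule.span_mono ?_ h
  rintro _ ⟨_, ⟨v, hv, rfl⟩, _, ⟨w, hw, rfl⟩, rfl⟩
  refine ⟨v * w, ?_, by simp [monomial]⟩
  have : (v * w).length = v.length + w.length := FreeMonoid.length_mul v w
  simp only [Set.mem_ofPred_eq] at *
  omega

theorem one_mem_degLE (d : ℕ) : (1 : NCPoly ι) ∈ degLE ι d :=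
  monomial_mem_degLE (w := 1) (by simp)

theorem pow_mem_degLE {p : NCPoly ι} {a : ℕ} (hp : p ∈ degLE ι a) (N : ℕ) :
    p ^ N ∈ degLE ι (a * N) := by
  induction N with
  | zero => simpa using one_mem_degLE 0
  | succ N ih => rw [pow_succ]; exact mul_mem_degLE ih hp

theorem ncStar_mem_degLE {p : NCPoly ι} {a : ℕ} (hp : p ∈ degLE ι a) : ncStar p ∈ degLE ι a := by
  induction hp using Submodule.span_induction with
  | mem x hx =>
    obtain ⟨v, hv, rfl⟩ := hx
    rw [monomial, ncStar_single, star_one]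
    refine monomial_mem_degLE (w := star v) ?_
    have : (star v).length = v.length := 
      List.length_reverse (as := v.toList)
    rw [this]; exact hv
  | zero => rw [ncStar_zero]; exact Submodule.zero_mem _
  | add x y _ _ hx hy => rw [ncStar_add]; exact Submodule.add_mem _ hx hy
  | smul c x _ hx => rw [ncStar_smul]; exact Submodule.smul_mem _ _ hx

theorem mapDomain_mem_degLE {κ : Type*} (f : ι → κ) {p : NCPoly ι} {d : ℕ}
    (hp : p ∈ degLE ι d) :
    MonoidAlgebra.mapDomainAlgHom ℂ ℂ (FreeMonoid.map f) p ∈ degLE κ d := by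
  induction hp using Submodule.span_induction with
  | mem x hx =>
    obtain ⟨v, hv, rfl⟩ := hx
    have : MonoidAlgebra.mapDomainAlgHom ℂ ℂ (FreeMonoid.map f) (monomial v)
        = monomial (FreeMonoid.map f v) := by simp [monomial]
    rw [this]
    exact monomial_mem_degLE ((List.length_map (as := v.toList) f).trans_le hv)
  | zero => simp
  | add x y _ _ hx hy => rw [map_add]; exact Submodule.add_mem _ hx hy
  | smul c x _ hx => rw [map_smul]; exact Submodule.smul_mem _ _ hx

theorem mem_degLE_of_support (p : NCPoly ι) : ∃ d, p ∈ degLE ι d := by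
  refine ⟨p.coeff.support.sup FreeMonoid.length, mem_degLE.2 fun w hw => ?_⟩
  exact Finset.le_sup (f := FreeMonoid.length) (by simpa using hw)

theorem finite_words_le [Finite ι] (d : ℕ) : {w : FreeMonoid ι | w.length ≤ d}.Finite :=
  List.finite_length_le ι d

instance [Finite ι] (d : ℕ) : FiniteDimensional ℂ (degLE ι d) :=
  FiniteDimensional.span_of_finite ℂ ((finite_words_le d).image _)

theorem ncard_words_le [Fintype ι] (d : ℕ) :
    {w : FreeMonoid ι | w.length ≤ d}.ncard ≤ ∑ j ∈ Finset.range (d + 1), Fintype.card ι ^ j := by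
  classical
  induction d with
  | zero =>
    have : {w : FreeMonoid ι | w.length ≤ 0} = {1} := by
      ext w; simp
    rw [this]; simp
  | succ d ih =>
    have hsub : {w : FreeMonoid ι | w.length ≤ d + 1} ⊆ {w : FreeMonoid ι | w.length ≤ d} ∪
        Set.range (fun v : List.Vector ι (d + 1) => FreeMonoid.ofList v.1) := by
      intro w hw
      rcases Nat.lt_or_ge d w.length with h | h
      · right
        exact ⟨⟨w.toList, le_antisymm hw h⟩, rfl⟩
      · left; exact h
    have hfin : ({w : FreeMonoid ι | w.length ≤ d} ∪
        Set.range (fun v : List.Vector ι (d + 1) => FreeMonoid.ofList v.1)).Finite :=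
      (finite_words_le d).union (Set.finite_range _)
    calc _ ≤ _ := Set.ncard_le_ncard hsub hfin
      _ ≤ _ := Set.ncard_union_le _ _
      _ ≤ _ := by
        rw [Finset.sum_range_succ _ (d + 1)]
        refine add_le_add ih ?_
        rw [← Set.image_univ]
        refine (Set.ncard_image_le Set.finite_univ).trans ?_
        rw [Set.ncard_univ, Nat.card_eq_fintype_card, card_vector]

theorem finrank_degLE_le [Fintype ι] (d : ℕ) :
    Module.finrank ℂ (degLE ι d) ≤ ∑ j ∈ Finset.range (d + 1), Fintype.card ι ^ j := by
  have hfin : (monomial '' {w : FreeMonoid ι | w.length ≤ d}).Finite :=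
    (finite_words_le d).image _
  have : Fintype _ := hfin.fintype
  refine (finrank_span_le_card (R := ℂ) _).trans ?_
  rw [← Set.ncard_eq_toFinset_card']
  exact (Set.ncard_image_le (finite_words_le d)).trans (ncard_words_le d)

/-- The geometric sum is below s^(d+1), and d + 1 ≤ 2d because d ≥ 1. This crude bound is the source
of the factor (m+n)² in the theorem. -/
theorem geom_sum_le_pow_two_mul {s d : ℕ} (hs : 2 ≤ s) (hd : 1 ≤ d) :
    ∑ j ∈ Finset.range (d + 1), s ^ j ≤ s ^ (2 * d) := by
  have h : ∑ j ∈ Finset.range (d + 1), s ^ j ≤ s ^ (d + 1) :=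
    (Nat.geomSum_lt hs (by simp)).le
  exact h.trans (Nat.pow_le_pow_right (by omega) (by omega))

end Degree

/-! ### Positive functionals and operator norms -/

section Positive

variable {ι : Type*} {k : ℕ} {τ : NCPoly ι →ₗ[ℂ] ℂ}

/-- Positivity of a linear functional on `ℂ⟨X⟩`. -/
def IsPositive (τ : NCPoly ι →ₗ[ℂ] ℂ) : Prop :=
  ∀ p, 0 ≤ (τ (ncStar p * p)).re ∧ (τ (ncStar p * p)).im = 0

/-- Polarization: the forms of p, q, p + q and p + iq all have zero imaginary part. -/
theorem IsPositive.map_ncStar_mul (h : IsPositive τ) (p q : NCPoly ι) :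
    τ (ncStar q * p) = star (τ (ncStar p * q)) := by
  have h1 := (h (p + q)).2
  have h2 := (h (p + Complex.I • q)).2
  have hp := (h p).2
  have hq := (h q).2
  simp only [ncStar_add, ncStar_smul, add_mul, mul_add, map_add, map_smul, smul_mul_assoc,
    mul_smul_comm, smul_eq_mul, Complex.add_im, Complex.mul_im, Complex.mul_re, Complex.star_def,
    Complex.conj_I, Complex.neg_re, Complex.neg_im, Complex.I_re, Complex.I_im] at h1 h2
  apply Complex.ext
  · rw [Complex.star_def, Complex.conj_re]
    linarith
  · rw [Complex.star_def, Complex.conj_im]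
    linarith

theorem IsPositive.map_ncStar (h : IsPositive τ) (p : NCPoly ι) :
    τ (ncStar p) = star (τ p) := by
  simpa [ncStar_one] using h.map_ncStar_mul 1 p

/-- Cauchy–Schwarz against the vector 1, obtained from positivity at the centred element p − τ(p)1.
-/
theorem IsPositive.norm_sq_le (h : IsPositive τ) (h1 : τ 1 = 1) (p : NCPoly ι) :
    ‖τ p‖ ^ 2 ≤ (τ (ncStar p * p)).re := by
  have := (h (p - τ p • 1)).1
  simp only [ncStar_sub, ncStar_smul, ncStar_one, sub_mul, mul_sub, map_sub, map_smul,
    smul_mul_assoc, mul_smul_comm, one_mul, mul_one, h1, h.map_ncStar, smul_eq_mul] at this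
  have e : star (τ p) * τ p = ((‖τ p‖ ^ 2 : ℝ) : ℂ) := by
    rw [Complex.star_def, Complex.conj_mul']; push_cast; rfl
  rw [mul_comm (τ p) (star (τ p)), e] at this
  simp only [Complex.sub_re, Complex.ofReal_re] at this
  linarith

theorem vecL2Norm_nonneg (ξ : Fin k → NCPoly ι) : 0 ≤ vecL2Norm τ ξ := Real.sqrt_nonneg _

theorem IsPositive.sq_vecL2Norm (h : IsPositive τ) (ξ : Fin k → NCPoly ι) :
    vecL2Norm τ ξ ^ 2 = ∑ i, (τ (ncStar (ξ i) * ξ i)).re :=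
  Real.sq_sqrt (Finset.sum_nonneg fun i _ => (h (ξ i)).1)

theorem vecL2Norm_smul (c : ℂ) (ξ : Fin k → NCPoly ι) :
    vecL2Norm τ (c • ξ) = ‖c‖ * vecL2Norm τ ξ := by
  have e : ∀ i, (τ (ncStar ((c • ξ) i) * (c • ξ) i)).re
      = ‖c‖ ^ 2 * (τ (ncStar (ξ i) * ξ i)).re := by
    intro i
    have : τ (ncStar ((c • ξ) i) * (c • ξ) i) = ((‖c‖ ^ 2 : ℝ) : ℂ) * τ (ncStar (ξ i) * ξ i) := by
      rw [Pi.smul_apply, ncStar_smul, smul_mul_smul_comm, map_smul, smul_eq_mul,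
        Complex.star_def, Complex.conj_mul']
      push_cast; rfl
    rw [this, Complex.re_ofReal_mul]
  simp only [vecL2Norm, e]
  rw [← Finset.mul_sum, Real.sqrt_mul (by positivity), Real.sqrt_sq (norm_nonneg c)]

theorem opNorm_le_ofReal_iff {P : Matrix (Fin k) (Fin k) (NCPoly ι)} {c : ℝ} (hc : 0 ≤ c) :
    opNorm τ P ≤ ENNReal.ofReal c ↔
      ∀ ξ, vecL2Norm τ (P *ᵥ ξ) ≤ c * vecL2Norm τ ξ := by
  simp only [opNorm, iSup_le_iff, ENNReal.ofReal_le_ofReal_iff hc]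
  constructor
  · intro h ξ
    have hs : ∀ t : ℝ, 0 ≤ t → t * vecL2Norm τ ξ ≤ 1 → t * vecL2Norm τ (P *ᵥ ξ) ≤ c := by
      intro t ht h1
      have := h ((t : ℂ) • ξ) (by rw [vecL2Norm_smul]; simpa [abs_of_nonneg ht] using h1)
      rw [Matrix.mulVec_smul, vecL2Norm_smul] at this
      simpa [abs_of_nonneg ht] using this
    -- Faithfulness is not assumed, so `ξ` may be a null vector. All its multiples then lie in the
    -- unit ball, and a nonzero `P ξ` could be scaled to norm c + 1.
    rcases (vecL2Norm_nonneg (τ := τ) ξ).eq_or_lt with h0 | h0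
    · rw [← h0, mul_zero]
      by_contra! hlt
      have := hs ((c + 1) / vecL2Norm τ (P *ᵥ ξ)) (by positivity) (by rw [← h0]; simp)
      rw [div_mul_cancel₀ _ hlt.ne'] at this
      linarith
    · have := hs (vecL2Norm τ ξ)⁻¹ (by positivity) (by rw [inv_mul_cancel₀ h0.ne'])
      rwa [inv_mul_le_iff₀ h0, mul_comm] at this
  · intro h ξ hξ
    exact (h ξ).trans (mul_le_of_le_one_right hc hξ)

theorem opNorm_le_one_iff {P : Matrix (Fin k) (Fin k) (NCPoly ι)} :
    opNorm τ P ≤ 1 ↔ ∀ ξ, vecL2Norm τ (P *ᵥ ξ) ≤ vecL2Norm τ ξ := by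
  rw [← ENNReal.ofReal_one, opNorm_le_ofReal_iff zero_le_one]
  simp

theorem opNorm_smul_le_one {P : Matrix (Fin k) (Fin k) (NCPoly ι)} {c : ℝ} (hc : 0 < c)
    (h : ∀ ξ, vecL2Norm τ (P *ᵥ ξ) ≤ c * vecL2Norm τ ξ) :
    opNorm τ (((c⁻¹ : ℝ) : ℂ) • P) ≤ 1 := by
  rw [opNorm_le_one_iff]
  intro ξ
  rw [Matrix.smul_mulVec, vecL2Norm_smul, Complex.norm_real, Real.norm_eq_abs,
    abs_of_pos (inv_pos.2 hc), inv_mul_le_iff₀ hc]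
  exact h ξ

/-! ### Scalar polynomials as matrix polynomials -/

/-- The polynomial `I_k ⊗ p`. -/
def scalarPoly (k : ℕ) (p : NCPoly ι) : Matrix (Fin k) (Fin k) (NCPoly ι) :=
  Matrix.diagonal fun _ => p

theorem scalarPoly_mulVec (p : NCPoly ι) (ξ : Fin k → NCPoly ι) :
    scalarPoly k p *ᵥ ξ = fun i => p * ξ i := by
  ext1 i
  rw [scalarPoly, Matrix.mulVec_diagonal]

theorem evalAt_scalarPoly (p : NCPoly ι) (A : ι → Matrix (Fin k) (Fin k) ℂ) :
    evalAt (scalarPoly k p) A 1 = evalTuple A p := by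
  simp only [evalAt, mul_one]
  have : ∀ i : Fin k, ∑ j, Matrix.single i j (1 : ℂ) * evalTuple A (scalarPoly k p i j)
      = Matrix.single i i 1 * evalTuple A p := by
    intro i
    rw [Finset.sum_eq_single i]
    · simp [scalarPoly]
    · intro j _ hj
      simp [scalarPoly, Matrix.diagonal_apply_ne _ hj.symm]
    · simp
  simp only [this]
  rw [← Finset.sum_mul, Matrix.sum_single_one, one_mul]

theorem hasDegreeLE_iff {P : Matrix (Fin k) (Fin k) (NCPoly ι)} {d : ℕ} :
    HasDegreeLE P d ↔ ∀ i j, P i j ∈ degLE ι d := by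
  simp only [HasDegreeLE, mem_degLE]

theorem HasDegreeLE.mono {P : Matrix (Fin k) (Fin k) (NCPoly ι)} {a b : ℕ} (h : HasDegreeLE P a)
    (hab : a ≤ b) : HasDegreeLE P b := fun i j w hw => (h i j w hw).trans hab

theorem hasDegreeLE_scalarPoly {p : NCPoly ι} {d : ℕ} (hp : p ∈ degLE ι d) :
    HasDegreeLE (scalarPoly k p) d := by
  rw [hasDegreeLE_iff]
  intro i j
  by_cases h : i = j
  · subst h; simpa [scalarPoly] using hp
  · simp [scalarPoly, h]

theorem HasDegreeLE.smul {P : Matrix (Fin k) (Fin k) (NCPoly ι)} {d : ℕ} (h : HasDegreeLE P d)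
    (c : ℂ) : HasDegreeLE (c • P) d := by
  rw [hasDegreeLE_iff] at h ⊢
  exact fun i j => Submodule.smul_mem _ _ (h i j)

theorem hasDegreeEq_scalarPoly (hk : 1 ≤ k) {p : NCPoly ι} {d : ℕ} (hd : 1 ≤ d)
    (hp : p ∈ degLE ι d) (hp' : p ∉ degLE ι (d - 1)) : HasDegreeEq (scalarPoly k p) d := by
  refine ⟨hasDegreeLE_scalarPoly hp, ⟨0, hk⟩, ⟨0, hk⟩, ?_⟩
  rw [mem_degLE] at hp'
  push Not at hp'
  obtain ⟨w, hw, hl⟩ := hp'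
  refine ⟨w, by simpa [scalarPoly] using hw, ?_⟩
  have := mem_degLE.1 hp w hw
  omega

theorem evalAt_smul (c : ℂ) (P : Matrix (Fin k) (Fin k) (NCPoly ι))
    (A : ι → Matrix (Fin k) (Fin k) ℂ) (C : Matrix (Fin k) (Fin k) ℂ) :
    evalAt (c • P) A C = c • evalAt P A C := by
  simp [evalAt, Finset.smul_sum]

/-- The operator norm of left multiplication by `p` is at most `c`. -/
def MulBound (τ : NCPoly ι →ₗ[ℂ] ℂ) (p : NCPoly ι) (c : ℝ) : Prop :=
  ∀ f, (τ (ncStar (p * f) * (p * f))).re ≤ c ^ 2 * (τ (ncStar f * f)).re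

theorem MulBound.one : MulBound τ 1 1 := fun f => by simp

theorem MulBound.mul {p q : NCPoly ι} {a b : ℝ} (hp : MulBound τ p a) (hq : MulBound τ q b) :
    MulBound τ (p * q) (a * b) := fun f => by
  rw [mul_assoc, mul_pow, mul_assoc]
  exact (hp _).trans (mul_le_mul_of_nonneg_left (hq f) (sq_nonneg a))

theorem MulBound.pow {p : NCPoly ι} {a : ℝ} (hp : MulBound τ p a) (N : ℕ) :
    MulBound τ (p ^ N) (a ^ N) := by
  induction N with
  | zero => simpa using MulBound.one
  | succ N ih => rw [pow_succ, pow_succ]; exact ih.mul hp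

/-- Expand 0 ≤ ‖p p^⋆ f − c² f‖² and bound ‖p p^⋆ f‖² by c² ‖p^⋆ f‖²; what remains is c² ‖p^⋆ f‖² ≤
c⁴ ‖f‖². Only positivity of the functional enters, not traciality. -/
theorem MulBound.star (h : IsPositive τ) {p : NCPoly ι} {c : ℝ} (hc : 0 < c)
    (hp : MulBound τ p c) :
    MulBound τ (ncStar p) c := fun f => by
  have h1 := hp (ncStar p * f)
  have h2 := (h (p * (ncStar p * f) - ((c ^ 2 : ℝ) : ℂ) • f)).1
  have e1 : τ (ncStar (p * (ncStar p * f)) * f) = τ (ncStar (ncStar p * f) * (ncStar p * f)) := by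
    simp only [ncStar_mul, ncStar_ncStar, mul_assoc]
  have e2 : τ (ncStar f * (p * (ncStar p * f))) = τ (ncStar (ncStar p * f) * (ncStar p * f)) := by
    simp only [ncStar_mul, ncStar_ncStar, mul_assoc]
  simp only [ncStar_sub, ncStar_smul, sub_mul, mul_sub, map_sub, map_smul, smul_mul_assoc,
    mul_smul_comm, e1, e2, smul_eq_mul, Complex.star_def, Complex.conj_ofReal, Complex.sub_re,
    Complex.re_ofReal_mul] at h2
  have h3 : c ^ 2 * (τ (ncStar (ncStar p * f) * (ncStar p * f))).re
      ≤ c ^ 2 * (c ^ 2 * (τ (ncStar f * f)).re) := by linarith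
  exact le_of_mul_le_mul_left h3 (by positivity)

theorem MulBound.vecL2Norm_le (h : IsPositive τ) {p : NCPoly ι} {c : ℝ} (hc : 0 ≤ c)
    (hp : MulBound τ p c) (ξ : Fin k → NCPoly ι) :
    vecL2Norm τ (scalarPoly k p *ᵥ ξ) ≤ c * vecL2Norm τ ξ := by
  rw [← abs_of_nonneg (vecL2Norm_nonneg (τ := τ) (scalarPoly k p *ᵥ ξ))]
  refine abs_le_of_sq_le_sq ?_ (mul_nonneg hc (vecL2Norm_nonneg _))
  rw [mul_pow, h.sq_vecL2Norm, h.sq_vecL2Norm, Finset.mul_sum]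
  refine Finset.sum_le_sum fun i _ => ?_
  rw [scalarPoly_mulVec]
  exact hp (ξ i)

theorem mulBound_of_opNorm (h : IsPositive τ) (hk : 1 ≤ k) {p : NCPoly ι} {c : ℝ} (hc : 0 ≤ c)
    (hp : opNorm τ (scalarPoly k p) ≤ ENNReal.ofReal c) : MulBound τ p c := fun f => by
  have := (opNorm_le_ofReal_iff hc).1 hp (Pi.single ⟨0, hk⟩ f)
  have h2 := pow_le_pow_left₀ (vecL2Norm_nonneg _) this 2
  rw [mul_pow, h.sq_vecL2Norm, h.sq_vecL2Norm, scalarPoly_mulVec] at h2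
  rw [Finset.sum_eq_single ⟨0, hk⟩, Finset.sum_eq_single ⟨0, hk⟩] at h2
  · simpa using h2
  all_goals simp +contextual [ncStar_zero]

end Positive

/-! ### Orthonormal polynomials -/

/-- A filtered inner product space has an orthonormal family adapted to the filtration. -/
theorem exists_orthonormal_adapted {E : Type*} [NormedAddCommGroup E] [InnerProductSpace ℂ E]
    (V : ℕ → Submodule ℂ E) (hV : Monotone V) [∀ d, FiniteDimensional ℂ (V d)] :
    ∃ (I : Type) (deg : I → ℕ) (e : I → E), (∀ i, 1 ≤ deg i) ∧ (∀ d, {i | deg i = d}.Finite) ∧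
      Orthonormal ℂ e ∧ (∀ i, e i ∈ V (deg i)) ∧ (∀ i, ∀ v ∈ V (deg i - 1), inner ℂ v (e i) = 0) ∧
      ∀ d, V d ≤ V 0 ⊔ Submodule.span ℂ (e '' {i | deg i ≤ d}) := by
  -- Gram–Schmidt by layers: `W d` is the part of degree d + 1 orthogonal to degree d. The shift by
  -- one leaves the constants to `V 0`, so every basis vector has degree at least 1.
  let W : ℕ → Submodule ℂ E := fun d => V (d + 1) ⊓ (V d)ᗮ
  have hWfin : ∀ d, FiniteDimensional ℂ (W d) := fun d =>
    Submodule.finiteDimensional_of_le (inf_le_left : W d ≤ V (d + 1))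
  let b : ∀ d, OrthonormalBasis (Fin (Module.finrank ℂ (W d))) ℂ (W d) := fun d =>
    stdOrthonormalBasis ℂ (W d)
  refine ⟨Σ d : ℕ, Fin (Module.finrank ℂ (W d)), fun i => i.1 + 1, fun i => (b i.1 i.2 : E),
    fun i => by simp, ?_, ?_, ?_, ?_, ?_⟩
  · intro d
    refine (Set.finite_range fun j : Fin (Module.finrank ℂ (W (d - 1))) =>
      (⟨d - 1, j⟩ : Σ d : ℕ, Fin (Module.finrank ℂ (W d)))).subset ?_
    rintro ⟨c, j⟩ hc
    obtain rfl : c + 1 = d := hc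
    exact ⟨j, rfl⟩
  · have hlt : ∀ (c d : ℕ) (x : W c) (y : W d), c < d → inner ℂ (x : E) (y : E) = 0 := by
      intro c d x y h
      exact (Submodule.mem_orthogonal _ _).1 y.2.2 _ (hV (Nat.succ_le_of_lt h) x.2.1)
    refine ⟨fun i => ?_, ?_⟩
    · exact (b i.1).orthonormal.1 i.2
    · rintro ⟨c, i⟩ ⟨d, j⟩ hne
      rcases lt_trichotomy c d with h | h | h
      · exact hlt _ _ _ _ h
      · subst h
        have := (b c).orthonormal.2 (i := i) (j := j) (by rintro rfl; exact hne rfl)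
        simpa using this
      · exact inner_eq_zero_symm.1 (hlt _ _ _ _ h)
  · exact fun i => (b i.1 i.2).2.1
  · exact fun i v hv => (Submodule.mem_orthogonal _ _).1 (b i.1 i.2).2.2 _ (by simpa using hv)
  · intro d
    induction d with
    | zero => exact le_sup_left
    | succ d ih =>
      intro x hx
      obtain ⟨y, hy, z, hz, rfl⟩ := (V d).exists_add_mem_mem_orthogonal x
      have hz' : z ∈ W d := ⟨by
        have := (V (d + 1)).sub_mem hx (hV (Nat.le_succ d) hy)
        simpa using this, hz⟩
      refine Submodule.add_mem _ ?_ ?_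
      · obtain ⟨u, hu, v, hv, rfl⟩ := Submodule.mem_sup.1 (ih hy)
        exact Submodule.add_mem_sup hu (Submodule.span_mono
          (Set.image_mono fun i hi => Nat.le_succ_of_le hi) hv)
      · refine (le_sup_right : _ ≤ V 0 ⊔ _) ?_
        have := (b d).sum_repr ⟨z, hz'⟩
        have h2 : z = ∑ i, (b d).repr ⟨z, hz'⟩ i • ((b d i : W d) : E) := by
          have := congrArg (Subtype.val : W d → E) this
          simpa using this.symm
        rw [h2]
        refine Submodule.sum_mem _ fun i _ => Submodule.smul_mem _ _ (Submodule.subset_span ?_)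
        exact ⟨⟨d, i⟩, le_refl (d + 1), rfl⟩

variable {ι : Type*}

theorem IsFaithfulBoundedTrace.isPositive {τ : NCPoly ι →ₗ[ℂ] ℂ} (h : IsFaithfulBoundedTrace τ) :
    IsPositive τ := h.nonneg

/-- An orthonormal family of centred polynomials for `τ` which together with `1` spans the
polynomials of each degree. -/
structure IsOrthoSystem {I : Type*} (τ : NCPoly ι →ₗ[ℂ] ℂ) (deg : I → ℕ) (e : I → NCPoly ι) :
    Prop where
  one_le_deg : ∀ i, 1 ≤ deg i
  finite_deg : ∀ d, {i | deg i = d}.Finite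
  mem : ∀ i, e i ∈ degLE ι (deg i)
  notMem : ∀ i, e i ∉ degLE ι (deg i - 1)
  centred : ∀ i, τ (e i) = 0
  norm_one : ∀ i, τ (ncStar (e i) * e i) = 1
  ortho : ∀ i j, i ≠ j → τ (ncStar (e i) * e j) = 0
  le_span : ∀ d, degLE ι d ≤ Submodule.span ℂ {1} ⊔ Submodule.span ℂ (e '' {i | deg i ≤ d})

theorem degLE_zero : degLE ι 0 = Submodule.span ℂ {1} := by
  have : {w : FreeMonoid ι | w.length ≤ 0} = {1} := by
    ext w; simp
  rw [degLE, this, Set.image_singleton]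
  rfl

/-- Faithfulness turns τ(p^⋆ q) into an inner product. Orthogonality to the lower degrees makes each
vector centred, since 1 is among them, and of exact degree, as the Bernstein–Markov inequality
requires. -/
theorem exists_isOrthoSystem [Finite ι] {τ : NCPoly ι →ₗ[ℂ] ℂ} (h : IsFaithfulBoundedTrace τ) :
    ∃ (I : Type) (deg : I → ℕ) (e : I → NCPoly ι), IsOrthoSystem τ deg e := by
  let core : InnerProductSpace.Core ℂ (NCPoly ι) :=
    { inner := fun p q => τ (ncStar p * q)
      conj_inner_symm := fun p q => (h.isPositive.map_ncStar_mul q p).symm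
      re_inner_nonneg := fun p => (h.nonneg p).1
      add_left := fun p q r => by simp only [ncStar_add, add_mul, map_add]
      smul_left := fun p q c => by
        simp only [ncStar_smul, smul_mul_assoc, map_smul, smul_eq_mul]; rfl
      definite := fun p hp => h.faithful p hp }
  let _ : NormedAddCommGroup (NCPoly ι) := core.toNormedAddCommGroup
  let _ : InnerProductSpace ℂ (NCPoly ι) := InnerProductSpace.ofCore core.toCore
  have hin : ∀ p q : NCPoly ι, inner ℂ p q = τ (ncStar p * q) := fun _ _ => rfl
  obtain ⟨I, deg, e, h1, h2, h3, h4, h5, h6⟩ := exists_orthonormal_adapted (degLE ι) degLE_mono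
  have hone : ∀ i, τ (ncStar (e i) * e i) = 1 := fun i => by
    rw [← hin, inner_self_eq_norm_sq_to_K, h3.1 i]; simp
  refine ⟨I, deg, e, h1, h2, h4, fun i hi => ?_, fun i => ?_, hone, fun i j hij => ?_, ?_⟩
  · have := h5 i _ hi
    rw [hin, hone] at this
    exact one_ne_zero this
  · have := h5 i 1 (one_mem_degLE _)
    rwa [hin, ncStar_one, one_mul] at this
  · rw [← hin]; exact h3.2 hij
  · intro d
    have := h6 d
    rwa [degLE_zero] at this

/-! ### Orthonormal alternating products -/

section FreeSystem

variable {κ J : Type*}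

/-- Two filtered star algebras `⋃ B true a`, `⋃ B false a` that are free with respect to `τ`, with
adapted orthonormal families of centred elements `e j` of colour `col j`. -/
structure FreeSystem (τ : NCPoly κ →ₗ[ℂ] ℂ) (B : Bool → ℕ → Submodule ℂ (NCPoly κ))
    (col : J → Bool) (deg : J → ℕ) (e : J → NCPoly κ) : Prop where
  map_one : τ 1 = 1
  one_mem : ∀ c a, 1 ∈ B c a
  mul_mem : ∀ {c a b x y}, x ∈ B c a → y ∈ B c b → x * y ∈ B c (a + b)
  star_mem : ∀ {c a x}, x ∈ B c a → ncStar x ∈ B c a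
  le_deg : ∀ c a, B c a ≤ degLE κ a
  star_centred : ∀ {c a x}, x ∈ B c a → τ x = 0 → τ (ncStar x) = 0
  free : ∀ l : List (Bool × NCPoly κ), l ≠ [] → l.IsChain (fun a b => a.1 ≠ b.1) →
    (∀ a ∈ l, (∃ n, a.2 ∈ B a.1 n) ∧ τ a.2 = 0) → τ (l.map Prod.snd).prod = 0
  letter : ∀ x : κ, ∃ c, monomial (FreeMonoid.of x) ∈ B c 1
  mem : ∀ j, e j ∈ B (col j) (deg j)
  centred : ∀ j, τ (e j) = 0
  norm_one : ∀ i, τ (ncStar (e i) * e i) = 1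
  ortho : ∀ i j, col i = col j → i ≠ j → τ (ncStar (e i) * e j) = 0
  conorm_one : ∀ i, τ (e i * ncStar (e i)) = 1
  coortho : ∀ i j, col i = col j → i ≠ j → τ (e i * ncStar (e j)) = 0
  le_span : ∀ c a, B c a ≤ Submodule.span ℂ {1} ⊔
    Submodule.span ℂ (e '' {j | col j = c ∧ deg j ≤ a})

theorem ncStar_list_prod (l : List (NCPoly κ)) :
    ncStar l.prod = (l.reverse.map ncStar).prod := by
  induction l with
  | nil => simp [ncStar_one]
  | cons a l ih => simp [ncStar_mul, ih]

namespace FreeSystem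

variable {τ : NCPoly κ →ₗ[ℂ] ℂ} {B : Bool → ℕ → Submodule ℂ (NCPoly κ)}
  {col : J → Bool} {deg : J → ℕ} {e : J → NCPoly κ}

/-- Reversing and starring the first list and appending the second gives another alternating list of
centred elements, because the two heads that meet have different colours. Freeness applies to it. -/
theorem map_star_prod_mul_prod (F : FreeSystem τ B col deg e) {l l' : List (Bool × NCPoly κ)}
    (hl : l.IsChain (fun a b => a.1 ≠ b.1)) (hl' : l'.IsChain (fun a b => a.1 ≠ b.1))
    (hc : ∀ a ∈ l, (∃ n, a.2 ∈ B a.1 n) ∧ τ a.2 = 0)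
    (hc' : ∀ a ∈ l', (∃ n, a.2 ∈ B a.1 n) ∧ τ a.2 = 0)
    (hh : ∀ a ∈ l.head?, ∀ b ∈ l'.head?, a.1 ≠ b.1) (hne : l ≠ [] ∨ l' ≠ []) :
    τ (ncStar (l.map Prod.snd).prod * (l'.map Prod.snd).prod) = 0 := by
  have key := F.free (l.reverse.map (fun a => (a.1, ncStar a.2)) ++ l') ?_ ?_ ?_
  · rw [List.map_append, List.prod_append] at key
    rw [ncStar_list_prod, ← List.map_reverse, List.map_map]
    rwa [List.map_map] at key
  · rcases hne with h | h <;> simp [h]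
  · rw [List.isChain_append]
    refine ⟨?_, hl', ?_⟩
    · rw [List.isChain_map, List.isChain_reverse]
      exact hl.imp fun a b h => h.symm
    · intro x hx y hy
      rw [List.getLast?_map, List.getLast?_reverse] at hx
      obtain ⟨a, ha, rfl⟩ := Option.mem_map.1 hx
      exact hh a ha y hy
  · intro a ha
    rcases List.mem_append.1 ha with ha | ha
    · obtain ⟨b, hb, rfl⟩ := List.mem_map.1 ha
      obtain ⟨⟨n, hn⟩, h0⟩ := hc b (List.mem_reverse.1 hb)
      exact ⟨⟨n, F.star_mem hn⟩, F.star_centred hn h0⟩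
    · exact hc' a ha

/-- The product of the letters of an alternating word. -/
def wordProd (e : J → NCPoly κ) (l : List J) : NCPoly κ := (l.map e).prod

/-- Words in which neighbouring letters have different colours. -/
abbrev Alt (col : J → Bool) (l : List J) : Prop := l.IsChain (fun a b => col a ≠ col b)

@[simp] theorem wordProd_nil (e : J → NCPoly κ) : wordProd e [] = 1 := rfl

@[simp] theorem wordProd_cons (e : J → NCPoly κ) (a : J) (l : List J) :
    wordProd e (a :: l) = e a * wordProd e l := by simp [wordProd]

theorem wordProd_eq (col : J → Bool) (e : J → NCPoly κ) (l : List J) :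
    wordProd e l = ((l.map fun j => (col j, e j)).map Prod.snd).prod := by
  simp [wordProd, Function.comp_def]

theorem map_star_wordProd_mul_wordProd (F : FreeSystem τ B col deg e) {l l' : List J}
    (hl : Alt col l) (hl' : Alt col l') (hh : ∀ a ∈ l.head?, ∀ b ∈ l'.head?, col a ≠ col b)
    (hne : l ≠ [] ∨ l' ≠ []) : τ (ncStar (wordProd e l) * wordProd e l') = 0 := by
  rw [wordProd_eq col, wordProd_eq col]
  have hc : ∀ l : List J, ∀ a ∈ l.map (fun j => (col j, e j)),
      (∃ n, a.2 ∈ B a.1 n) ∧ τ a.2 = 0 := by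
    intro l a ha
    obtain ⟨j, -, rfl⟩ := List.mem_map.1 ha
    exact ⟨⟨deg j, F.mem j⟩, F.centred j⟩
  refine F.map_star_prod_mul_prod ((List.isChain_map _).2 hl) ((List.isChain_map _).2 hl')
    (hc l) (hc l') ?_ (by simpa using hne)
  intro a ha b hb
  rw [List.head?_map] at ha hb
  obtain ⟨i, hi, rfl⟩ := Option.mem_map.1 ha
  obtain ⟨j, hj, rfl⟩ := Option.mem_map.1 hb
  exact hh i hi j hj

/-- Split x into its centred part and τ(x)1. The centred part fits between the two words as one more
alternating letter, so its contribution vanishes. -/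
theorem map_star_wordProd_mul_mem_mul_wordProd (F : FreeSystem τ B col deg e) {c : Bool} {n : ℕ}
    {x : NCPoly κ} (hx : x ∈ B c n) {l l' : List J} (hl : Alt col l) (hl' : Alt col l')
    (hh : ∀ a ∈ l.head?, col a ≠ c) (hh' : ∀ a ∈ l'.head?, col a ≠ c) :
    τ (ncStar (wordProd e l) * (x * wordProd e l'))
      = τ x * τ (ncStar (wordProd e l) * wordProd e l') := by
  have hc : ∀ l : List J, ∀ a ∈ l.map (fun j => (col j, e j)),
      (∃ n, a.2 ∈ B a.1 n) ∧ τ a.2 = 0 := by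
    intro l a ha
    obtain ⟨j, -, rfl⟩ := List.mem_map.1 ha
    exact ⟨⟨deg j, F.mem j⟩, F.centred j⟩
  have h0 : τ (x - τ x • 1) = 0 := by simp [F.map_one]
  have key := F.map_star_prod_mul_prod (l := l.map fun j => (col j, e j))
    (l' := (c, x - τ x • 1) :: l'.map fun j => (col j, e j))
    ((List.isChain_map _).2 hl) ?_ (hc l) ?_ ?_ (by simp)
  · rw [List.map_cons, List.prod_cons, ← wordProd_eq, ← wordProd_eq] at key
    rw [sub_mul, mul_sub, map_sub, sub_eq_zero] at key
    rw [key]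
    simp
  · rw [List.isChain_cons]
    refine ⟨?_, (List.isChain_map _).2 hl'⟩
    intro b hb
    rw [List.head?_map] at hb
    obtain ⟨j, hj, rfl⟩ := Option.mem_map.1 hb
    exact (hh' j hj).symm
  · intro a ha
    rcases List.mem_cons.1 ha with rfl | ha
    · exact ⟨⟨n, Submodule.sub_mem _ hx (Submodule.smul_mem _ _ (F.one_mem c n))⟩, h0⟩
    · exact hc l' a ha
  · intro a ha b hb
    rw [List.head?_map] at ha
    obtain ⟨i, hi, rfl⟩ := Option.mem_map.1 ha
    obtain rfl : _ = b := by simpa using hb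
    exact hh i hi

theorem alt_cons {a : J} {l : List J} (h : Alt col (a :: l)) :
    Alt col l ∧ ∀ b ∈ l.head?, col b ≠ col a := by
  rw [Alt, List.isChain_cons] at h
  exact ⟨h.2, fun b hb => (h.1 b hb).symm⟩

/-- Peel off first letters. If they share a colour, the element e_a^⋆ e_b in the middle may be
replaced by its trace, which is the Kronecker delta of a and b; if not, the whole product is
alternating and centred. -/
theorem ortho_wordProd (F : FreeSystem τ B col deg e) [DecidableEq J] {l l' : List J}
    (hl : Alt col l) (hl' : Alt col l') :
    τ (ncStar (wordProd e l) * wordProd e l') = if l = l' then 1 else 0 := by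
  induction l generalizing l' with
  | nil =>
    cases l' with
    | nil => simp [ncStar_one, F.map_one]
    | cons b l' =>
      rw [F.map_star_wordProd_mul_wordProd hl hl' (by simp) (by simp)]; simp
  | cons a l ih =>
    cases l' with
    | nil =>
      rw [F.map_star_wordProd_mul_wordProd hl hl' (by simp) (by simp)]; simp
    | cons b l' =>
      by_cases hab : col a = col b
      · obtain ⟨h1, h2⟩ := alt_cons hl
        obtain ⟨h1', h2'⟩ := alt_cons hl'
        have e1 : ncStar (wordProd e (a :: l)) * wordProd e (b :: l')
            = ncStar (wordProd e l) * (ncStar (e a) * e b * wordProd e l') := by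
          simp only [wordProd_cons, ncStar_mul, mul_assoc]
        have hx : ncStar (e a) * e b ∈ B (col a) (deg a + deg b) :=
          F.mul_mem (F.star_mem (F.mem a)) (hab ▸ F.mem b)
        rw [e1, F.map_star_wordProd_mul_mem_mul_wordProd hx h1 h1' h2 (hab ▸ h2'), ih h1 h1']
        by_cases h : a = b
        · subst h
          rw [F.norm_one, one_mul]
          simp
        · rw [F.ortho a b hab h]
          simp [h]
      · rw [F.map_star_wordProd_mul_wordProd hl hl' (by simpa using hab) (by simp),
          if_neg fun h => hab (by rw [(List.cons.inj h).1])]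

/-- The conditions on e and on its adjoints are exchanged, so each statement about words has a
mirror image. -/
theorem star (F : FreeSystem τ B col deg e) :
    FreeSystem τ B col deg (fun j => ncStar (e j)) where
  map_one := F.map_one
  one_mem := F.one_mem
  mul_mem := F.mul_mem
  star_mem := F.star_mem
  le_deg := F.le_deg
  star_centred := F.star_centred
  free := F.free
  letter := F.letter
  mem j := F.star_mem (F.mem j)
  centred j := F.star_centred (F.mem j) (F.centred j)
  norm_one i := by rw [ncStar_ncStar]; exact F.conorm_one i
  ortho i j h hij := by rw [ncStar_ncStar]; exact F.coortho i j h hij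
  conorm_one i := by rw [ncStar_ncStar]; exact F.norm_one i
  coortho i j h hij := by rw [ncStar_ncStar]; exact F.ortho i j h hij
  le_span c a := by
    intro x hx
    have h1 := F.le_span c a (F.star_mem hx)
    obtain ⟨y, hy, z, hz, hyz⟩ := Submodule.mem_sup.1 h1
    rw [← ncStar_ncStar x, ← hyz, ncStar_add]
    refine Submodule.add_mem_sup ?_ ?_
    · obtain ⟨t, rfl⟩ := Submodule.mem_span_singleton.1 hy
      rw [ncStar_smul, ncStar_one]
      exact Submodule.smul_mem _ _ (Submodule.mem_span_singleton_self _)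
    · clear hyz
      induction hz using Submodule.span_induction with
      | mem x hx =>
        obtain ⟨j, hj, rfl⟩ := hx
        exact Submodule.subset_span ⟨j, hj, rfl⟩
      | zero => rw [ncStar_zero]; exact Submodule.zero_mem _
      | add x y _ _ hx hy => rw [ncStar_add]; exact Submodule.add_mem _ hx hy
      | smul t x _ hx => rw [ncStar_smul]; exact Submodule.smul_mem _ _ hx

theorem ncStar_wordProd (e : J → NCPoly κ) (l : List J) :
    ncStar (wordProd e l) = wordProd (fun j => ncStar (e j)) l.reverse := by
  rw [wordProd, ncStar_list_prod, wordProd, ← List.map_reverse, List.map_map]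
  rfl

theorem Alt.reverse {l : List J} (hl : Alt col l) : Alt col l.reverse := by
  rw [Alt, List.isChain_reverse]
  exact hl.imp fun _ _ h => h.symm

/-- The adjoints of the alternating products are orthonormal too. They are the test vectors in the
upper bound, where P acts from the left. -/
theorem coortho_wordProd (F : FreeSystem τ B col deg e) [DecidableEq J] {l l' : List J}
    (hl : Alt col l) (hl' : Alt col l') :
    τ (wordProd e l * ncStar (wordProd e l')) = if l = l' then 1 else 0 := by
  have := F.star.ortho_wordProd hl.reverse hl'.reverse
  rw [← ncStar_wordProd, ← ncStar_wordProd, ncStar_ncStar] at this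
  rw [this]
  simp

/-- The degree of an alternating word. -/
def wordDeg (deg : J → ℕ) (l : List J) : ℕ := (l.map deg).sum

@[simp] theorem wordDeg_cons (deg : J → ℕ) (a : J) (l : List J) :
    wordDeg deg (a :: l) = deg a + wordDeg deg l := by simp [wordDeg]

@[simp] theorem wordDeg_nil (deg : J → ℕ) : wordDeg deg [] = 0 := rfl

theorem wordProd_mem_degLE (F : FreeSystem τ B col deg e) (l : List J) :
    wordProd e l ∈ degLE κ (wordDeg deg l) := by
  induction l with
  | nil => exact one_mem_degLE _
  | cons a l ih =>
    rw [wordProd_cons, wordDeg_cons]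
    exact mul_mem_degLE (F.le_deg _ _ (F.mem a)) ih

/-- The alternating words of degree at most `d`. -/
abbrev AltDeg (col : J → Bool) (deg : J → ℕ) (d : ℕ) : Type _ :=
  {l : List J // Alt col l ∧ wordDeg deg l ≤ d}

/-- The span of the alternating products of degree at most `d`. -/
def altSpan (col : J → Bool) (deg : J → ℕ) (e : J → NCPoly κ) (d : ℕ) : Submodule ℂ (NCPoly κ) :=
  Submodule.span ℂ (Set.range fun l : AltDeg col deg d => wordProd e l.1)

theorem wordProd_mem_altSpan {l : List J} {d : ℕ} (hl : Alt col l) (hd : wordDeg deg l ≤ d) :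
    wordProd e l ∈ altSpan col deg e d :=
  Submodule.subset_span ⟨⟨l, hl, hd⟩, rfl⟩

theorem mem_mul_wordProd_mem_altSpan (F : FreeSystem τ B col deg e) {c : Bool} {a d : ℕ}
    {x : NCPoly κ} (hx : x ∈ B c a) {l : List J} (hl : Alt col l) (hh : ∀ b ∈ l.head?, col b ≠ c)
    (hd : a + wordDeg deg l ≤ d) : x * wordProd e l ∈ altSpan col deg e d := by
  obtain ⟨y, hy, z, hz, rfl⟩ := Submodule.mem_sup.1 (F.le_span c a hx)
  rw [add_mul]
  refine Submodule.add_mem _ ?_ ?_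
  · obtain ⟨t, rfl⟩ := Submodule.mem_span_singleton.1 hy
    rw [smul_mul_assoc, one_mul]
    exact Submodule.smul_mem _ _ (wordProd_mem_altSpan hl (by omega))
  · clear hx
    induction hz using Submodule.span_induction with
    | mem x hx =>
      obtain ⟨j, ⟨rfl, hj⟩, rfl⟩ := hx
      rw [← wordProd_cons]
      refine wordProd_mem_altSpan ?_ (by rw [wordDeg_cons]; omega)
      rw [Alt, List.isChain_cons]
      exact ⟨fun b hb => (hh b hb).symm, hl⟩
    | zero => rw [zero_mul]; exact Submodule.zero_mem _
    | add x y _ _ hx hy => rw [add_mul]; exact Submodule.add_mem _ hx hy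
    | smul t x _ hx => rw [smul_mul_assoc]; exact Submodule.smul_mem _ _ hx

/-- A letter of the colour of the first factor merges with it into one element of that algebra, of
degree at most one more, which is expanded again in 1 and the e_j. Thus the filtration by degree is
respected. -/
theorem letter_mul_mem_altSpan (F : FreeSystem τ B col deg e) (x : κ) {d : ℕ} {f : NCPoly κ}
    (hf : f ∈ altSpan col deg e d) :
    monomial (FreeMonoid.of x) * f ∈ altSpan col deg e (d + 1) := by
  obtain ⟨c, hx⟩ := F.letter x
  induction hf using Submodule.span_induction with
  | mem f hf =>
    obtain ⟨⟨l, hl, hd : wordDeg deg l ≤ d⟩, rfl⟩ := hf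
    change _ * wordProd e l ∈ _
    by_cases hh : ∀ b ∈ l.head?, col b ≠ c
    · exact F.mem_mul_wordProd_mem_altSpan hx hl hh (by omega)
    · cases l with
      | nil => simp at hh
      | cons b l =>
        obtain ⟨h1, h2⟩ := alt_cons hl
        obtain rfl : col b = c := by simpa using hh
        rw [wordProd_cons, ← mul_assoc]
        rw [wordDeg_cons] at hd
        exact F.mem_mul_wordProd_mem_altSpan (F.mul_mem hx (F.mem b)) h1 h2 (by omega)
  | zero => rw [mul_zero]; exact Submodule.zero_mem _
  | add f g _ _ hf hg => rw [mul_add]; exact Submodule.add_mem _ hf hg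
  | smul t f _ hf => rw [mul_smul_comm]; exact Submodule.smul_mem _ _ hf

theorem degLE_le_altSpan (F : FreeSystem τ B col deg e) (d : ℕ) :
    degLE κ d ≤ altSpan col deg e d := by
  have hmono : Monotone (altSpan col deg e) := by
    intro a b hab
    refine Submodule.span_mono ?_
    rintro _ ⟨⟨l, hl, hd⟩, rfl⟩
    exact ⟨⟨l, hl, hd.trans hab⟩, rfl⟩
  have hword : ∀ w : List κ, monomial (FreeMonoid.ofList w) ∈ altSpan col deg e w.length := by
    intro w
    induction w with
    | nil => exact wordProd_mem_altSpan (l := []) .nil le_rfl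
    | cons x w ih =>
      have e : monomial (FreeMonoid.ofList (x :: w))
          = monomial (FreeMonoid.of x) * monomial (FreeMonoid.ofList w) := by
        simp [monomial, FreeMonoid.ofList_cons]
      rw [e]
      exact F.letter_mul_mem_altSpan x ih
  refine Submodule.span_le.2 ?_
  rintro _ ⟨w, hw, rfl⟩
  exact hmono hw (hword w.toList)

theorem map_star_sum_mul_sum {α : Type*} [DecidableEq α] (s : Finset α) (f : α → NCPoly κ)
    (hf : ∀ a ∈ s, ∀ b ∈ s, τ (ncStar (f a) * f b) = if a = b then 1 else 0) (x : α → ℂ) :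
    τ (ncStar (∑ a ∈ s, x a • f a) * ∑ a ∈ s, x a • f a) = ((∑ a ∈ s, ‖x a‖ ^ 2 : ℝ) : ℂ) := by
  rw [ncStar_sum, Finset.sum_mul_sum, map_sum, Complex.ofReal_sum]
  refine Finset.sum_congr rfl fun a ha => ?_
  rw [map_sum, Finset.sum_eq_single a]
  · rw [ncStar_smul, smul_mul_smul_comm, map_smul, hf a ha a ha, if_pos rfl, smul_eq_mul, mul_one,
      Complex.star_def, Complex.conj_mul']
    push_cast; rfl
  · intro b hb hba
    rw [ncStar_smul, smul_mul_smul_comm, map_smul, hf a ha b hb, if_neg hba.symm, smul_zero]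
  · exact fun h => absurd ha h

/-- In terms of the orthonormal alternating products the form is a sum of squared moduli. Positivity
of the free product is thus a consequence and not an assumption. -/
theorem isPositive (F : FreeSystem τ B col deg e) : IsPositive τ := by
  classical
  intro p
  obtain ⟨d, hd⟩ := mem_degLE_of_support p
  obtain ⟨x, rfl⟩ := (Finsupp.mem_span_range_iff_exists_finsupp).1 (F.degLE_le_altSpan d hd)
  rw [Finsupp.sum, map_star_sum_mul_sum (f := fun l : AltDeg col deg d => wordProd e l.1)]
  · exact ⟨by rw [Complex.ofReal_re]; positivity, Complex.ofReal_im _⟩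
  · intro a _ b _
    rw [F.ortho_wordProd a.2.1 b.2.1]
    simp [Subtype.ext_iff]

/-- A vanishing combination has zero norm, which is the sum of the squared moduli of its
coefficients. Independence is taken inside `degLE κ d` so that its dimension bounds the number of
words. -/
theorem linearIndependent (F : FreeSystem τ B col deg e) (d : ℕ) :
    LinearIndependent ℂ fun l : AltDeg col deg d =>
      (⟨wordProd e l.1, degLE_mono l.2.2 (F.wordProd_mem_degLE l.1)⟩ : degLE κ d) := by
  classical
  rw [linearIndependent_iff']
  intro s x hx a ha
  have h1 := congrArg (Subtype.val : degLE κ d → NCPoly κ) hx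
  simp only [Submodule.coe_sum, Submodule.coe_smul, Submodule.coe_zero] at h1
  have h2 := map_star_sum_mul_sum (τ := τ) s (fun l : AltDeg col deg d => wordProd e l.1)
    (fun a _ b _ => by rw [F.ortho_wordProd a.2.1 b.2.1]; simp [Subtype.ext_iff]) x
  rw [h1, mul_zero, map_zero] at h2
  have h3 : ∑ a ∈ s, ‖x a‖ ^ 2 = 0 := by exact_mod_cast h2.symm
  have := (Finset.sum_eq_zero_iff_of_nonneg fun a _ => sq_nonneg ‖x a‖).1 h3 a ha
  simpa using this

theorem finite_altDeg [Finite κ] (F : FreeSystem τ B col deg e) (d : ℕ) :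
    Finite (AltDeg col deg d) :=
  (F.linearIndependent d).finite

theorem card_altDeg_le [Fintype κ] (F : FreeSystem τ B col deg e) (d : ℕ)
    [Fintype (AltDeg col deg d)] :
    Fintype.card (AltDeg col deg d) ≤ ∑ j ∈ Finset.range (d + 1), Fintype.card κ ^ j :=
  (F.linearIndependent d).fintype_card_le_finrank.trans (finrank_degLE_le d)

end FreeSystem

end FreeSystem

namespace FreeSystem

/-! ### Comparison of the operator norms of a factor and of the free product -/

section Comparison

variable {κ J ι' : Type*} {τ : NCPoly κ →ₗ[ℂ] ℂ} {B : Bool → ℕ → Submodule ℂ (NCPoly κ)}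
  {col : J → Bool} {deg : J → ℕ} {e : J → NCPoly κ} {c : Bool}

/-- Alternating words that do not start with colour `c`. -/
abbrev AltNot (col : J → Bool) (c : Bool) : Type _ :=
  {r : List J // Alt col r ∧ ∀ b ∈ r.head?, col b ≠ c}

/-- The element `∑_r φ(h_r) e_r` of the free module over the factor of colour `c`. -/
def assemble (e : J → NCPoly κ) (φ : NCPoly ι' →ₐ[ℂ] NCPoly κ) (h : AltNot col c →₀ NCPoly ι') :
    NCPoly κ := h.sum fun r a => φ a * wordProd e r.1

theorem assemble_add (φ : NCPoly ι' →ₐ[ℂ] NCPoly κ) (g h : AltNot col c →₀ NCPoly ι') :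
    assemble e φ (g + h) = assemble e φ g + assemble e φ h := by
  classical
  exact Finsupp.sum_add_index' (by simp) (by simp [add_mul])

theorem assemble_smul (φ : NCPoly ι' →ₐ[ℂ] NCPoly κ) (p : NCPoly ι')
    (h : AltNot col c →₀ NCPoly ι') : assemble e φ (p • h) = φ p * assemble e φ h := by
  rw [assemble, Finsupp.sum_smul_index (by simp), assemble, Finsupp.mul_sum]
  simp [mul_assoc]

theorem assemble_sum {α : Type*} (φ : NCPoly ι' →ₐ[ℂ] NCPoly κ) (s : Finset α)
    (h : α → AltNot col c →₀ NCPoly ι') :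
    assemble e φ (∑ a ∈ s, h a) = ∑ a ∈ s, assemble e φ (h a) := by
  classical
  induction s using Finset.induction_on with
  | empty => simp [assemble]
  | insert a s ha ih => rw [Finset.sum_insert ha, assemble_add, ih, Finset.sum_insert ha]

/-- An alternating word either avoids colour c at its head, and is then an index itself, or its
first letter comes from the factor and the remaining word is an index. -/
theorem assemble_surjective (F : FreeSystem τ B col deg e) (φ : NCPoly ι' →ₐ[ℂ] NCPoly κ)
    (he : ∀ j, col j = c → ∃ p, φ p = e j) :
    Function.Surjective (assemble e φ : (AltNot col c →₀ NCPoly ι') → NCPoly κ) := by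
  intro f
  obtain ⟨d, hd⟩ := mem_degLE_of_support f
  have hf := F.degLE_le_altSpan d hd
  clear hd
  induction hf using Submodule.span_induction with
  | mem f hf =>
    obtain ⟨⟨l, hl, -⟩, rfl⟩ := hf
    change ∃ h, _ = wordProd e l
    by_cases hh : ∀ b ∈ l.head?, col b ≠ c
    · exact ⟨Finsupp.single ⟨l, hl, hh⟩ 1, by simp [assemble]⟩
    · cases l with
      | nil => simp at hh
      | cons b l =>
        obtain ⟨h1, h2⟩ := alt_cons hl
        obtain rfl : col b = c := by simpa using hh
        obtain ⟨p, hp⟩ := he b rfl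
        exact ⟨Finsupp.single ⟨l, h1, h2⟩ p, by simp [assemble, hp]⟩
  | zero => exact ⟨0, by simp [assemble]⟩
  | add f g _ _ hf hg =>
    obtain ⟨u, rfl⟩ := hf
    obtain ⟨v, rfl⟩ := hg
    exact ⟨u + v, assemble_add φ u v⟩
  | smul t f _ hf =>
    obtain ⟨u, rfl⟩ := hf
    exact ⟨(t • (1 : NCPoly ι')) • u, by rw [assemble_smul]; simp⟩

/-- The element φ(h_r^⋆ h_s) stands between two words that do not start with its colour, so it is
replaced by its trace, and orthogonality of words removes r ≠ s. The free module is thus an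
orthogonal sum of copies of the factor. -/
theorem map_star_assemble_mul_assemble (F : FreeSystem τ B col deg e) {τ' : NCPoly ι' →ₗ[ℂ] ℂ}
    (φ : NCPoly ι' →ₐ[ℂ] NCPoly κ) (hB : ∀ p, ∃ n, φ p ∈ B c n)
    (hφ : ∀ p, ncStar (φ p) = φ (ncStar p)) (hτ : ∀ p, τ (φ p) = τ' p)
    (h : AltNot col c →₀ NCPoly ι') :
    τ (ncStar (assemble e φ h) * assemble e φ h)
      = ∑ r ∈ h.support, τ' (ncStar (h r) * h r) := by
  classical
  rw [assemble, Finsupp.sum, ncStar_sum, Finset.sum_mul_sum, map_sum]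
  have key : ∀ r s : AltNot col c, τ (ncStar (φ (h r) * wordProd e r.1) * (φ (h s) * wordProd e s.1))
      = if r = s then τ' (ncStar (h r) * h s) else 0 := by
    intro r s
    obtain ⟨n, hn⟩ := hB (ncStar (h r) * h s)
    have e1 : ncStar (φ (h r) * wordProd e r.1) * (φ (h s) * wordProd e s.1)
        = ncStar (wordProd e r.1) * (φ (ncStar (h r) * h s) * wordProd e s.1) := by
      rw [ncStar_mul, hφ, map_mul]; simp only [mul_assoc]
    rw [e1, F.map_star_wordProd_mul_mem_mul_wordProd hn r.2.1 s.2.1 r.2.2 s.2.2, hτ,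
      F.ortho_wordProd r.2.1 s.2.1]
    simp [Subtype.ext_iff]
  refine Finset.sum_congr rfl fun r hr => ?_
  rw [map_sum, Finset.sum_eq_single r]
  · rw [key, if_pos rfl]
  · intro s _ hs
    rw [key, if_neg hs.symm]
  · exact fun h => absurd hr h

/-- The matrix acts separately, and by P itself, on each copy of the factor, so its norm bound holds
on the orthogonal sum. -/
theorem vecL2Norm_map_mulVec_le (F : FreeSystem τ B col deg e) {τ' : NCPoly ι' →ₗ[ℂ] ℂ}
    (hpos : IsPositive τ') (φ : NCPoly ι' →ₐ[ℂ] NCPoly κ) (hB : ∀ p, ∃ n, φ p ∈ B c n)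
    (hφ : ∀ p, ncStar (φ p) = φ (ncStar p)) (hτ : ∀ p, τ (φ p) = τ' p)
    (he : ∀ j, col j = c → ∃ p, φ p = e j) {k : ℕ} {P : Matrix (Fin k) (Fin k) (NCPoly ι')}
    {C : ℝ} (hC : 0 ≤ C) (h : ∀ ξ, vecL2Norm τ' (P *ᵥ ξ) ≤ C * vecL2Norm τ' ξ)
    (ξ : Fin k → NCPoly κ) : vecL2Norm τ (P.map φ *ᵥ ξ) ≤ C * vecL2Norm τ ξ := by
  classical
  choose g hg using fun i => F.assemble_surjective φ he (c := c) (ξ i)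
  have hsum : ∀ u : Fin k → AltNot col c →₀ NCPoly ι', ∀ S : Finset (AltNot col c),
      (∀ i, (u i).support ⊆ S) →
      vecL2Norm τ (fun i => assemble e φ (u i)) ^ 2 = ∑ r ∈ S, vecL2Norm τ' (fun i => u i r) ^ 2 := by
    intro u S hS
    rw [F.isPositive.sq_vecL2Norm]
    simp only [hpos.sq_vecL2Norm]
    rw [Finset.sum_comm]
    refine Finset.sum_congr rfl fun i _ => ?_
    rw [F.map_star_assemble_mul_assemble φ hB hφ hτ, Complex.re_sum]
    refine Finset.sum_subset (hS i) fun r _ hr => ?_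
    rw [Finsupp.notMem_support_iff.1 hr]
    simp
  let u : Fin k → AltNot col c →₀ NCPoly ι' := fun i => ∑ j, P i j • g j
  have hu : P.map φ *ᵥ ξ = fun i => assemble e φ (u i) := by
    ext1 i
    simp only [u, assemble_sum, assemble_smul, hg]
    rfl
  -- One finite index set for the vector and for its image, so that the two sums of squares can be
  -- compared term by term.
  let S : Finset (AltNot col c) :=
    (Finset.univ.biUnion fun i => (u i).support) ∪ Finset.univ.biUnion fun i => (g i).support
  have h1 := hsum u S fun i => (Finset.subset_biUnion_of_mem (fun i => (u i).support)
    (Finset.mem_univ i)).trans Finset.subset_union_left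
  have h2 := hsum g S fun i => (Finset.subset_biUnion_of_mem (fun i => (g i).support)
    (Finset.mem_univ i)).trans Finset.subset_union_right
  rw [← hu] at h1
  rw [show (fun i => assemble e φ (g i)) = ξ from funext hg] at h2
  rw [← abs_of_nonneg (vecL2Norm_nonneg (τ := τ) (P.map φ *ᵥ ξ))]
  refine abs_le_of_sq_le_sq ?_ (mul_nonneg hC (vecL2Norm_nonneg _))
  rw [mul_pow, h1, h2, Finset.mul_sum]
  refine Finset.sum_le_sum fun r _ => ?_
  rw [← mul_pow]
  refine pow_le_pow_left₀ (vecL2Norm_nonneg _) ?_ 2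
  have e3 : (fun i => u i r) = P *ᵥ fun i => g i r := by
    ext1 i
    simp [u, Finsupp.finsetSum_apply, Matrix.mulVec, dotProduct]
  rw [e3]
  exact h _

end Comparison

end FreeSystem

/-! ### Norms of matrices -/

section MatNorm

variable {k : ℕ}

/-- The square of the Euclidean norm. -/
def sqNorm (v : Fin k → ℂ) : ℝ := ∑ i, ‖v i‖ ^ 2

theorem sqNorm_eq (v : Fin k → ℂ) : sqNorm v = ‖WithLp.toLp 2 v‖ ^ 2 := by
  rw [EuclideanSpace.norm_sq_eq]; rfl

theorem sqNorm_nonneg (v : Fin k → ℂ) : 0 ≤ sqNorm v := by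
  rw [sqNorm_eq]; positivity

theorem matNorm_nonneg (B : Matrix (Fin k) (Fin k) ℂ) : 0 ≤ matNorm B := norm_nonneg _

theorem sqNorm_mulVec_le (B : Matrix (Fin k) (Fin k) ℂ) (v : Fin k → ℂ) :
    sqNorm (B *ᵥ v) ≤ matNorm B ^ 2 * sqNorm v := by
  rw [sqNorm_eq, sqNorm_eq, ← mul_pow, ← Matrix.toEuclideanCLM_toLp]
  exact pow_le_pow_left₀ (norm_nonneg _) (ContinuousLinearMap.le_opNorm _ _) 2

theorem matNorm_le {B : Matrix (Fin k) (Fin k) ℂ} {C : ℝ} (hC : 0 ≤ C)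
    (h : ∀ v, sqNorm (B *ᵥ v) ≤ C ^ 2 * sqNorm v) : matNorm B ≤ C := by
  refine ContinuousLinearMap.opNorm_le_bound _ hC fun v => ?_
  have := h v.ofLp
  rw [sqNorm_eq, sqNorm_eq, ← mul_pow, ← Matrix.toEuclideanCLM_toLp] at this
  exact le_of_sq_le_sq this (by positivity)

theorem matNorm_mul_le (A B : Matrix (Fin k) (Fin k) ℂ) :
    matNorm (A * B) ≤ matNorm A * matNorm B := by
  rw [matNorm, map_mul]
  exact norm_mul_le _ _

theorem matNorm_smul (c : ℂ) (A : Matrix (Fin k) (Fin k) ℂ) :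
    matNorm (c • A) = ‖c‖ * matNorm A := by
  rw [matNorm, map_smul, norm_smul]; rfl

theorem matNorm_one_le : matNorm (1 : Matrix (Fin k) (Fin k) ℂ) ≤ 1 := by
  rw [matNorm, map_one]
  exact ContinuousLinearMap.norm_id_le

theorem matNorm_one (hk : 1 ≤ k) : matNorm (1 : Matrix (Fin k) (Fin k) ℂ) = 1 := by
  have : Nonempty (Fin k) := ⟨⟨0, hk⟩⟩
  rw [matNorm, map_one]
  exact norm_one

end MatNorm

/-! ### The upper bound for evaluations -/

namespace FreeSystem

section Upper

variable {κ J : Type*} {τ : NCPoly κ →ₗ[ℂ] ℂ} {B : Bool → ℕ → Submodule ℂ (NCPoly κ)}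
  {col : J → Bool} {deg : J → ℕ} {e : J → NCPoly κ} {k : ℕ}

theorem matNorm_evalTuple_wordProd_le {A : κ → Matrix (Fin k) (Fin k) ℂ} {L : ℝ} (hL : 0 ≤ L)
    (h : ∀ j, matNorm (evalTuple A (e j)) ^ 2 ≤ L ^ deg j) (l : List J) :
    matNorm (evalTuple A (wordProd e l)) ^ 2 ≤ L ^ wordDeg deg l := by
  induction l with
  | nil =>
    rw [show evalTuple A (wordProd e []) = 1 from _root_.map_one (evalTuple A), wordDeg_nil, pow_zero]
    exact pow_le_one₀ (matNorm_nonneg _) matNorm_one_le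
  | cons j l ih =>
    rw [wordProd_cons, map_mul, wordDeg_cons, pow_add]
    calc matNorm (evalTuple A (e j) * evalTuple A (wordProd e l)) ^ 2
        ≤ (matNorm (evalTuple A (e j)) * matNorm (evalTuple A (wordProd e l))) ^ 2 :=
          pow_le_pow_left₀ (matNorm_nonneg _) (matNorm_mul_le _ _) 2
      _ = matNorm (evalTuple A (e j)) ^ 2 * matNorm (evalTuple A (wordProd e l)) ^ 2 := by ring
      _ ≤ L ^ deg j * L ^ wordDeg deg l :=
          mul_le_mul (h j) ih (by positivity) (by positivity)

/-- The coefficients form a contractive row. The vector with entries ∑_a x_a(j) w_a^⋆ has squared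
norm ∑_a |x_a|² by orthonormality of the adjoints, and the component along 1 of its image under P is
∑_a c_a x_a. -/
theorem sqNorm_sum_mulVec_le (F : FreeSystem τ B col deg e)
    {P : Matrix (Fin k) (Fin k) (NCPoly κ)} (hP : opNorm τ P ≤ 1)
    {α : Type*} [Fintype α] (w : α → List J) (hw : Function.Injective w)
    (hAlt : ∀ a, Alt col (w a)) (c : α → Matrix (Fin k) (Fin k) ℂ)
    (hc : ∀ i j, P i j = ∑ a, c a i j • wordProd e (w a)) (x : α → Fin k → ℂ) :
    sqNorm (∑ a, c a *ᵥ x a) ≤ ∑ a, sqNorm (x a) := by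
  classical
  let ξ : Fin k → NCPoly κ := fun j => ∑ a, x a j • ncStar (wordProd e (w a))
  have hξ : vecL2Norm τ ξ ^ 2 = ∑ a, sqNorm (x a) := by
    rw [F.isPositive.sq_vecL2Norm]
    simp only [sqNorm]
    rw [Finset.sum_comm]
    refine Finset.sum_congr rfl fun j _ => ?_
    rw [map_star_sum_mul_sum, Complex.ofReal_re]
    intro a _ b _
    rw [ncStar_ncStar, F.coortho_wordProd (hAlt a) (hAlt b)]
    simp [hw.eq_iff]
  have hval : ∀ i, (∑ a, c a *ᵥ x a) i = τ ((P *ᵥ ξ) i) := by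
    intro i
    simp only [Finset.sum_apply, Matrix.mulVec, dotProduct, map_sum]
    rw [Finset.sum_comm]
    refine Finset.sum_congr rfl fun j _ => ?_
    rw [hc, Finset.sum_mul_sum, map_sum]
    refine Finset.sum_congr rfl fun a _ => ?_
    rw [map_sum, Finset.sum_eq_single a]
    · rw [smul_mul_smul_comm, map_smul, F.coortho_wordProd (hAlt a) (hAlt a), if_pos rfl,
        smul_eq_mul, mul_one]
    · intro b _ hb
      rw [smul_mul_smul_comm, map_smul, F.coortho_wordProd (hAlt a) (hAlt b),
        if_neg fun h => hb (hw h).symm, smul_zero]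
    · simp
  have h1 := pow_le_pow_left₀ (vecL2Norm_nonneg _) (opNorm_le_one_iff.1 hP ξ) 2
  rw [hξ, F.isPositive.sq_vecL2Norm] at h1
  refine le_trans (Finset.sum_le_sum fun i _ => ?_) h1
  rw [hval]
  exact F.isPositive.norm_sq_le F.map_one _

theorem evalAt_eq_sum {P : Matrix (Fin k) (Fin k) (NCPoly κ)} {α : Type*} [Fintype α]
    (f : α → NCPoly κ) (c : α → Matrix (Fin k) (Fin k) ℂ)
    (hc : ∀ i j, P i j = ∑ a, c a i j • f a) (A : κ → Matrix (Fin k) (Fin k) ℂ) :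
    evalAt P A 1 = ∑ a, c a * evalTuple A (f a) := by
  have h1 : ∀ a, c a * evalTuple A (f a)
      = ∑ i, ∑ j, c a i j • (Matrix.single i j (1 : ℂ) * evalTuple A (f a)) := by
    intro a
    conv_lhs => rw [Matrix.matrix_eq_sum_single (c a)]
    rw [Finset.sum_mul]
    refine Finset.sum_congr rfl fun i _ => ?_
    rw [Finset.sum_mul]
    refine Finset.sum_congr rfl fun j _ => ?_
    rw [← smul_mul_assoc, Matrix.smul_single, smul_eq_mul, mul_one]
  simp only [h1, evalAt, mul_one]
  rw [Finset.sum_comm (s := (Finset.univ : Finset α))]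
  refine Finset.sum_congr rfl fun i _ => ?_
  rw [Finset.sum_comm (s := (Finset.univ : Finset α))]
  refine Finset.sum_congr rfl fun j _ => ?_
  rw [hc, map_sum, Finset.mul_sum]
  refine Finset.sum_congr rfl fun a _ => ?_
  rw [map_smul, mul_smul_comm]

/-- Apply the row contraction to x_a = w_a(A)v. Each term is at most L^d |v|², and there are at most
|κ|^(2d) words. -/
theorem phiInfDeg_le [Fintype κ] (F : FreeSystem τ B col deg e)
    (hκ : 2 ≤ Fintype.card κ) {A : κ → Matrix (Fin k) (Fin k) ℂ} {L : ℝ} (hL : 1 ≤ L)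
    (h : ∀ j, matNorm (evalTuple A (e j)) ^ 2 ≤ L ^ deg j) {d : ℕ} (hd : 1 ≤ d) :
    phiInfDeg τ d A ≤ ENNReal.ofReal (((Fintype.card κ : ℝ) ^ 2 * L) ^ d) := by
  have hL0 : 0 ≤ L := zero_le_one.trans hL
  have : Finite (AltDeg col deg d) := F.finite_altDeg d
  have : Fintype (AltDeg col deg d) := Fintype.ofFinite _
  refine iSup_le fun P => iSup_le fun hPd => iSup_le fun hP => ?_
  refine ENNReal.ofReal_le_ofReal ?_
  have hrep : ∀ i j, ∃ x : AltDeg col deg d → ℂ, ∑ a, x a • wordProd e a.1 = P i j := by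
    intro i j
    have := F.degLE_le_altSpan d (hasDegreeLE_iff.1 hPd i j)
    rwa [altSpan, Submodule.mem_span_range_iff_exists_fun] at this
  choose x hx using hrep
  let c : AltDeg col deg d → Matrix (Fin k) (Fin k) ℂ := fun a => Matrix.of fun i j => x i j a
  have hc : ∀ i j, P i j = ∑ a, c a i j • wordProd e a.1 := fun i j => (hx i j).symm
  have hcard : (Fintype.card (AltDeg col deg d) : ℝ) ≤ ((Fintype.card κ : ℝ) ^ 2) ^ d := by
    rw [← pow_mul]
    exact_mod_cast (F.card_altDeg_le d).trans (geom_sum_le_pow_two_mul hκ hd)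
  have hnn : 0 ≤ ((Fintype.card κ : ℝ) ^ 2 * L) ^ d := by positivity
  rw [← Real.le_sqrt (matNorm_nonneg _) hnn]
  refine matNorm_le (Real.sqrt_nonneg _) fun v => ?_
  rw [Real.sq_sqrt hnn, evalAt_eq_sum (fun a : AltDeg col deg d => wordProd e a.1) c hc,
    Matrix.sum_mulVec]
  simp only [← Matrix.mulVec_mulVec]
  calc _ ≤ ∑ a : AltDeg col deg d, sqNorm (evalTuple A (wordProd e a.1) *ᵥ v) :=
        F.sqNorm_sum_mulVec_le hP (fun a : AltDeg col deg d => a.1) Subtype.val_injective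
          (fun a => a.2.1) c hc _
    _ ≤ ∑ a : AltDeg col deg d, L ^ d * sqNorm v := by
        refine Finset.sum_le_sum fun a _ => (sqNorm_mulVec_le _ _).trans ?_
        refine mul_le_mul_of_nonneg_right ?_ (sqNorm_nonneg v)
        exact (matNorm_evalTuple_wordProd_le hL0 h a.1).trans (pow_le_pow_right₀ hL a.2.2)
    _ = Fintype.card (AltDeg col deg d) * (L ^ d * sqNorm v) := by
        rw [Finset.sum_const, nsmul_eq_mul, Finset.card_univ]
    _ ≤ ((Fintype.card κ : ℝ) ^ 2) ^ d * (L ^ d * sqNorm v) :=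
        mul_le_mul_of_nonneg_right hcard (mul_nonneg (by positivity) (sqNorm_nonneg v))
    _ = _ := by rw [mul_pow, mul_assoc]

end Upper

end FreeSystem

/-! ### The system of a free product -/

section FreeProductSystem

variable {ι₁ ι₂ I₁ I₂ : Type*} {τ₁ : NCPoly ι₁ →ₗ[ℂ] ℂ} {τ₂ : NCPoly ι₂ →ₗ[ℂ] ℂ}
  {τ : NCPoly (ι₁ ⊕ ι₂) →ₗ[ℂ] ℂ} {deg₁ : I₁ → ℕ} {deg₂ : I₂ → ℕ} {e₁ : I₁ → NCPoly ι₁}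
  {e₂ : I₂ → NCPoly ι₂}

/-- The polynomials of one colour of degree at most `a` in `ℂ⟨X₁, X₂⟩`. -/
def colourDegLE (ι₁ ι₂ : Type*) (c : Bool) (a : ℕ) : Submodule ℂ (NCPoly (ι₁ ⊕ ι₂)) :=
  if c then (degLE ι₁ a).map (inclLeft (ι₁ := ι₁) (ι₂ := ι₂)).toLinearMap
  else (degLE ι₂ a).map (inclRight (ι₁ := ι₁) (ι₂ := ι₂)).toLinearMap

theorem mem_colourDegLE_true {a : ℕ} {x : NCPoly (ι₁ ⊕ ι₂)} :
    x ∈ colourDegLE ι₁ ι₂ true a ↔ ∃ p ∈ degLE ι₁ a, inclLeft p = x := Iff.rfl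

theorem mem_colourDegLE_false {a : ℕ} {x : NCPoly (ι₁ ⊕ ι₂)} :
    x ∈ colourDegLE ι₁ ι₂ false a ↔ ∃ p ∈ degLE ι₂ a, inclRight p = x := Iff.rfl

theorem map_le_of_le_span {ι κ I : Type*} (φ : NCPoly ι →ₐ[ℂ] NCPoly κ) {e : I → NCPoly ι}
    {s : Set I} {p : NCPoly ι} {S : Set (NCPoly κ)}
    (hp : p ∈ Submodule.span ℂ {1} ⊔ Submodule.span ℂ (e '' s)) (hS : ∀ i ∈ s, φ (e i) ∈ S) :
    φ p ∈ Submodule.span ℂ {1} ⊔ Submodule.span ℂ S := by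
  obtain ⟨y, hy, z, hz, rfl⟩ := Submodule.mem_sup.1 hp
  rw [map_add]
  refine Submodule.add_mem_sup ?_ ?_
  · obtain ⟨t, rfl⟩ := Submodule.mem_span_singleton.1 hy
    rw [map_smul, map_one]
    exact Submodule.smul_mem _ _ (Submodule.mem_span_singleton_self _)
  · have : Submodule.span ℂ (e '' s) ≤ (Submodule.span ℂ S).comap φ.toLinearMap := by
      refine Submodule.span_le.2 ?_
      rintro _ ⟨i, hi, rfl⟩
      exact Submodule.subset_span (hS i hi)
    exact this hz

/-- Traciality of the factors enters only in `conorm_one` and `coortho`: it turns orthonormality of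
the e_i into that of their adjoints. -/
theorem IsOrthoSystem.freeSystem (h₁ : IsFaithfulBoundedTrace τ₁)
    (h₂ : IsFaithfulBoundedTrace τ₂) (h : IsFreeProduct τ₁ τ₂ τ) (he₁ : IsOrthoSystem τ₁ deg₁ e₁)
    (he₂ : IsOrthoSystem τ₂ deg₂ e₂) :
    FreeSystem τ (colourDegLE ι₁ ι₂) (Sum.isLeft : I₁ ⊕ I₂ → Bool) (Sum.elim deg₁ deg₂)
      (Sum.elim (fun i => inclLeft (e₁ i)) fun i => inclRight (e₂ i)) where
  map_one := by rw [← map_one (inclLeft (ι₁ := ι₁) (ι₂ := ι₂)), h.left, h₁.map_one]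
  one_mem c a := by
    cases c
    · exact ⟨1, one_mem_degLE a, map_one inclRight⟩
    · exact ⟨1, one_mem_degLE a, map_one inclLeft⟩
  mul_mem {c a b x y} hx hy := by
    cases c
    · obtain ⟨p, hp, rfl⟩ := hx
      obtain ⟨q, hq, rfl⟩ := hy
      exact ⟨p * q, mul_mem_degLE hp hq, map_mul inclRight p q⟩
    · obtain ⟨p, hp, rfl⟩ := hx
      obtain ⟨q, hq, rfl⟩ := hy
      exact ⟨p * q, mul_mem_degLE hp hq, map_mul inclLeft p q⟩
  star_mem {c a x} hx := by
    cases c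
    · obtain ⟨p, hp, rfl⟩ := hx
      exact ⟨ncStar p, ncStar_mem_degLE hp, (ncStar_inclRight p).symm⟩
    · obtain ⟨p, hp, rfl⟩ := hx
      exact ⟨ncStar p, ncStar_mem_degLE hp, (ncStar_inclLeft p).symm⟩
  le_deg c a := by
    cases c
    · rintro _ ⟨p, hp, rfl⟩
      exact mapDomain_mem_degLE _ hp
    · rintro _ ⟨p, hp, rfl⟩
      exact mapDomain_mem_degLE _ hp
  star_centred {c a x} hx h0 := by
    cases c
    · obtain ⟨p, hp, rfl⟩ := mem_colourDegLE_false.1 hx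
      rw [h.right] at h0
      rw [ncStar_inclRight, h.right, h₂.isPositive.map_ncStar, h0, star_zero]
    · obtain ⟨p, hp, rfl⟩ := mem_colourDegLE_true.1 hx
      rw [h.left] at h0
      rw [ncStar_inclLeft, h.left, h₁.isPositive.map_ncStar, h0, star_zero]
  free l hne hl hc := by
    have key : ∀ l : List (Bool × NCPoly (ι₁ ⊕ ι₂)),
        (∀ a ∈ l, (∃ n, a.2 ∈ colourDegLE ι₁ ι₂ a.1 n) ∧ τ a.2 = 0) →
        ∃ l' : List (NCPoly ι₁ ⊕ NCPoly ι₂),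
          l = l'.map (fun a => (a.isLeft,
            Sum.elim (fun p => inclLeft p) (fun p => inclRight p) a)) ∧
          ∀ a ∈ l', Sum.elim (fun p => τ₁ p) (fun p => τ₂ p) a = 0 := by
      intro l
      induction l with
      | nil => exact fun _ => ⟨[], rfl, by simp⟩
      | cons a l ih =>
        intro hc
        obtain ⟨l', rfl, hl'⟩ := ih fun b hb => hc b (List.mem_cons_of_mem _ hb)
        obtain ⟨⟨n, hn⟩, h0⟩ := hc a List.mem_cons_self
        obtain ⟨c, x⟩ := a
        cases c
        · obtain ⟨p, hp, rfl⟩ := mem_colourDegLE_false.1 hn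
          refine ⟨Sum.inr p :: l', rfl, ?_⟩
          rw [List.forall_mem_cons]
          exact ⟨by simpa [h.right] using h0, hl'⟩
        · obtain ⟨p, hp, rfl⟩ := mem_colourDegLE_true.1 hn
          refine ⟨Sum.inl p :: l', rfl, ?_⟩
          rw [List.forall_mem_cons]
          exact ⟨by simpa [h.left] using h0, hl'⟩
    obtain ⟨l', rfl, hl'⟩ := key l hc
    rw [List.map_map]
    exact h.free l' (by simpa using hne) ((List.isChain_map (R := fun a b : Bool × NCPoly (ι₁ ⊕ ι₂) => a.1 ≠ b.1) _).1 hl) hl'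
  letter x := by
    cases x with
    | inl i =>
      exact ⟨true, monomial (FreeMonoid.of i), monomial_mem_degLE (by simp),
        by simp [inclLeft, monomial]⟩
    | inr i =>
      exact ⟨false, monomial (FreeMonoid.of i), monomial_mem_degLE (by simp),
        by simp [inclRight, monomial]⟩
  mem j := by
    cases j with
    | inl i => exact ⟨e₁ i, he₁.mem i, rfl⟩
    | inr i => exact ⟨e₂ i, he₂.mem i, rfl⟩
  centred j := by
    cases j with
    | inl i => exact (h.left _).trans (he₁.centred i)
    | inr i => exact (h.right _).trans (he₂.centred i)
  norm_one j := by
    cases j with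
    | inl i =>
      rw [Sum.elim_inl, ncStar_inclLeft, ← map_mul, h.left, he₁.norm_one]
    | inr i =>
      rw [Sum.elim_inr, ncStar_inclRight, ← map_mul, h.right, he₂.norm_one]
  ortho i j hij hne := by
    cases i with
    | inl i =>
      cases j with
      | inl j =>
        rw [Sum.elim_inl, Sum.elim_inl, ncStar_inclLeft, ← map_mul, h.left,
          he₁.ortho i j fun h => hne (by rw [h])]
      | inr j => simp at hij
    | inr i =>
      cases j with
      | inl j => simp at hij
      | inr j =>
        rw [Sum.elim_inr, Sum.elim_inr, ncStar_inclRight, ← map_mul, h.right,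
          he₂.ortho i j fun h => hne (by rw [h])]
  conorm_one j := by
    cases j with
    | inl i =>
      rw [Sum.elim_inl, ncStar_inclLeft, ← map_mul, h.left, h₁.tracial, he₁.norm_one]
    | inr i =>
      rw [Sum.elim_inr, ncStar_inclRight, ← map_mul, h.right, h₂.tracial, he₂.norm_one]
  coortho i j hij hne := by
    cases i with
    | inl i =>
      cases j with
      | inl j =>
        rw [Sum.elim_inl, Sum.elim_inl, ncStar_inclLeft, ← map_mul, h.left, h₁.tracial,
          he₁.ortho j i fun h => hne (by rw [h])]
      | inr j => simp at hij
    | inr i =>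
      cases j with
      | inl j => simp at hij
      | inr j =>
        rw [Sum.elim_inr, Sum.elim_inr, ncStar_inclRight, ← map_mul, h.right, h₂.tracial,
          he₂.ortho j i fun h => hne (by rw [h])]
  le_span c a := by
    cases c
    · rintro _ ⟨p, hp, rfl⟩
      exact map_le_of_le_span inclRight (he₂.le_span a hp) fun i hi => ⟨Sum.inr i, ⟨rfl, hi⟩, rfl⟩
    · rintro _ ⟨p, hp, rfl⟩
      exact map_le_of_le_span inclLeft (he₁.le_span a hp) fun i hi => ⟨Sum.inl i, ⟨rfl, hi⟩, rfl⟩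

end FreeProductSystem

/-! ### Growth of polynomials on complex lines -/

section OneVariable

open Polynomial

/-- A Bernstein–Walsh inequality for the unit disc. -/
theorem norm_eval_le_mul_pow {p : ℂ[X]} {q : ℕ} (hq : p.natDegree ≤ q) {M : ℝ}
    (hM : ∀ t : ℂ, ‖t‖ = 1 → ‖p.eval t‖ ≤ M) {t : ℂ} (ht : 1 ≤ ‖t‖) :
    ‖p.eval t‖ ≤ M * ‖t‖ ^ q := by
  -- The reversed polynomial s^q p(1/s) is again a polynomial because deg p ≤ q. The maximum
  -- principle for it inside the disc controls p outside.
  have hrefl : ∀ s : ℂ, s ≠ 0 → (p.reflect q).eval s⁻¹ * s ^ q = p.eval s := by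
    intro s hs
    let _ := invertibleOfNonzero hs
    have h2 := eval₂_reflect_mul_pow (RingHom.id ℂ) s q p hq
    rwa [invOf_eq_inv] at h2
  have hg : ∀ s : ℂ, ‖s‖ ≤ 1 → ‖(p.reflect q).eval s‖ ≤ M := by
    intro s hs
    refine Complex.norm_le_of_forall_mem_frontier_norm_le (U := Metric.ball (0 : ℂ) 1)
      Metric.isBounded_ball (p.reflect q).differentiable.diffContOnCl ?_ ?_
    · intro z hz
      rw [frontier_ball _ one_ne_zero, mem_sphere_zero_iff_norm] at hz
      have hz0 : z ≠ 0 := by rintro rfl; simp at hz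
      have := hrefl z⁻¹ (inv_ne_zero hz0)
      rw [inv_inv] at this
      have h2 := hM z⁻¹ (by rw [norm_inv, hz, inv_one])
      rwa [← this, norm_mul, norm_pow, norm_inv, hz, inv_one, one_pow, mul_one] at h2
    · rw [closure_ball _ one_ne_zero]
      simpa using hs
  have ht0 : t ≠ 0 := by rintro rfl; simp at ht; linarith
  rw [← hrefl t ht0, norm_mul, norm_pow]
  refine mul_le_mul_of_nonneg_right (hg _ ?_) (by positivity)
  rw [norm_inv]
  exact inv_le_one_of_one_le₀ ht

/-- The sub-mean value inequality for `log |p|` at the centre of the unit disc. -/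
theorem log_norm_eval_zero_le_circleAverage {p : ℂ[X]} (h0 : p.eval 0 ≠ 0) :
    Real.log ‖p.eval 0‖ ≤ Real.circleAverage (fun z => Real.log ‖p.eval z‖) 0 1 := by
  have han : AnalyticOnNhd ℂ (fun z => p.eval z) (Metric.closedBall 0 |1|) := fun z _ =>
    (AnalyticOnNhd.eval_polynomial p) z trivial
  -- Jensen's formula: the average exceeds log |p(0)| by a sum over the zeros in the disc, each term
  -- being nonnegative.
  rw [han.circleAverage_log_norm one_ne_zero h0]
  refine le_add_of_nonneg_left (finsum_nonneg fun u => ?_)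
  by_cases hu : u ∈ Metric.closedBall (0 : ℂ) |1|
  · refine mul_nonneg ?_ ?_
    · exact_mod_cast (MeromorphicOn.AnalyticOnNhd.divisor_nonneg han) u
    · rw [one_mul, zero_sub, norm_neg]
      by_cases h : u = 0
      · simp [h]
      · refine Real.log_nonneg (one_le_inv_iff₀.2 ⟨norm_pos_iff.2 h, ?_⟩)
        simpa using hu
  · rw [Function.locallyFinsuppWithin.apply_eq_zero_of_notMem _ hu]
    simp

/-- A two-constants estimate: the bound is a on the good part of the circle and a + K on T, and T
fills at most the proportion η of the circle. -/
theorem log_norm_eval_zero_le {p : ℂ[X]} (h0 : p.eval 0 ≠ 0) {T : Set ℝ} (hT : MeasurableSet T)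
    {a K η : ℝ} (hK : 0 ≤ K) (hη : 0 ≤ η)
    (h : ∀ θ : ℝ, Real.log ‖p.eval (circleMap 0 1 θ)‖ ≤ a + T.indicator (fun _ => K) θ)
    (hvol : volume (T ∩ Set.Ioc 0 (2 * Real.pi)) ≤ ENNReal.ofReal (2 * Real.pi * η)) :
    Real.log ‖p.eval 0‖ ≤ a + K * η := by
  refine (log_norm_eval_zero_le_circleAverage h0).trans ?_
  have hpi : 0 < 2 * Real.pi := by positivity
  have hmer : MeromorphicOn (fun z => p.eval z) (Metric.sphere 0 |1|) := fun z _ =>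
    ((AnalyticOnNhd.eval_polynomial p) z trivial).meromorphicAt
  have hint : CircleIntegrable (fun z => Real.log ‖p.eval z‖) 0 1 :=
    hmer.circleIntegrable_log_norm
  rw [Real.circleAverage, smul_eq_mul, inv_mul_le_iff₀ hpi]
  have hind : IntegrableOn (T.indicator fun _ => K) (Set.Ioc 0 (2 * Real.pi)) :=
    (integrable_const K).indicator hT
  have hconst : IntegrableOn (fun _ : ℝ => a) (Set.Ioc 0 (2 * Real.pi)) := integrable_const a
  have hle : ∫ θ in (0)..(2 * Real.pi), Real.log ‖p.eval (circleMap 0 1 θ)‖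
      ≤ ∫ θ in (0)..(2 * Real.pi), (a + T.indicator (fun _ => K) θ) := by
    refine intervalIntegral.integral_mono hpi.le hint ?_ h
    rw [intervalIntegrable_iff_integrableOn_Ioc_of_le hpi.le]
    exact hconst.add hind
  refine hle.trans ?_
  rw [intervalIntegral.integral_of_le hpi.le, integral_add hconst hind, integral_indicator hT]
  simp only [integral_const, measureReal_restrict_apply_univ, smul_eq_mul, Real.volume_real_Ioc,
    measureReal_restrict_apply_univ]
  rw [measureReal_def, Measure.restrict_apply hT,
    max_eq_left (by linarith)]
  have h1 : (volume (T ∩ Set.Ioc 0 (2 * Real.pi))).toReal ≤ 2 * Real.pi * η :=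
    ENNReal.toReal_le_of_le_ofReal (by positivity) hvol
  nlinarith [mul_le_mul_of_nonneg_right h1 hK]

end OneVariable

/-! ### Envelopes of polynomials of bounded degree in several variables -/

section SeveralVariables

theorem envelope_le_ofReal_iff {E : Type*} {Φ : ℕ → E → ℝ≥0∞} {q : ℕ} {S : Set (E → ℂ)} {z : E}
    (h : Φ q z = ⨆ f ∈ S, ENNReal.ofReal (‖f z‖ ^ 2)) {c : ℝ} (hc : 0 ≤ c) :
    Φ q z ≤ ENNReal.ofReal c ↔ ∀ f ∈ S, ‖f z‖ ^ 2 ≤ c := by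
  rw [h]
  simp only [iSup_le_iff, ENNReal.ofReal_le_ofReal_iff hc]

variable {E : Type*} [NormedAddCommGroup E] [NormedSpace ℂ E]

/-- A continuous function whose restriction to each complex line is a polynomial of degree at
most `q`. -/
def IsPolyOnLines (q : ℕ) (f : E → ℂ) : Prop :=
  Continuous f ∧ ∀ z b, ∃ p : Polynomial ℂ, p.natDegree ≤ q ∧ ∀ t : ℂ, f (z + t • b) = p.eval t

/-- A sequence of functions, increasing in `q`, the `q`-th of which is an upper envelope of squared
moduli of polynomials of degree at most `q`. -/
structure IsPolyEnvelope (Φ : ℕ → E → ℝ≥0∞) : Prop where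
  mono : Monotone Φ
  exists_eq : ∀ q, ∃ S : Set (E → ℂ), (∀ f ∈ S, IsPolyOnLines q f) ∧
    ∀ z, Φ q z = ⨆ f ∈ S, ENNReal.ofReal (‖f z‖ ^ 2)

theorem IsPolyOnLines.norm_le {q : ℕ} {f : E → ℂ} (hf : IsPolyOnLines q f) {z₀ : E} {r M : ℝ}
    (hr : 0 < r) (hM : ∀ z ∈ Metric.closedBall z₀ r, ‖f z‖ ≤ M) (z : E) :
    ‖f z‖ ≤ M * max 1 (‖z - z₀‖ / r) ^ q := by
  rcases le_or_gt ‖z - z₀‖ r with h | h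
  · have hz := hM z (by rwa [Metric.mem_closedBall, dist_eq_norm])
    have hM0 : 0 ≤ M := (norm_nonneg _).trans hz
    exact hz.trans (le_mul_of_one_le_right hM0 (one_le_pow₀ (le_max_left _ _)))
  · have hpos : 0 < ‖z - z₀‖ := hr.trans h
    -- Restrict to the complex line through z₀ and z, with the direction scaled to length r: the
    -- unit circle then lies in the ball, and z has parameter ‖z − z₀‖ / r.
    obtain ⟨p, hp, hfp⟩ := hf.2 z₀ (((r / ‖z - z₀‖ : ℝ) : ℂ) • (z - z₀))
    have hnb : ‖((r / ‖z - z₀‖ : ℝ) : ℂ) • (z - z₀)‖ = r := by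
      rw [norm_smul, Complex.norm_real, Real.norm_of_nonneg (by positivity),
        div_mul_cancel₀ _ hpos.ne']
    have ht : ‖((‖z - z₀‖ / r : ℝ) : ℂ)‖ = ‖z - z₀‖ / r := by
      rw [Complex.norm_real, Real.norm_of_nonneg (by positivity)]
    have h1 : 1 ≤ ‖z - z₀‖ / r := (one_le_div hr).2 h.le
    have key := norm_eval_le_mul_pow (M := M) hp (fun t ht => ?_)
      (t := ((‖z - z₀‖ / r : ℝ) : ℂ)) (by rw [ht]; exact h1)
    · rw [ht, ← hfp, smul_smul, ← Complex.ofReal_mul] at key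
      have e1 : ‖z - z₀‖ / r * (r / ‖z - z₀‖) = 1 := by field_simp
      rw [e1, Complex.ofReal_one, one_smul, add_sub_cancel] at key
      rwa [max_eq_right h1]
    · rw [← hfp]
      refine hM _ ?_
      rw [Metric.mem_closedBall, dist_eq_norm, add_sub_cancel_left, norm_smul, ht, one_mul, hnb]

namespace IsPolyEnvelope

variable {Φ : ℕ → E → ℝ≥0∞}

theorem isClosed_le (hΦ : IsPolyEnvelope Φ) (q : ℕ) (c : ℝ≥0∞) : IsClosed {z | Φ q z ≤ c} := by
  obtain ⟨S, hS, h⟩ := hΦ.exists_eq q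
  simp only [h, iSup_le_iff, Set.ofPred_forall]
  refine isClosed_iInter fun f => isClosed_iInter fun hf => ?_
  have := (hS f hf).1
  exact _root_.isClosed_le (ENNReal.continuous_ofReal.comp (by fun_prop)) continuous_const

theorem isClosed_forall_le (hΦ : IsPolyEnvelope Φ) (Q : ℕ) (c : ℕ → ℝ≥0∞) :
    IsClosed {z | ∀ q, Q ≤ q → Φ q z ≤ c q} := by
  simp only [Set.ofPred_forall]
  exact isClosed_iInter fun q => isClosed_iInter fun _ => hΦ.isClosed_le q _

theorem le_of_le_closedBall (hΦ : IsPolyEnvelope Φ) {z₀ : E} {r a : ℝ} (hr : 0 < r) (ha : 0 ≤ a)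
    {q : ℕ} (h : ∀ z ∈ Metric.closedBall z₀ r, Φ q z ≤ ENNReal.ofReal (a ^ q)) (z : E) :
    Φ q z ≤ ENNReal.ofReal ((a * max 1 (‖z - z₀‖ / r) ^ 2) ^ q) := by
  obtain ⟨S, hS, hE⟩ := hΦ.exists_eq q
  rw [envelope_le_ofReal_iff (hE z) (by positivity)]
  intro f hf
  have hM : ∀ z ∈ Metric.closedBall z₀ r, ‖f z‖ ≤ √(a ^ q) := by
    intro z hz
    exact Real.le_sqrt_of_sq_le ((envelope_le_ofReal_iff (hE z) (by positivity)).1 (h z hz) f hf)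
  have := pow_le_pow_left₀ (norm_nonneg _) ((hS f hf).norm_le hr hM z) 2
  rw [mul_pow, Real.sq_sqrt (by positivity)] at this
  refine this.trans_eq ?_
  ring

/-- If the growth rates are finite near a point then they are locally uniformly bounded
everywhere. -/
theorem exists_le_of_limsup_lt_top [CompleteSpace E] (hΦ : IsPolyEnvelope Φ) {U : Set E}
    (hU : IsOpen U) (hne : U.Nonempty)
    (h : ∀ z ∈ U, limsup (fun q : ℕ => Φ q z ^ (1 / (q : ℝ))) atTop < ⊤) (R : ℝ) (z₁ : E) :
    ∃ L : ℝ, 1 ≤ L ∧ ∀ z ∈ Metric.closedBall z₁ R, ∀ q, 1 ≤ q → Φ q z ≤ ENNReal.ofReal (L ^ q) := by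
  -- Baire category: N serves both as the threshold for the degree and as the growth rate. The
  -- complement of U is added so that these closed sets cover the whole space.
  let T : ℕ → Set E := fun N => {z | ∀ q, N ≤ q → Φ q z ≤ ENNReal.ofReal ((N : ℝ) ^ q)} ∪ Uᶜ
  have hT : ∀ N, IsClosed (T N) := fun N => (hΦ.isClosed_forall_le N _).union hU.isClosed_compl
  have hcov : ⋃ N, T N = Set.univ := by
    refine Set.eq_univ_of_forall fun z => ?_
    by_cases hz : z ∈ U
    · obtain ⟨c, hc, hcz⟩ := ENNReal.lt_iff_exists_nnreal_btwn.1 (h z hz)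
      have hev := eventually_lt_of_limsup_lt hc
      obtain ⟨N₀, hN₀⟩ := eventually_atTop.1 hev
      obtain ⟨N₁, hN₁⟩ := exists_nat_ge c
      refine Set.mem_iUnion.2 ⟨max (max N₀ N₁) 1, Or.inl fun q hq => ?_⟩
      have hq1 : 1 ≤ q := (le_max_right _ _).trans hq
      have hq0 : (0 : ℝ) < q := by exact_mod_cast hq1
      have h1 := (hN₀ q (((le_max_left _ _).trans (le_max_left _ _)).trans hq)).le
      rw [one_div, ENNReal.rpow_inv_le_iff hq0, ENNReal.rpow_natCast] at h1
      refine h1.trans ?_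
      rw [ENNReal.ofReal_pow (by positivity), ENNReal.ofReal_natCast]
      refine pow_le_pow_left' ?_ q
      have h2 : (c : ℝ≥0∞) ≤ ((N₁ : ℕ) : ℝ≥0∞) := by exact_mod_cast hN₁
      exact h2.trans (by exact_mod_cast (le_max_right N₀ N₁).trans (le_max_left _ 1))
    · exact Set.mem_iUnion.2 ⟨0, Or.inr hz⟩
  obtain ⟨z₀, hz₀, hz₀'⟩ := (dense_iUnion_interior_of_closed hT hcov).inter_open_nonempty U hU hne
  obtain ⟨N, hN⟩ := Set.mem_iUnion.1 hz₀'
  have hnhds : U ∩ interior (T N) ∈ 𝓝 z₀ := (hU.inter isOpen_interior).mem_nhds ⟨hz₀, hN⟩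
  obtain ⟨r, hr, hrsub⟩ := Metric.nhds_basis_closedBall.mem_iff.1 hnhds
  -- Degrees q < N are reached by monotonicity: Φ_q ≤ Φ_N ≤ N^N ≤ a ≤ a^q.
  let a : ℝ := max 1 ((N : ℝ) ^ N)
  have hball : ∀ q, 1 ≤ q → ∀ z ∈ Metric.closedBall z₀ r, Φ q z ≤ ENNReal.ofReal (a ^ q) := by
    intro q hq z hz
    have hzT : ∀ q, N ≤ q → Φ q z ≤ ENNReal.ofReal ((N : ℝ) ^ q) := by
      rcases interior_subset (hrsub hz).2 with h | h
      · exact h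
      · exact absurd (hrsub hz).1 h
    have ha1 : 1 ≤ a := le_max_left _ _
    rcases le_or_gt N q with hNq | hNq
    · refine (hzT q hNq).trans (ENNReal.ofReal_le_ofReal (pow_le_pow_left₀ (by positivity) ?_ q))
      rcases Nat.eq_zero_or_pos N with h0 | h0
      · simp [a, h0]
      · refine le_trans ?_ (le_max_right _ _)
        exact le_self_pow₀ (by exact_mod_cast h0) h0.ne'
    · refine (hΦ.mono hNq.le z).trans ((hzT N le_rfl).trans (ENNReal.ofReal_le_ofReal ?_))
      exact (le_max_right 1 _).trans (le_self_pow₀ ha1 (by omega))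
  let L : ℝ := a * max 1 ((‖z₁ - z₀‖ + R) / r) ^ 2
  have ha1 : 1 ≤ a := le_max_left _ _
  refine ⟨L, one_le_mul_of_one_le_of_one_le ha1 (one_le_pow₀ (le_max_left _ _)), ?_⟩
  intro z hz q hq
  refine (hΦ.le_of_le_closedBall hr (by positivity) (hball q hq) z).trans ?_
  refine ENNReal.ofReal_le_ofReal (pow_le_pow_left₀ (by positivity) ?_ q)
  have h3 : ‖z - z₀‖ ≤ ‖z₁ - z₀‖ + R := by
    have := norm_add_le (z - z₁) (z₁ - z₀)
    rw [sub_add_sub_cancel] at this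
    rw [Metric.mem_closedBall, dist_eq_norm] at hz
    linarith
  refine mul_le_mul_of_nonneg_left (pow_le_pow_left₀ (by positivity) ?_ 2) (by positivity)
  exact max_le_max le_rfl (by gcongr)

end IsPolyEnvelope

end SeveralVariables

/-! ### A Hartogs lemma -/

section Hartogs

variable {E : Type*} [NormedAddCommGroup E] [NormedSpace ℂ E] [FiniteDimensional ℂ E]

/-- Multiplication by a unimodular scalar maps the unit ball onto itself, so its real determinant
has modulus 1. -/
theorem measure_preimage_add_smul [MeasurableSpace E] [BorelSpace E] (μ : Measure E)
    [μ.IsAddHaarMeasure] {c : ℂ} (hc : ‖c‖ = 1) (z : E) (s : Set E) :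
    μ ((fun b => z + c • b) ⁻¹' s) = μ s := by
  let _ : NormedSpace ℝ E := NormedSpace.restrictScalars ℝ ℂ E
  have : IsScalarTower ℝ ℂ E := RestrictScalars.isScalarTower ℝ ℂ E
  have : FiniteDimensional ℝ E := FiniteDimensional.trans ℝ ℂ E
  have hc0 : c ≠ 0 := by rintro rfl; simp at hc
  let T : E ≃ₗ[ℝ] E := (LinearEquiv.smulOfNeZero ℂ E c hc0).restrictScalars ℝ
  have hdet : LinearMap.det (T : E →ₗ[ℝ] E) ≠ 0 := (LinearEquiv.isUnit_det' T).ne_zero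
  have hball : (T : E →ₗ[ℝ] E) ⁻¹' Metric.ball 0 1 = Metric.ball 0 1 := by
    ext b
    simp [T, norm_smul, hc]
  have h1 := Measure.addHaar_preimage_linearMap μ hdet (Metric.ball 0 1)
  have hpos : μ (Metric.ball 0 1) ≠ 0 := (Metric.measure_ball_pos μ 0 one_pos).ne'
  have hfin : μ (Metric.ball 0 1) ≠ ⊤ := measure_ball_lt_top.ne
  rw [hball] at h1
  have h2 : ENNReal.ofReal |(LinearMap.det (T : E →ₗ[ℝ] E))⁻¹| = 1 := by
    have h3 : 1 * μ (Metric.ball 0 1)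
        = ENNReal.ofReal |(LinearMap.det (T : E →ₗ[ℝ] E))⁻¹| * μ (Metric.ball 0 1) := by
      rw [one_mul]; exact h1
    exact ((ENNReal.mul_left_inj hpos hfin).1 h3).symm
  have h4 : (fun b => z + c • b) ⁻¹' s = (T : E →ₗ[ℝ] E) ⁻¹' ((fun b => z + b) ⁻¹' s) := rfl
  rw [h4, Measure.addHaar_preimage_linearMap μ hdet, h2, one_mul, measure_preimage_add]

/-- If `D` has small measure then some circle with given centre and radius at most `r` is mostly
disjoint from `D`. -/
theorem exists_circle_measure_le [MeasurableSpace E] [BorelSpace E] (μ : Measure E)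
    [μ.IsAddHaarMeasure] {D : Set E} (hD : MeasurableSet D) (z : E) {r η : ℝ}
    (h : μ D < ENNReal.ofReal η * μ (Metric.ball (0 : E) r)) :
    ∃ b ∈ Metric.ball (0 : E) r,
      volume ((fun θ : ℝ => z + circleMap 0 1 θ • b) ⁻¹' D ∩ Set.Ioc 0 (2 * Real.pi))
        ≤ ENNReal.ofReal (2 * Real.pi * η) := by
  -- Fubini in (b, θ): for fixed θ the map b ↦ z + e^{iθ}b preserves μ, so the total is at most 2π
  -- μ(D). If every circle were bad, it would be at least 2πη μ(ball).
  by_contra! hcon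
  have : SecondCountableTopology E := by
    have : ProperSpace E := FiniteDimensional.proper ℂ E
    infer_instance
  have : SFinite μ := inferInstance
  let ν : Measure ℝ := volume.restrict (Set.Ioc 0 (2 * Real.pi))
  let μ' : Measure E := μ.restrict (Metric.ball 0 r)
  let S : Set (E × ℝ) := (fun x : E × ℝ => z + circleMap 0 1 x.2 • x.1) ⁻¹' D
  have hcont : Continuous fun x : E × ℝ => z + circleMap 0 1 x.2 • x.1 := by
    have := continuous_circleMap (0 : ℂ) 1
    fun_prop
  have hS : MeasurableSet S := hcont.measurable hD
  have e1 : (μ'.prod ν) S = ∫⁻ b, ν (Prod.mk b ⁻¹' S) ∂μ' := Measure.prod_apply hS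
  have e2 : (μ'.prod ν) S = ∫⁻ θ, μ' ((fun b => (b, θ)) ⁻¹' S) ∂ν := Measure.prod_apply_symm hS
  have hlow : ENNReal.ofReal (2 * Real.pi * η) * μ (Metric.ball 0 r) ≤ (μ'.prod ν) S := by
    rw [e1, ← setLIntegral_const]
    refine setLIntegral_mono' measurableSet_ball fun b hb => ?_
    have h1 := (hcon b hb).le
    have h2 : MeasurableSet (Prod.mk b ⁻¹' S) := measurable_prodMk_left hS
    rw [Measure.restrict_apply h2]
    exact h1
  have hup : (μ'.prod ν) S ≤ μ D * ENNReal.ofReal (2 * Real.pi) := by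
    rw [e2]
    calc _ ≤ ∫⁻ _, μ D ∂ν := by
          refine lintegral_mono fun θ => ?_
          refine (Measure.restrict_apply_le _ _).trans_eq ?_
          exact measure_preimage_add_smul μ (c := circleMap 0 1 θ) (by simp) z D
      _ = _ := by
          rw [lintegral_const, Measure.restrict_apply_univ, Real.volume_Ioc, sub_zero]
  have hpi : 0 < 2 * Real.pi := by positivity
  have h3 := hlow.trans hup
  rw [ENNReal.ofReal_mul hpi.le, mul_comm (μ D), mul_assoc] at h3
  have h4 := (ENNReal.mul_le_mul_iff_right (ENNReal.ofReal_pos.2 hpi).ne'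
    ENNReal.ofReal_ne_top).1 h3
  exact absurd h4 (not_le.2 h)

/-- The sets `D Q`, where the rate c fails in some degree q ≥ Q, decrease to the empty set, hence in
measure. Once `D Q` is small, each z in the smaller ball is the centre of a circle that mostly
avoids it. The sub-mean value inequality for log |f| there, with the crude rate L on the exceptional
arcs, gives the rate c' for all q ≥ Q. -/
theorem IsPolyEnvelope.hartogs {Φ : ℕ → E → ℝ≥0∞} (hΦ : IsPolyEnvelope Φ) {A : E} {r L c c' : ℝ}
    (hr : 0 < r) (hL : 1 ≤ L) (hc : 1 ≤ c) (hcc : c < c')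
    (hbdd : ∀ z ∈ Metric.ball A (2 * r), ∀ q, 1 ≤ q → Φ q z ≤ ENNReal.ofReal (L ^ q))
    (hlim : ∀ z ∈ Metric.ball A (2 * r), ∀ᶠ q in atTop, Φ q z ≤ ENNReal.ofReal (c ^ q)) :
    ∃ Q, ∀ q, Q ≤ q → ∀ z ∈ Metric.ball A r, Φ q z ≤ ENNReal.ofReal (c' ^ q) := by
  let _ : MeasurableSpace E := borel E
  have : BorelSpace E := ⟨rfl⟩
  have : ProperSpace E := FiniteDimensional.proper ℂ E
  let μ : Measure E := Measure.addHaar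
  have hlogL : 0 ≤ Real.log L := Real.log_nonneg hL
  have hlogc : 0 ≤ Real.log c := Real.log_nonneg hc
  have hgap : 0 < Real.log c' - Real.log c := sub_pos.2 (Real.log_lt_log (by linarith) hcc)
  -- Chosen so that log c + η log L ≤ log c'. The summand 1 keeps the denominator positive when L =
  -- 1.
  let η : ℝ := (Real.log c' - Real.log c) / (Real.log L + 1)
  have hη : 0 < η := by positivity
  have hLη : Real.log L * η ≤ Real.log c' - Real.log c := by
    simp only [η]
    rw [mul_div_assoc', div_le_iff₀ (by positivity)]
    nlinarith
  let G : ℕ → Set E := fun Q => {z | ∀ q, Q ≤ q → Φ q z ≤ ENNReal.ofReal (c ^ q)}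
  let D : ℕ → Set E := fun Q => Metric.ball A (2 * r) \ G Q
  have hDm : ∀ Q, MeasurableSet (D Q) := fun Q =>
    measurableSet_ball.diff (hΦ.isClosed_forall_le Q _).measurableSet
  have hDanti : Antitone D := fun Q Q' h z hz => ⟨hz.1, fun hG => hz.2 fun q hq =>
    hG q (h.trans hq)⟩
  have hDempty : ⋂ Q, D Q = ∅ := by
    refine Set.eq_empty_of_forall_notMem fun z hz => ?_
    rw [Set.mem_iInter] at hz
    obtain ⟨Q, hQ⟩ := eventually_atTop.1 (hlim z (hz 0).1)
    exact (hz Q).2 hQ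
  have hDlim : Tendsto (fun Q => μ (D Q)) atTop (𝓝 0) := by
    have := tendsto_measure_iInter_atTop (μ := μ) (fun Q => (hDm Q).nullMeasurableSet) hDanti
      ⟨0, (measure_mono Set.sdiff_subset).trans_lt measure_ball_lt_top |>.ne⟩
    rwa [hDempty, measure_empty] at this
  have hsmall : 0 < ENNReal.ofReal η * μ (Metric.ball (0 : E) r) :=
    ENNReal.mul_pos (ENNReal.ofReal_pos.2 hη).ne' (Metric.measure_ball_pos μ 0 hr).ne'
  obtain ⟨Q, hQ, hQ1⟩ := ((hDlim.eventually_lt_const hsmall).and (eventually_ge_atTop 1)).exists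
  refine ⟨Q, fun q hq z hz => ?_⟩
  obtain ⟨S, hS, hE⟩ := hΦ.exists_eq q
  have hc'0 : 0 < c' := by linarith
  rw [envelope_le_ofReal_iff (hE z) (by positivity)]
  intro f hf
  obtain ⟨b, hb, hvol⟩ := exists_circle_measure_le μ (hDm Q) z hQ
  obtain ⟨p, -, hp⟩ := (hS f hf).2 z b
  have hp0 : f z = p.eval 0 := by rw [← hp 0, zero_smul, add_zero]
  by_cases h0 : p.eval 0 = 0
  · rw [hp0, h0, norm_zero, zero_pow two_ne_zero]; positivity
  have hcont : Continuous fun θ : ℝ => z + circleMap 0 1 θ • b := by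
    have := continuous_circleMap (0 : ℂ) 1
    fun_prop
  have hq1 : 1 ≤ q := hQ1.trans hq
  have hq0 : (0 : ℝ) < q := by exact_mod_cast hq1
  have hlog : ∀ x : ℂ, ∀ C : ℝ, 1 ≤ C → ‖x‖ ^ 2 ≤ C ^ q → Real.log ‖x‖ ≤ q / 2 * Real.log C := by
    intro x C hC hx
    rcases (norm_nonneg x).eq_or_lt with hx0 | hx0
    · rw [← hx0, Real.log_zero]
      have := Real.log_nonneg hC
      positivity
    · have := Real.log_le_log (by positivity) hx
      rw [Real.log_pow, Real.log_pow] at this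
      push_cast at this
      linarith
  have hmain := log_norm_eval_zero_le h0 (T := (fun θ : ℝ => z + circleMap 0 1 θ • b) ⁻¹' D Q)
    (hcont.measurable (hDm Q)) (a := q / 2 * Real.log c) (K := q / 2 * Real.log L) (η := η)
    (by positivity) hη.le ?_ hvol
  · rw [hp0]
    have h1 : 2 * Real.log ‖p.eval 0‖ ≤ q * Real.log c' := by nlinarith
    have hn : 0 < ‖p.eval 0‖ := norm_pos_iff.2 h0
    rw [← Real.log_le_log_iff (by positivity) (by positivity), Real.log_pow, Real.log_pow]
    push_cast
    exact h1
  · intro θ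
    have hmem : z + circleMap 0 1 θ • b ∈ Metric.ball A (2 * r) := by
      rw [Metric.mem_ball, dist_eq_norm] at hz ⊢
      have hb' : ‖circleMap 0 1 θ • b‖ < r := by
        rw [norm_smul]; simpa using hb
      have := norm_add_le (z - A) (circleMap 0 1 θ • b)
      rw [show z + circleMap 0 1 θ • b - A = z - A + circleMap 0 1 θ • b by abel]
      linarith
    rw [← hp]
    by_cases hθ : z + circleMap 0 1 θ • b ∈ G Q
    · have h2 := hlog _ c hc ((envelope_le_ofReal_iff (hE _) (by positivity)).1 (hθ q hq) f hf)
      refine h2.trans (le_add_of_nonneg_right (Set.indicator_nonneg (fun _ _ => ?_) θ))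
      positivity
    · have h2 := hlog _ L hL
        ((envelope_le_ofReal_iff (hE _) (by positivity)).1 (hbdd _ hmem q hq1) f hf)
      rw [Set.indicator_of_mem (show θ ∈ _ ⁻¹' D Q from ⟨hmem, hθ⟩)]
      have : 0 ≤ (q : ℝ) / 2 * Real.log c := by positivity
      linarith

end Hartogs

/-! ### Evaluations depend polynomially on the matrices -/

section PolyOnLines

variable {E : Type*} [NormedAddCommGroup E] [NormedSpace ℂ E] {f g : E → ℂ} {a b : ℕ}

theorem IsPolyOnLines.mono (hf : IsPolyOnLines a f) (h : a ≤ b) : IsPolyOnLines b f :=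
  ⟨hf.1, fun z v => (hf.2 z v).imp fun _ hp => ⟨hp.1.trans h, hp.2⟩⟩

theorem IsPolyOnLines.add (hf : IsPolyOnLines a f) (hg : IsPolyOnLines a g) :
    IsPolyOnLines a fun z => f z + g z := by
  refine ⟨hf.1.add hg.1, fun z v => ?_⟩
  obtain ⟨p, hp, hp'⟩ := hf.2 z v
  obtain ⟨q, hq, hq'⟩ := hg.2 z v
  exact ⟨p + q, Polynomial.natDegree_add_le_of_degree_le hp hq, fun t => by simp [hp', hq']⟩

theorem IsPolyOnLines.mul (hf : IsPolyOnLines a f) (hg : IsPolyOnLines b g) :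
    IsPolyOnLines (a + b) fun z => f z * g z := by
  refine ⟨hf.1.mul hg.1, fun z v => ?_⟩
  obtain ⟨p, hp, hp'⟩ := hf.2 z v
  obtain ⟨q, hq, hq'⟩ := hg.2 z v
  exact ⟨p * q, Polynomial.natDegree_mul_le_of_le hp hq, fun t => by simp [hp', hq']⟩

theorem isPolyOnLines_const (c : ℂ) : IsPolyOnLines a fun _ : E => c :=
  ⟨continuous_const, fun _ _ => ⟨Polynomial.C c, by simp, fun t => by simp⟩⟩

theorem IsPolyOnLines.const_mul (c : ℂ) (hf : IsPolyOnLines a f) :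
    IsPolyOnLines a fun z => c * f z := by
  simpa using (isPolyOnLines_const (a := 0) c).mul hf

theorem IsPolyOnLines.sum {α : Type*} (s : Finset α) {f : α → E → ℂ}
    (hf : ∀ i ∈ s, IsPolyOnLines a (f i)) : IsPolyOnLines a fun z => ∑ i ∈ s, f i z := by
  classical
  induction s using Finset.induction_on with
  | empty => simpa using isPolyOnLines_const 0
  | insert i s hi ih =>
    simp only [Finset.sum_insert hi]
    exact (hf i (by simp)).add (ih fun j hj => hf j (by simp [hj]))

end PolyOnLines

/-! ### The functions Φ^∞_d as polynomial envelopes -/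

section Evaluation

theorem phiInfDeg_mono {ι : Type*} {k : ℕ} {τ : NCPoly ι →ₗ[ℂ] ℂ} : Monotone fun (d : ℕ) (A : ι → Matrix (Fin k) (Fin k) ℂ) =>
    phiInfDeg τ d A := fun _ _ h _ =>
  iSup_mono fun _ => iSup_mono' fun hP => ⟨hP.mono h, le_rfl⟩

/-- Writing the norm as a supremum of moduli of ⟨u, Bv⟩ makes it a supremum of moduli of functions
linear in B, which is what turns Φ^∞_d into an envelope of polynomials. -/
theorem matNorm_le_iff {k : ℕ} {B : Matrix (Fin k) (Fin k) ℂ} {c : ℝ} (hc : 0 ≤ c) :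
    matNorm B ≤ c ↔ ∀ u v : EuclideanSpace ℂ (Fin k), ‖u‖ ≤ 1 → ‖v‖ ≤ 1 →
      ‖∑ i, star (u i) * ∑ j, B i j * v j‖ ≤ c := by
  have hin : ∀ u v : EuclideanSpace ℂ (Fin k), ∑ i, star (u i) * ∑ j, B i j * v j
      = inner ℂ u (Matrix.toEuclideanCLM (n := Fin k) (𝕜 := ℂ) B v) := by
    intro u v
    rw [PiLp.inner_apply]
    refine Finset.sum_congr rfl fun i _ => ?_
    rw [RCLike.inner_apply, mul_comm]
    rfl
  simp only [hin]
  constructor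
  · intro h u v hu hv
    refine (norm_inner_le_norm _ _).trans ?_
    calc ‖u‖ * ‖Matrix.toEuclideanCLM (n := Fin k) (𝕜 := ℂ) B v‖ ≤ 1 * (matNorm B * 1) := by
          refine mul_le_mul hu ?_ (norm_nonneg _) zero_le_one
          exact (ContinuousLinearMap.le_opNorm _ _).trans
            (mul_le_mul_of_nonneg_left hv (norm_nonneg _))
      _ ≤ c := by simpa using h
  · intro h
    refine ContinuousLinearMap.opNorm_le_of_unit_norm (𝕜 := ℂ) hc fun v hv => ?_
    set y := Matrix.toEuclideanCLM (n := Fin k) (𝕜 := ℂ) B v with hy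
    rcases (norm_nonneg y).eq_or_lt with h0 | h0
    · rw [← h0]; exact hc
    · have := h (((‖y‖⁻¹ : ℝ) : ℂ) • y) v (by
        rw [norm_smul, Complex.norm_real, Real.norm_of_nonneg (by positivity),
          inv_mul_cancel₀ h0.ne']) hv.le
      rw [inner_smul_left, norm_mul, ← hy, inner_self_eq_norm_sq_to_K] at this
      simpa [h0.ne', pow_two] using this

attribute [local instance] Matrix.normedAddCommGroup Matrix.normedSpace

variable {ι : Type*} [Fintype ι] {k : ℕ} {τ : NCPoly ι →ₗ[ℂ] ℂ}

theorem isPolyOnLines_coord (i : ι) (a b : Fin k) :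
    IsPolyOnLines 1 fun A : ι → Matrix (Fin k) (Fin k) ℂ => A i a b := by
  refine ⟨by fun_prop, fun z v => ?_⟩
  refine ⟨Polynomial.C (z i a b) + Polynomial.X * Polynomial.C (v i a b), ?_, fun t => by simp [mul_comm t]⟩
  refine Polynomial.natDegree_add_le_of_degree_le (by simp) ?_
  exact Polynomial.natDegree_mul_le_of_le (m := 1) (n := 0) Polynomial.natDegree_X_le (by simp)

theorem isPolyOnLines_evalTuple_monomial (w : List ι) (a b : Fin k) :
    IsPolyOnLines w.length fun A : ι → Matrix (Fin k) (Fin k) ℂ =>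
      evalTuple A (monomial (FreeMonoid.ofList w)) a b := by
  induction w generalizing a b with
  | nil =>
    have : ∀ A : ι → Matrix (Fin k) (Fin k) ℂ,
        evalTuple A (monomial (FreeMonoid.ofList [])) = 1 := fun A => map_one (evalTuple A)
    simp only [this]
    exact isPolyOnLines_const _
  | cons x w ih =>
    have : ∀ A : ι → Matrix (Fin k) (Fin k) ℂ, evalTuple A (monomial (FreeMonoid.ofList (x :: w)))
        = A x * evalTuple A (monomial (FreeMonoid.ofList w)) := by
      intro A
      have e : monomial (FreeMonoid.ofList (x :: w))
          = monomial (FreeMonoid.of x) * monomial (FreeMonoid.ofList w) := by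
        simp [monomial, FreeMonoid.ofList_cons]
      rw [e, map_mul]
      simp [evalTuple, monomial]
    simp only [this, Matrix.mul_apply]
    refine IsPolyOnLines.sum _ fun c _ => ?_
    rw [List.length_cons, add_comm]
    exact (isPolyOnLines_coord x a c).mul (ih c b)

theorem isPolyOnLines_evalTuple {p : NCPoly ι} {d : ℕ} (hp : p ∈ degLE ι d) (a b : Fin k) :
    IsPolyOnLines d fun A : ι → Matrix (Fin k) (Fin k) ℂ => evalTuple A p a b := by
  induction hp using Submodule.span_induction with
  | mem x hx =>
    obtain ⟨w, hw, rfl⟩ := hx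
    exact (isPolyOnLines_evalTuple_monomial w.toList a b).mono hw
  | zero => simpa using isPolyOnLines_const 0
  | add x y _ _ hx hy => simpa using hx.add hy
  | smul c x _ hx => simpa using hx.const_mul c

theorem continuous_evalTuple (p : NCPoly ι) :
    Continuous fun A : ι → Matrix (Fin k) (Fin k) ℂ => evalTuple A p := by
  obtain ⟨d, hd⟩ := mem_degLE_of_support p
  exact continuous_matrix fun a b => (isPolyOnLines_evalTuple hd a b).1

theorem isPolyOnLines_evalAt {P : Matrix (Fin k) (Fin k) (NCPoly ι)} {d : ℕ}
    (hP : HasDegreeLE P d) (a b : Fin k) :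
    IsPolyOnLines d fun A : ι → Matrix (Fin k) (Fin k) ℂ => evalAt P A 1 a b := by
  simp only [evalAt, Matrix.sum_apply, Matrix.mul_apply]
  refine IsPolyOnLines.sum _ fun i _ => IsPolyOnLines.sum _ fun j _ =>
    IsPolyOnLines.sum _ fun c _ => ?_
  exact (isPolyOnLines_evalTuple (hasDegreeLE_iff.1 hP i j) c b).const_mul _

/-- The envelope is taken over the functions A ↦ ⟨u, P(A)(I) v⟩ with P admissible and u, v in the
unit ball. The two suprema are compared through their upper bounds. -/
theorem isPolyEnvelope_phiInfDeg :
    IsPolyEnvelope fun (d : ℕ) (A : ι → Matrix (Fin k) (Fin k) ℂ) => phiInfDeg τ d A where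
  mono := phiInfDeg_mono
  exists_eq d := by
    refine ⟨{f | ∃ P : Matrix (Fin k) (Fin k) (NCPoly ι), HasDegreeLE P d ∧ opNorm τ P ≤ 1 ∧
      ∃ u v : EuclideanSpace ℂ (Fin k), ‖u‖ ≤ 1 ∧ ‖v‖ ≤ 1 ∧
        f = fun A => ∑ i, star (u i) * ∑ j, evalAt P A 1 i j * v j}, ?_, ?_⟩
    · rintro _ ⟨P, hP, -, u, v, -, -, rfl⟩
      refine IsPolyOnLines.sum _ fun i _ => (IsPolyOnLines.sum _ fun j _ => ?_).const_mul _
      simpa only [mul_comm] using (isPolyOnLines_evalAt hP i j).const_mul (v j)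
    · intro A
      refine eq_of_forall_ge_iff fun c => ?_
      induction c using ENNReal.recTopCoe with
      | top => simp
      | coe c =>
        have hc : (c : ℝ≥0∞) = ENNReal.ofReal (c : ℝ) := (ENNReal.ofReal_coe_nnreal).symm
        rw [phiInfDeg, hc]
        simp only [iSup_le_iff, ENNReal.ofReal_le_ofReal_iff c.coe_nonneg]
        have hsq : ∀ x : ℝ, 0 ≤ x → (x ^ 2 ≤ (c : ℝ) ↔ x ≤ √(c : ℝ)) := fun x hx =>
          (Real.le_sqrt hx c.coe_nonneg).symm
        constructor
        · rintro h _ ⟨P, hP, hP', u, v, hu, hv, rfl⟩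
          rw [hsq _ (norm_nonneg _)]
          have := (hsq _ (matNorm_nonneg _)).1 (h P hP hP')
          exact (matNorm_le_iff (Real.sqrt_nonneg _)).1 this u v hu hv
        · intro h P hP hP'
          rw [hsq _ (matNorm_nonneg _), matNorm_le_iff (Real.sqrt_nonneg _)]
          intro u v hu hv
          rw [← hsq _ (norm_nonneg _)]
          exact h _ ⟨P, hP, hP', u, v, hu, hv, rfl⟩

end Evaluation

/-! ### Consequences of the Bernstein–Markov property -/

section Factor

variable {ι I : Type*} {k : ℕ} {τ : NCPoly ι →ₗ[ℂ] ℂ} {deg : I → ℕ} {e : I → NCPoly ι} {M : ℕ → ℝ}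

/-- The inequalities in the Bernstein–Markov property for matrices of size `k`. -/
def IsBernsteinMarkovBound (k : ℕ) (τ : NCPoly ι →ₗ[ℂ] ℂ) (M : ℕ → ℝ) : Prop :=
  ∀ d : ℕ, 1 ≤ d → 0 ≤ M d ∧ ∀ P : Matrix (Fin k) (Fin k) (NCPoly ι), HasDegreeEq P d →
    opNorm τ P ≤ ENNReal.ofReal (M d * l2Norm τ P)

theorem l2Norm_scalarPoly (hk : 1 ≤ k) (p : NCPoly ι) :
    l2Norm τ (scalarPoly k p) = √(τ (ncStar p * p)).re := by
  have h : ∀ i : Fin k, ∑ j, (τ (ncStar (scalarPoly k p j i) * scalarPoly k p j i)).re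
      = (τ (ncStar p * p)).re := by
    intro i
    rw [Finset.sum_eq_single i]
    · simp [scalarPoly]
    · intro j _ hj
      simp [scalarPoly, Matrix.diagonal_apply_ne _ hj]
    · simp
  have hk0 : (k : ℝ) ≠ 0 := by exact_mod_cast (by omega : k ≠ 0)
  rw [l2Norm]
  simp only [h, Finset.sum_const, Finset.card_univ, Fintype.card_fin, nsmul_eq_mul]
  rw [mul_div_cancel_left₀ _ hk0]

theorem IsBernsteinMarkovBound.mulBound (hM : IsBernsteinMarkovBound k τ M) (hτ : IsPositive τ)
    (hk : 1 ≤ k) {p : NCPoly ι} {d : ℕ} (hd : 1 ≤ d) (hp : p ∈ degLE ι d)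
    (hp' : p ∉ degLE ι (d - 1)) : MulBound τ p (M d * √(τ (ncStar p * p)).re) := by
  have := (hM d hd).2 _ (hasDegreeEq_scalarPoly hk hd hp hp')
  rw [l2Norm_scalarPoly hk] at this
  exact mulBound_of_opNorm hτ hk (mul_nonneg (hM d hd).1 (Real.sqrt_nonneg _)) this

/-- Multiplication by p sends 1 to p, so ‖p‖₂ ≤ M_d ‖p‖₂, and faithfulness allows cancellation. It
lets M_d be divided by later. -/
theorem IsBernsteinMarkovBound.one_le (hM : IsBernsteinMarkovBound k τ M)
    (hτ : IsFaithfulBoundedTrace τ) (hk : 1 ≤ k) {p : NCPoly ι} {d : ℕ} (hd : 1 ≤ d)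
    (hp : p ∈ degLE ι d) (hp' : p ∉ degLE ι (d - 1)) : 1 ≤ M d := by
  have hpos : 0 < (τ (ncStar p * p)).re := by
    refine (hτ.nonneg p).1.lt_of_ne fun h => hp' ?_
    rw [hτ.faithful p (Complex.ext h.symm (hτ.nonneg p).2)]
    exact Submodule.zero_mem _
  have := hM.mulBound hτ.isPositive hk hd hp hp' 1
  rw [mul_one, ncStar_one, one_mul, hτ.map_one, Complex.one_re, mul_one, mul_pow,
    Real.sq_sqrt hpos.le] at this
  have h1 : 1 ≤ M d ^ 2 := le_of_mul_le_mul_right (by linarith) hpos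
  exact (one_le_sq_iff₀ (hM d hd).1).1 h1

theorem IsOrthoSystem.one_le (he : IsOrthoSystem τ deg e) (hM : IsBernsteinMarkovBound k τ M)
    (hτ : IsFaithfulBoundedTrace τ) (hk : 1 ≤ k) (i : I) : 1 ≤ M (deg i) :=
  hM.one_le hτ hk (he.one_le_deg i) (he.mem i) (he.notMem i)

theorem IsOrthoSystem.mulBound (he : IsOrthoSystem τ deg e) (hM : IsBernsteinMarkovBound k τ M)
    (hτ : IsPositive τ) (hk : 1 ≤ k) (i : I) : MulBound τ (e i) (M (deg i)) := by
  have := hM.mulBound hτ hk (he.one_le_deg i) (he.mem i) (he.notMem i)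
  rwa [he.norm_one, Complex.one_re, Real.sqrt_one, mul_one] at this

/-- The polynomial p / c, amplified to a scalar matrix polynomial, competes in the supremum. -/
theorem MulBound.matNorm_sq_le {p : NCPoly ι} {c : ℝ} (hp : MulBound τ p c) (hτ : IsPositive τ)
    (hc : 0 < c) {d : ℕ} (hd : p ∈ degLE ι d) (A : ι → Matrix (Fin k) (Fin k) ℂ) :
    ENNReal.ofReal ((matNorm (evalTuple A p) / c) ^ 2) ≤ phiInfDeg τ d A := by
  have h1 := opNorm_smul_le_one hc (hp.vecL2Norm_le (k := k) hτ hc.le)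
  refine le_trans ?_ (le_iSup_of_le (((c⁻¹ : ℝ) : ℂ) • scalarPoly k p)
    (le_iSup_of_le ((hasDegreeLE_scalarPoly hd).smul _) (le_iSup_of_le h1 le_rfl)))
  rw [evalAt_smul, evalAt_scalarPoly, matNorm_smul, Complex.norm_real,
    Real.norm_of_nonneg (inv_nonneg.2 hc.le), div_eq_inv_mul]

theorem one_le_phiInfDeg (hk : 1 ≤ k) (hτ : IsPositive τ) (d : ℕ)
    (A : ι → Matrix (Fin k) (Fin k) ℂ) : 1 ≤ phiInfDeg τ d A := by
  have := (MulBound.one (τ := τ)).matNorm_sq_le hτ one_pos (one_mem_degLE d) A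
  rw [map_one, matNorm_one hk] at this
  simpa using this

theorem evalTuple_ncStar {A : ι → Matrix (Fin k) (Fin k) ℂ} (hA : ∀ i, (A i).IsHermitian)
    (p : NCPoly ι) : evalTuple A (ncStar p) = (evalTuple A p)ᴴ := by
  induction p using MonoidAlgebra.induction_linear with
  | zero => simp [ncStar_zero]
  | add p q hp hq => rw [ncStar_add, map_add, hp, hq, map_add, Matrix.conjTranspose_add]
  | single w c =>
    rw [ncStar_single]
    simp only [evalTuple, MonoidAlgebra.lift_single, Matrix.conjTranspose_smul]
    congr 1
    induction w using FreeMonoid.inductionOn' with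
    | one => simp
    | of_mul x w ih =>
      rw [star_mul, map_mul, ih, map_mul, Matrix.conjTranspose_mul]
      simp [(hA x).eq]

theorem matNorm_conjTranspose_mul_self_pow (B : Matrix (Fin k) (Fin k) ℂ) (j : ℕ) :
    matNorm ((Bᴴ * B) ^ 2 ^ j) = (matNorm B ^ 2) ^ 2 ^ j := by
  have hs : ∀ B : Matrix (Fin k) (Fin k) ℂ, Matrix.toEuclideanCLM (n := Fin k) (𝕜 := ℂ) Bᴴ
      = star (Matrix.toEuclideanCLM (n := Fin k) (𝕜 := ℂ) B) := fun B =>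
    map_star (Matrix.toEuclideanCLM (n := Fin k) (𝕜 := ℂ)) B
  have key : ∀ T : EuclideanSpace ℂ (Fin k) →L[ℂ] EuclideanSpace ℂ (Fin k),
      ‖(star T * T) ^ 2 ^ j‖ = (‖T‖ ^ 2) ^ 2 ^ j := fun T => by
    rw [(IsSelfAdjoint.star_mul_self T).norm_pow_two_pow, CStarRing.norm_star_mul_self, ← pow_two]
  rw [matNorm, map_pow, map_mul, hs]
  exact key _

/-- For selfadjoint matrices the limiting growth rate dominates the growth in every degree. -/
theorem MulBound.matNorm_sq_le_limsup {p : NCPoly ι} {c : ℝ} (hp : MulBound τ p c)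
    (hτ : IsPositive τ) (hc : 0 < c) {d : ℕ} (hd : 1 ≤ d) (hpd : p ∈ degLE ι d)
    {A : ι → Matrix (Fin k) (Fin k) ℂ} (hA : ∀ i, (A i).IsHermitian) :
    ENNReal.ofReal ((matNorm (evalTuple A p) / c) ^ 2)
      ≤ limsup (fun q : ℕ => phiInfDeg τ q A ^ (1 / (q : ℝ))) atTop ^ d := by
  set x : ℝ := (matNorm (evalTuple A p) / c) ^ 2 with hx
  have hx0 : 0 ≤ x := by positivity
  have hd0 : (0 : ℝ) < d := by exact_mod_cast hd
  -- The competitor is (p^⋆ p)^N, of degree at most 2dN and with bound c^{2N}. Since A is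
  -- selfadjoint, its value at A has norm exactly ‖p(A)‖^{2N}, so the root of order 2dN does not
  -- depend on N. Powers of two suffice and follow from iterating the C⋆-identity.
  have hN : ∀ N : ℕ, (∃ j, N = 2 ^ j) →
      ENNReal.ofReal x ^ (1 / (d : ℝ))
        ≤ phiInfDeg τ ((d + d) * N) A ^ (1 / (((d + d) * N : ℕ) : ℝ)) := by
    rintro N ⟨j, rfl⟩
    have h1 := (((hp.star hτ hc).mul hp).pow (2 ^ j)).matNorm_sq_le hτ (by positivity)
      (pow_mem_degLE (mul_mem_degLE (ncStar_mem_degLE hpd) hpd) (2 ^ j)) A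
    rw [map_pow, map_mul, evalTuple_ncStar hA, matNorm_conjTranspose_mul_self_pow] at h1
    have e1 : ((matNorm (evalTuple A p) ^ 2) ^ 2 ^ j / (c * c) ^ 2 ^ j) ^ 2 = x ^ (2 * 2 ^ j) := by
      rw [hx, div_pow, ← pow_two, ← div_pow, ← pow_mul]
      ring
    rw [e1, ENNReal.ofReal_pow hx0] at h1
    have h2 := ENNReal.rpow_le_rpow h1 (z := 1 / (((d + d) * 2 ^ j : ℕ) : ℝ)) (by positivity)
    refine le_trans (le_of_eq ?_) h2
    rw [← ENNReal.rpow_natCast, ← ENNReal.rpow_mul]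
    congr 1
    push_cast
    field_simp
    ring
  have h3 : ENNReal.ofReal x ^ (1 / (d : ℝ))
      ≤ limsup (fun q : ℕ => phiInfDeg τ q A ^ (1 / (q : ℝ))) atTop := by
    refine le_limsup_of_frequently_le ?_
    rw [frequently_atTop]
    intro a
    refine ⟨(d + d) * 2 ^ a, ?_, hN _ ⟨a, rfl⟩⟩
    calc a ≤ 2 ^ a := Nat.lt_two_pow_self.le
      _ ≤ (d + d) * 2 ^ a := Nat.le_mul_of_pos_left _ (by omega)
  have h4 := pow_le_pow_left' h3 d
  rwa [← ENNReal.rpow_natCast, ← ENNReal.rpow_mul, one_div, inv_mul_cancel₀ hd0.ne',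
    ENNReal.rpow_one] at h4

theorem le_uscReg {E : Type*} [TopologicalSpace E] (f : E → ℝ≥0∞) (z : E) : f z ≤ uscReg f z :=
  le_limsup_of_frequently_le (Filter.Frequently.filter_mono
    (frequently_pure.2 le_rfl : ∃ᶠ x in pure z, f z ≤ f x) (pure_le_nhds z))

theorem le_pow_of_rpow_le {x c : ℝ≥0∞} {q : ℕ} (hq : 1 ≤ q) (h : x ^ (1 / (q : ℝ)) ≤ c) :
    x ≤ c ^ q := by
  have hq0 : (0 : ℝ) < q := by exact_mod_cast hq
  rwa [one_div, ENNReal.rpow_inv_le_iff hq0, ENNReal.rpow_natCast] at h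

theorem rpow_le_of_le_pow {x c : ℝ≥0∞} {q : ℕ} (hq : 1 ≤ q) (h : x ≤ c ^ q) :
    x ^ (1 / (q : ℝ)) ≤ c := by
  have hq0 : (0 : ℝ) < q := by exact_mod_cast hq
  rwa [one_div, ENNReal.rpow_inv_le_iff hq0, ENNReal.rpow_natCast]

theorem IsOrthoSystem.matNorm_sq_le (he : IsOrthoSystem τ deg e)
    (hM : IsBernsteinMarkovBound k τ M) (hτ : IsFaithfulBoundedTrace τ) (hk : 1 ≤ k) (i : I)
    {A : ι → Matrix (Fin k) (Fin k) ℂ} {y : ℝ≥0∞}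
    (h : ENNReal.ofReal ((matNorm (evalTuple A (e i)) / M (deg i)) ^ 2) ≤ y) :
    ENNReal.ofReal (matNorm (evalTuple A (e i)) ^ 2) ≤ ENNReal.ofReal (M (deg i)) ^ 2 * y := by
  have hM1 := he.one_le hM hτ hk i
  have e1 : matNorm (evalTuple A (e i)) ^ 2
      = M (deg i) ^ 2 * (matNorm (evalTuple A (e i)) / M (deg i)) ^ 2 := by
    field_simp
  rw [e1, ENNReal.ofReal_mul (by positivity), ENNReal.ofReal_pow (by linarith)]
  gcongr

/-- The regularization already carries the strict bound to a neighbourhood, and Σ^∞ bounds every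
degree there. -/
theorem eventually_matNorm_sq_le_of_sigmaInf_lt (he : IsOrthoSystem τ deg e)
    (hM : IsBernsteinMarkovBound k τ M) (hτ : IsFaithfulBoundedTrace τ) (hk : 1 ≤ k)
    {A : ι → Matrix (Fin k) (Fin k) ℂ} {c : ℝ≥0∞} (hc : sigmaInf τ A < c) :
    ∀ᶠ ζ in 𝓝 A, ∀ i, ENNReal.ofReal (matNorm (evalTuple ζ (e i)) ^ 2)
      ≤ ENNReal.ofReal (M (deg i)) ^ 2 * c ^ deg i := by
  filter_upwards [eventually_lt_of_limsup_lt hc] with ζ hζ i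
  have hM1 := he.one_le hM hτ hk i
  refine he.matNorm_sq_le hM hτ hk i (((he.mulBound hM hτ.isPositive hk i).matNorm_sq_le
    hτ.isPositive (by linarith) (he.mem i) ζ).trans ?_)
  refine le_pow_of_rpow_le (he.one_le_deg i) (le_trans ?_ hζ.le)
  exact le_iSup₂_of_le (deg i) (he.one_le_deg i) le_rfl

theorem phiInf_le_sigmaInf (A : ι → Matrix (Fin k) (Fin k) ℂ) : phiInf τ A ≤ sigmaInf τ A := by
  refine limsup_le_limsup (Eventually.of_forall fun ζ => ?_)
  refine limsup_le_of_le (h := ?_)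
  filter_upwards [eventually_ge_atTop 1] with d hd
  exact le_iSup₂_of_le (f := fun (d : ℕ) (_ : 1 ≤ d) => phiInfDeg τ d ζ ^ (1 / (d : ℝ)))
    d hd le_rfl

theorem one_le_phiInf (hk : 1 ≤ k) (hτ : IsPositive τ) (A : ι → Matrix (Fin k) (Fin k) ℂ) :
    1 ≤ phiInf τ A := by
  refine le_trans ?_ (le_uscReg _ A)
  refine le_limsup_of_frequently_le ((eventually_ge_atTop 1).mono fun d hd => ?_).frequently
  exact ENNReal.one_le_rpow (one_le_phiInfDeg hk hτ d A) (by positivity)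

/-! ### Local uniform bounds from pointwise growth rates -/

section Topological

attribute [local instance] Matrix.normedAddCommGroup Matrix.normedSpace

theorem exists_phiInfDeg_le_of_lt_top [Fintype ι] {U : Set (ι → Matrix (Fin k) (Fin k) ℂ)}
    (hU : IsOpen U) (hne : U.Nonempty)
    (h : ∀ z ∈ U, limsup (fun q : ℕ => phiInfDeg τ q z ^ (1 / (q : ℝ))) atTop < ⊤) (R : ℝ)
    (z₁ : ι → Matrix (Fin k) (Fin k) ℂ) :
    ∃ L : ℝ, 1 ≤ L ∧ ∀ z ∈ Metric.closedBall z₁ R, ∀ q, 1 ≤ q →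
      phiInfDeg τ q z ≤ ENNReal.ofReal (L ^ q) := by
  have : CompleteSpace (ι → Matrix (Fin k) (Fin k) ℂ) := FiniteDimensional.complete ℂ _
  exact isPolyEnvelope_phiInfDeg.exists_le_of_limsup_lt_top hU hne h R z₁

/-- Finiteness at one point implies finiteness everywhere. -/
theorem sigmaInf_lt_top [Finite ι] {z₀ : ι → Matrix (Fin k) (Fin k) ℂ} (h : phiInf τ z₀ < ⊤)
    (z : ι → Matrix (Fin k) (Fin k) ℂ) : sigmaInf τ z < ⊤ := by
  have := Fintype.ofFinite ι
  -- Since `phiInf` is a regularization, finiteness at z₀ already bounds the unregularized rates on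
  -- a neighbourhood, which is the open set that the Baire argument needs.
  obtain ⟨U, hU, hUo, hz₀⟩ := eventually_nhds_iff.1 (eventually_lt_of_limsup_lt h)
  obtain ⟨L, hL, hb⟩ := exists_phiInfDeg_le_of_lt_top hUo ⟨z₀, hz₀⟩ hU 1 z
  refine lt_of_le_of_lt (limsup_le_of_le (a := ENNReal.ofReal L) (h := ?_)) ENNReal.ofReal_lt_top
  filter_upwards [Metric.closedBall_mem_nhds z one_pos] with ζ hζ
  refine iSup₂_le fun d hd => rpow_le_of_le_pow hd ?_
  rw [← ENNReal.ofReal_pow (by linarith)]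
  exact hb ζ hζ d hd

/-- Φ^∞ says nothing directly about a fixed degree. High degrees are bounded uniformly near A by the
Hartogs lemma; the finitely many low ones are bounded strictly at A itself, where selfadjointness is
used, and near A by continuity. -/
theorem eventually_matNorm_sq_le_of_phiInf_lt [Fintype ι] (he : IsOrthoSystem τ deg e)
    (hM : IsBernsteinMarkovBound k τ M) (hτ : IsFaithfulBoundedTrace τ) (hk : 1 ≤ k)
    {A : ι → Matrix (Fin k) (Fin k) ℂ} (hA : ∀ i, (A i).IsHermitian) {c : ℝ≥0∞}
    (hc : phiInf τ A < c) :
    ∀ᶠ ζ in 𝓝 A, ∀ i, ENNReal.ofReal (matNorm (evalTuple ζ (e i)) ^ 2)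
      ≤ ENNReal.ofReal (M (deg i)) ^ 2 * c ^ deg i := by
  -- Two intermediate rates: the pointwise growth near A is below c₁, and the Hartogs lemma loses c₂
  -- > c₁ while staying below c.
  obtain ⟨c₁, h₁, h₁'⟩ := ENNReal.lt_iff_exists_nnreal_btwn.1 hc
  obtain ⟨c₂, h₂, h₂'⟩ := ENNReal.lt_iff_exists_nnreal_btwn.1 h₁'
  have hc₁ : (1 : ℝ) ≤ c₁ := by
    have := (one_le_phiInf hk hτ.isPositive A).trans h₁.le
    exact_mod_cast this
  have hc₁₂ : (c₁ : ℝ) < c₂ := by exact_mod_cast h₂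
  have hpow : ∀ (c : NNReal) (q : ℕ), ENNReal.ofReal ((c : ℝ) ^ q) = (c : ℝ≥0∞) ^ q := by
    intro c q
    rw [ENNReal.ofReal_pow c.coe_nonneg, ENNReal.ofReal_coe_nnreal]
  obtain ⟨U, hU, hUo, hAU⟩ := eventually_nhds_iff.1 (eventually_lt_of_limsup_lt h₁)
  obtain ⟨r, hr, hrU⟩ := Metric.isOpen_iff.1 hUo A hAU
  obtain ⟨L, hL, hb⟩ := exists_phiInfDeg_le_of_lt_top hUo ⟨A, hAU⟩
    (fun z hz => (hU z hz).trans ENNReal.coe_lt_top) r A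
  have hr2 : 2 * (r / 2) = r := by ring
  obtain ⟨Q, hQ⟩ := (isPolyEnvelope_phiInfDeg (τ := τ)).hartogs (A := A) (half_pos hr) hL hc₁ hc₁₂
    (fun z hz q hq => hb z (Metric.ball_subset_closedBall (by rwa [hr2] at hz)) q hq)
    (fun z hz => by
      rw [hr2] at hz
      filter_upwards [eventually_lt_of_limsup_lt (hU z (hrU hz)), eventually_ge_atTop 1]
        with q hq hq1
      rw [hpow]
      exact le_pow_of_rpow_le hq1 hq.le)
  have hhigh : ∀ᶠ ζ in 𝓝 A, ∀ i, Q ≤ deg i → ENNReal.ofReal (matNorm (evalTuple ζ (e i)) ^ 2)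
      ≤ ENNReal.ofReal (M (deg i)) ^ 2 * c ^ deg i := by
    filter_upwards [Metric.ball_mem_nhds A (half_pos hr)] with ζ hζ i hi
    have hM1 := he.one_le hM hτ hk i
    refine he.matNorm_sq_le hM hτ hk i (((he.mulBound hM hτ.isPositive hk i).matNorm_sq_le
      hτ.isPositive (by linarith) (he.mem i) ζ).trans ?_)
    refine (hQ _ hi ζ hζ).trans ?_
    rw [hpow]
    exact pow_le_pow_left' h₂'.le _
  have hfin : {i | deg i < Q}.Finite := by
    have : {i | deg i < Q} = ⋃ d ∈ Finset.range Q, {i | deg i = d} := by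
      ext i; simp
    rw [this]
    exact Set.Finite.biUnion (Finset.finite_toSet _) fun d _ => he.finite_deg d
  have hlow : ∀ᶠ ζ in 𝓝 A, ∀ i ∈ {i | deg i < Q},
      ENNReal.ofReal (matNorm (evalTuple ζ (e i)) ^ 2)
        ≤ ENNReal.ofReal (M (deg i)) ^ 2 * c ^ deg i := by
    rw [eventually_all_finite hfin]
    intro i _
    have hM1 := he.one_le hM hτ hk i
    have hd := he.one_le_deg i
    have h5 := he.matNorm_sq_le hM hτ hk i ((he.mulBound hM hτ.isPositive hk i).matNorm_sq_le_limsup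
      hτ.isPositive (by linarith) hd (he.mem i) hA)
    have h6 : ENNReal.ofReal (M (deg i)) ^ 2
        * limsup (fun q : ℕ => phiInfDeg τ q A ^ (1 / (q : ℝ))) atTop ^ deg i
        < ENNReal.ofReal (M (deg i)) ^ 2 * c ^ deg i := by
      have hpos : ENNReal.ofReal (M (deg i)) ^ 2 ≠ 0 :=
        pow_ne_zero 2 (ENNReal.ofReal_pos.2 (by linarith)).ne'
      refine (ENNReal.mul_lt_mul_iff_right hpos (ENNReal.pow_ne_top ENNReal.ofReal_ne_top)).2 ?_
      exact ENNReal.pow_lt_pow_left (by omega) ((le_uscReg _ A).trans_lt hc)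
    have hcont : Continuous fun ζ : ι → Matrix (Fin k) (Fin k) ℂ =>
        ENNReal.ofReal (matNorm (evalTuple ζ (e i)) ^ 2) := by
      refine ENNReal.continuous_ofReal.comp (Continuous.pow ?_ 2)
      have hlin : Continuous (Matrix.toEuclideanCLM (n := Fin k) (𝕜 := ℂ)) :=
        LinearMap.continuous_of_finiteDimensional
          (Matrix.toEuclideanCLM (n := Fin k) (𝕜 := ℂ)).toAlgEquiv.toLinearMap
      exact (hlin.comp (continuous_evalTuple (e i))).norm
    exact (hcont.tendsto A).eventually_le_const (h5.trans_lt h6)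
  filter_upwards [hhigh, hlow] with ζ hζ hζ' i
  rcases le_or_gt Q (deg i) with h | h
  · exact hζ i h
  · exact hζ' i h

end Topological

/-! ### The constant `bmSup` -/

/-- A finite limsup bounds all but finitely many terms, and each of the remaining ones is finite. -/
theorem bmSup_lt_top {C : ℝ}
    (h : limsup (fun d : ℕ => ENNReal.ofReal (M d) ^ (1 / (d : ℝ))) atTop = ENNReal.ofReal C) :
    bmSup M < ⊤ := by
  have h1 : limsup (fun d : ℕ => ENNReal.ofReal (M d) ^ (1 / (d : ℝ))) atTop
      < ENNReal.ofReal C + 1 := by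
    rw [h]
    exact ENNReal.lt_add_right ENNReal.ofReal_ne_top one_ne_zero
  obtain ⟨N, hN⟩ := eventually_atTop.1 (eventually_lt_of_limsup_lt h1)
  have hle : bmSup M ≤ (ENNReal.ofReal C + 1) ^ 2
      + ∑ q ∈ Finset.range N, ENNReal.ofReal (M q) ^ (2 / (q : ℝ)) := by
    refine iSup₂_le fun q hq => ?_
    rcases lt_or_ge q N with hqN | hqN
    · refine le_add_left ?_
      exact Finset.single_le_sum (f := fun q : ℕ => ENNReal.ofReal (M q) ^ (2 / (q : ℝ)))
        (fun _ _ => bot_le) (Finset.mem_range.2 hqN)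
    · refine le_add_right ?_
      have e1 : ENNReal.ofReal (M q) ^ (2 / (q : ℝ))
          = (ENNReal.ofReal (M q) ^ (1 / (q : ℝ))) ^ 2 := by
        rw [← ENNReal.rpow_natCast, ← ENNReal.rpow_mul]
        congr 1
        push_cast
        ring
      rw [e1]
      exact pow_le_pow_left' (hN q hqN).le 2
  refine hle.trans_lt (ENNReal.add_lt_top.2 ⟨ENNReal.pow_lt_top (by simp), ?_⟩)
  refine ENNReal.sum_lt_top.2 fun q _ => ?_
  exact ENNReal.rpow_lt_top_of_nonneg (by positivity) ENNReal.ofReal_ne_top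

theorem sq_le_bmSup_pow {q : ℕ} (hq : 1 ≤ q) : ENNReal.ofReal (M q) ^ 2 ≤ bmSup M ^ q := by
  have h := le_iSup₂_of_le (f := fun (q : ℕ) (_ : 1 ≤ q) => ENNReal.ofReal (M q) ^ (2 / (q : ℝ)))
    q hq le_rfl
  have hq0 : (q : ℝ) ≠ 0 := by exact_mod_cast (by omega : q ≠ 0)
  refine le_trans (le_of_eq ?_) (pow_le_pow_left' h q)
  rw [← ENNReal.rpow_natCast, ← ENNReal.rpow_natCast, ← ENNReal.rpow_mul, div_mul_cancel₀ _ hq0]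
  rfl

theorem one_le_bmSup [Nonempty ι] (hM : IsBernsteinMarkovBound k τ M)
    (hτ : IsFaithfulBoundedTrace τ) (hk : 1 ≤ k) : 1 ≤ bmSup M := by
  let i : ι := Classical.arbitrary ι
  have h1 : monomial (FreeMonoid.of i) ∈ degLE ι 1 := monomial_mem_degLE (by simp)
  have h2 : monomial (FreeMonoid.of i) ∉ degLE ι (1 - 1) := by
    rw [mem_degLE]
    intro h
    have := h (FreeMonoid.of i) (by simp [monomial])
    simp at this
  have h3 := hM.one_le hτ hk le_rfl h1 h2
  have h4 := sq_le_bmSup_pow (M := M) (le_refl 1)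
  rw [pow_one] at h4
  refine le_trans (one_le_pow₀ ?_) h4
  rwa [ENNReal.one_le_ofReal]

theorem ofReal_matNorm_sq_le_pow (he : IsOrthoSystem τ deg e) {i : I}
    {A : ι → Matrix (Fin k) (Fin k) ℂ} {c : ℝ≥0∞} {L : ℝ} (hL : 0 ≤ L)
    (hc : bmSup M * c ≤ ENNReal.ofReal L)
    (h : ENNReal.ofReal (matNorm (evalTuple A (e i)) ^ 2)
      ≤ ENNReal.ofReal (M (deg i)) ^ 2 * c ^ deg i) :
    matNorm (evalTuple A (e i)) ^ 2 ≤ L ^ deg i := by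
  rw [← ENNReal.ofReal_le_ofReal_iff (by positivity), ENNReal.ofReal_pow hL]
  refine h.trans ((mul_le_mul_left (sq_le_bmSup_pow (he.one_le_deg i)) _).trans ?_)
  rw [← mul_pow]
  exact pow_le_pow_left' hc _

end Factor

/-! ### Siciak functions of free products -/

section Comparison

variable {ι : Type*} {k : ℕ} {τ : NCPoly ι →ₗ[ℂ] ℂ}

theorem trace_conjTranspose_mul_self_le (B : Matrix (Fin k) (Fin k) ℂ) :
    (Bᴴ * B).trace.re / k ≤ matNorm B ^ 2 := by
  have h1 : (Bᴴ * B).trace.re = ∑ j, sqNorm (B *ᵥ Pi.single j 1) := by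
    rw [Matrix.trace, Complex.re_sum]
    refine Finset.sum_congr rfl fun j _ => ?_
    rw [Matrix.diag_apply, Matrix.mul_apply, Complex.re_sum, sqNorm]
    refine Finset.sum_congr rfl fun i _ => ?_
    rw [Matrix.mulVec_single_one, Matrix.conjTranspose_apply, Complex.star_def, Complex.conj_mul',
      ← Complex.ofReal_pow, Complex.ofReal_re]
    rfl
  have h2 : ∀ j : Fin k, sqNorm (Pi.single j (1 : ℂ)) = 1 := by
    intro j
    rw [sqNorm, Finset.sum_eq_single j]
    · simp
    · intro i _ hi
      simp [Pi.single_eq_of_ne hi]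
    · simp
  rw [h1]
  refine div_le_of_le_mul₀ (Nat.cast_nonneg k) (by positivity) ?_
  calc ∑ j : Fin k, sqNorm (B *ᵥ Pi.single j 1) ≤ ∑ _j : Fin k, matNorm B ^ 2 := by
        refine Finset.sum_le_sum fun j _ => ?_
        simpa [h2] using sqNorm_mulVec_le B (Pi.single j 1)
    _ = matNorm B ^ 2 * k := by simp [mul_comm]

theorem phiTwoDeg_le_phiInfDeg (d : ℕ) (A : ι → Matrix (Fin k) (Fin k) ℂ) :
    phiTwoDeg τ d A ≤ phiInfDeg τ d A :=
  iSup_mono fun _ => iSup_mono fun _ => iSup_mono fun _ =>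
    ENNReal.ofReal_le_ofReal (trace_conjTranspose_mul_self_le _)

theorem phiTwo_le_phiInf (A : ι → Matrix (Fin k) (Fin k) ℂ) : phiTwo τ A ≤ phiInf τ A :=
  limsup_le_limsup (Eventually.of_forall fun ζ => limsup_le_limsup (Eventually.of_forall fun d =>
    ENNReal.rpow_le_rpow (phiTwoDeg_le_phiInfDeg d ζ) (by positivity)))

theorem sigmaTwo_le_sigmaInf (A : ι → Matrix (Fin k) (Fin k) ℂ) : sigmaTwo τ A ≤ sigmaInf τ A :=
  limsup_le_limsup (Eventually.of_forall fun ζ => iSup₂_mono fun d _ =>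
    ENNReal.rpow_le_rpow (phiTwoDeg_le_phiInfDeg d ζ) (by positivity))

theorem phiTwo_le_sigmaTwo (A : ι → Matrix (Fin k) (Fin k) ℂ) : phiTwo τ A ≤ sigmaTwo τ A := by
  refine limsup_le_limsup (Eventually.of_forall fun ζ => ?_)
  refine limsup_le_of_le (h := ?_)
  filter_upwards [eventually_ge_atTop 1] with d hd
  exact le_iSup₂_of_le (f := fun (d : ℕ) (_ : 1 ≤ d) => phiTwoDeg τ d ζ ^ (1 / (d : ℝ)))
    d hd le_rfl

/-- If left multiplication by some letter is bounded then `Φ²_τ` takes a value greater than `1`. -/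
theorem exists_one_lt_phiTwo (hτ : IsPositive τ) (hk : 1 ≤ k) {x : ι} {R : ℝ}
    (hR : MulBound τ (monomial (FreeMonoid.of x)) R) (hR0 : 0 < R) :
    ∃ A : ι → Matrix (Fin k) (Fin k) ℂ, 1 < phiTwo τ A := by
  -- At this scalar tuple the competitor X_x^d / R^d takes the value 2^d I, whose normalized squared
  -- trace norm is 4^d.
  let A : ι → Matrix (Fin k) (Fin k) ℂ := fun _ => ((2 * R : ℝ) : ℂ) • 1
  have hk0 : (k : ℝ) ≠ 0 := by exact_mod_cast (by omega : k ≠ 0)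
  have hdeg : ∀ d : ℕ, ENNReal.ofReal 4 ^ d ≤ phiTwoDeg τ d A := by
    intro d
    have h1 := opNorm_smul_le_one (pow_pos hR0 d)
      ((hR.pow d).vecL2Norm_le (k := k) hτ (pow_pos hR0 d).le)
    have hX : monomial (FreeMonoid.of x) ^ d ∈ degLE ι d := by
      simpa using pow_mem_degLE (monomial_mem_degLE (by simp) :
        monomial (FreeMonoid.of x) ∈ degLE ι 1) d
    refine le_trans (le_of_eq ?_) (le_iSup_of_le
      ((((R ^ d)⁻¹ : ℝ) : ℂ) • scalarPoly k (monomial (FreeMonoid.of x) ^ d))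
      (le_iSup_of_le ((hasDegreeLE_scalarPoly hX).smul _) (le_iSup_of_le h1 le_rfl)))
    have e1 : evalTuple A (monomial (FreeMonoid.of x)) = A x := by simp [evalTuple, monomial]
    have e2 : ((((R ^ d)⁻¹ : ℝ) : ℂ) • (A x ^ d)) = ((2 ^ d : ℝ) : ℂ) • 1 := by
      rw [show A x = ((2 * R : ℝ) : ℂ) • 1 from rfl, smul_pow, one_pow, smul_smul]
      congr 1
      rw [← Complex.ofReal_pow, ← Complex.ofReal_mul, mul_pow]
      congr 1
      field_simp
    rw [evalAt_smul, evalAt_scalarPoly, map_pow, e1, e2, ← ENNReal.ofReal_pow (by norm_num)]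
    congr 1
    rw [Matrix.conjTranspose_smul, Matrix.conjTranspose_one, smul_mul_smul_comm, one_mul,
      Matrix.trace_smul, Matrix.trace_one, Complex.star_def, Complex.conj_ofReal, smul_eq_mul,
      ← Complex.ofReal_mul, Complex.re_ofReal_mul, Fintype.card_fin, Complex.natCast_re,
      mul_div_cancel_right₀ _ hk0, ← mul_pow]
    norm_num
  refine ⟨A, lt_of_lt_of_le ?_ (le_uscReg _ A)⟩
  have h4 : (1 : ℝ≥0∞) < ENNReal.ofReal 4 := by
    rw [ENNReal.one_lt_ofReal]; norm_num
  refine h4.trans_le (le_limsup_of_frequently_le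
    ((eventually_ge_atTop 1).mono fun d hd => ?_).frequently)
  have hd0 : (0 : ℝ) < d := by exact_mod_cast hd
  rw [one_div, ENNReal.le_rpow_inv_iff hd0, ENNReal.rpow_natCast]
  exact hdeg d

/-- The regularization of f looks at all points near π x; openness of π lifts them to points near x.
-/
theorem limsup_comp_le_of_isOpenMap {X Y : Type*} [TopologicalSpace X] [TopologicalSpace Y]
    {π : X → Y} (hπ : IsOpenMap π) (f : Y → ℝ≥0∞) (g : X → ℝ≥0∞) (h : ∀ x, f (π x) ≤ g x) (x : X) :
    uscReg f (π x) ≤ uscReg g x := by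
  calc limsup f (𝓝 (π x)) ≤ limsup f (map π (𝓝 x)) :=
        limsup_le_limsup_of_le (hπ.nhds_le x)
    _ = limsup (f ∘ π) (𝓝 x) := rfl
    _ ≤ limsup g (𝓝 x) := limsup_le_limsup (Eventually.of_forall h)

/-- A plurisubharmonic function is not identically −∞, so a pluripolar set is not the whole space.
One point of finiteness is all that is needed later. -/
theorem FiniteQE.exists_lt_top {E : Type*} [AddCommGroup E] [Module ℂ E] [TopologicalSpace E]
    {f : E → ℝ≥0∞} (h : FiniteQE f) : ∃ z, f z < ⊤ := by
  obtain ⟨F, hF, hf⟩ := h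
  by_cases h0 : (0 : E) ∈ F
  · obtain ⟨W, -, -, -, v, hv, hsub⟩ := hF 0 h0
    obtain ⟨z, hz, hvz⟩ := hv.not_bot
    exact ⟨z, hf z fun hzF => hvz (hsub ⟨hzF, hz⟩)⟩
  · exact ⟨0, hf 0 h0⟩

theorem finiteQE_of_forall_lt_top {E : Type*} [AddCommGroup E] [Module ℂ E] [TopologicalSpace E]
    {f : E → ℝ≥0∞} (h : ∀ z, f z < ⊤) : FiniteQE f :=
  ⟨∅, fun _ ha => absurd ha (Set.notMem_empty _), fun z _ => h z⟩

end Comparison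

/-! ### Comparing the free product with its factors -/

section Product

variable {ι₁ ι₂ I₁ I₂ : Type*} {k : ℕ} {τ₁ : NCPoly ι₁ →ₗ[ℂ] ℂ} {τ₂ : NCPoly ι₂ →ₗ[ℂ] ℂ}
  {τ : NCPoly (ι₁ ⊕ ι₂) →ₗ[ℂ] ℂ} {deg₁ : I₁ → ℕ} {deg₂ : I₂ → ℕ} {e₁ : I₁ → NCPoly ι₁}
  {e₂ : I₂ → NCPoly ι₂}

theorem evalTuple_mapDomain {ι κ : Type*} (f : ι → κ) (A : κ → Matrix (Fin k) (Fin k) ℂ)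
    (p : NCPoly ι) :
    evalTuple A (MonoidAlgebra.mapDomainAlgHom ℂ ℂ (FreeMonoid.map f) p)
      = evalTuple (A ∘ f) p := by
  have hw : ∀ w, FreeMonoid.lift A (FreeMonoid.map f w) = FreeMonoid.lift (A ∘ f) w := by
    intro w
    induction w using FreeMonoid.inductionOn' with
    | one => simp
    | of_mul x w ih => simp [ih]
  induction p using MonoidAlgebra.induction_linear with
  | zero => simp
  | add p q hp hq => simp only [map_add, hp, hq]
  | single w c => simp [evalTuple, hw]

theorem phiInfDeg_comp_le {ι κ : Type*} {τ' : NCPoly ι →ₗ[ℂ] ℂ} {σ : NCPoly κ →ₗ[ℂ] ℂ} (f : ι → κ)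
    (h : ∀ P : Matrix (Fin k) (Fin k) (NCPoly ι), opNorm τ' P ≤ 1 →
      opNorm σ (P.map (MonoidAlgebra.mapDomainAlgHom ℂ ℂ (FreeMonoid.map f))) ≤ 1)
    (d : ℕ) (A : κ → Matrix (Fin k) (Fin k) ℂ) :
    phiInfDeg τ' d (A ∘ f) ≤ phiInfDeg σ d A := by
  refine iSup_le fun P => iSup_le fun hPd => iSup_le fun hP => ?_
  refine le_iSup_of_le (P.map (MonoidAlgebra.mapDomainAlgHom ℂ ℂ (FreeMonoid.map f)))
    (le_iSup_of_le ?_ (le_iSup_of_le (h P hP) (le_of_eq ?_)))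
  · rw [hasDegreeLE_iff] at hPd ⊢
    exact fun i j => mapDomain_mem_degLE f (hPd i j)
  · simp only [evalAt, Matrix.map_apply, evalTuple_mapDomain]

theorem isOpenMap_comp_inl {X : Type*} [TopologicalSpace X] :
    IsOpenMap fun A : ι₁ ⊕ ι₂ → X => A ∘ Sum.inl :=
  isOpenMap_fst.comp (Homeomorph.sumPiEquivProdPi ι₁ ι₂ fun _ => X).isOpenMap

theorem isOpenMap_comp_inr {X : Type*} [TopologicalSpace X] :
    IsOpenMap fun A : ι₁ ⊕ ι₂ → X => A ∘ Sum.inr :=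
  isOpenMap_snd.comp (Homeomorph.sumPiEquivProdPi ι₁ ι₂ fun _ => X).isOpenMap

theorem IsOrthoSystem.vecL2Norm_map_inclLeft_le (h₁ : IsFaithfulBoundedTrace τ₁)
    (h₂ : IsFaithfulBoundedTrace τ₂) (h : IsFreeProduct τ₁ τ₂ τ) (he₁ : IsOrthoSystem τ₁ deg₁ e₁)
    (he₂ : IsOrthoSystem τ₂ deg₂ e₂) {P : Matrix (Fin k) (Fin k) (NCPoly ι₁)} {C : ℝ} (hC : 0 ≤ C)
    (hP : ∀ ξ, vecL2Norm τ₁ (P *ᵥ ξ) ≤ C * vecL2Norm τ₁ ξ) (ξ : Fin k → NCPoly (ι₁ ⊕ ι₂)) :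
    vecL2Norm τ (P.map inclLeft *ᵥ ξ) ≤ C * vecL2Norm τ ξ := by
  refine (he₁.freeSystem h₁ h₂ h he₂).vecL2Norm_map_mulVec_le (c := true) h₁.isPositive inclLeft
    (fun p => ?_) ncStar_inclLeft h.left (fun j hj => ?_) hC hP ξ
  · obtain ⟨d, hd⟩ := mem_degLE_of_support p
    exact ⟨d, p, hd, rfl⟩
  · cases j with
    | inl i => exact ⟨e₁ i, rfl⟩
    | inr i => simp at hj

theorem IsOrthoSystem.vecL2Norm_map_inclRight_le (h₁ : IsFaithfulBoundedTrace τ₁)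
    (h₂ : IsFaithfulBoundedTrace τ₂) (h : IsFreeProduct τ₁ τ₂ τ) (he₁ : IsOrthoSystem τ₁ deg₁ e₁)
    (he₂ : IsOrthoSystem τ₂ deg₂ e₂) {P : Matrix (Fin k) (Fin k) (NCPoly ι₂)} {C : ℝ} (hC : 0 ≤ C)
    (hP : ∀ ξ, vecL2Norm τ₂ (P *ᵥ ξ) ≤ C * vecL2Norm τ₂ ξ) (ξ : Fin k → NCPoly (ι₁ ⊕ ι₂)) :
    vecL2Norm τ (P.map inclRight *ᵥ ξ) ≤ C * vecL2Norm τ ξ := by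
  refine (he₁.freeSystem h₁ h₂ h he₂).vecL2Norm_map_mulVec_le (c := false) h₂.isPositive inclRight
    (fun p => ?_) ncStar_inclRight h.right (fun j hj => ?_) hC hP ξ
  · obtain ⟨d, hd⟩ := mem_degLE_of_support p
    exact ⟨d, p, hd, rfl⟩
  · cases j with
    | inl i => simp at hj
    | inr i => exact ⟨e₂ i, rfl⟩

theorem phiInfDeg_inl_le [Finite ι₁] [Finite ι₂] (h₁ : IsFaithfulBoundedTrace τ₁)
    (h₂ : IsFaithfulBoundedTrace τ₂) (h : IsFreeProduct τ₁ τ₂ τ) (d : ℕ)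
    (A : ι₁ ⊕ ι₂ → Matrix (Fin k) (Fin k) ℂ) :
    phiInfDeg τ₁ d (A ∘ Sum.inl) ≤ phiInfDeg τ d A := by
  obtain ⟨I₁, deg₁, e₁, he₁⟩ := exists_isOrthoSystem h₁
  obtain ⟨I₂, deg₂, e₂, he₂⟩ := exists_isOrthoSystem h₂
  refine phiInfDeg_comp_le Sum.inl (fun P hP => ?_) d A
  rw [opNorm_le_one_iff] at hP ⊢
  have := he₁.vecL2Norm_map_inclLeft_le (τ := τ) h₁ h₂ h he₂ zero_le_one (P := P)
    (by simpa only [one_mul] using hP)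
  simp only [one_mul] at this
  exact this

theorem phiInfDeg_inr_le [Finite ι₁] [Finite ι₂] (h₁ : IsFaithfulBoundedTrace τ₁)
    (h₂ : IsFaithfulBoundedTrace τ₂) (h : IsFreeProduct τ₁ τ₂ τ) (d : ℕ)
    (A : ι₁ ⊕ ι₂ → Matrix (Fin k) (Fin k) ℂ) :
    phiInfDeg τ₂ d (A ∘ Sum.inr) ≤ phiInfDeg τ d A := by
  obtain ⟨I₁, deg₁, e₁, he₁⟩ := exists_isOrthoSystem h₁
  obtain ⟨I₂, deg₂, e₂, he₂⟩ := exists_isOrthoSystem h₂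
  refine phiInfDeg_comp_le Sum.inr (fun P hP => ?_) d A
  rw [opNorm_le_one_iff] at hP ⊢
  have := he₁.vecL2Norm_map_inclRight_le (τ := τ) h₁ h₂ h he₂ zero_le_one (P := P)
    (by simpa only [one_mul] using hP)
  simp only [one_mul] at this
  exact this

/-- Boundedness of a letter comes from the Bernstein–Markov inequality in degree 1 and passes to the
free product through the module decomposition. -/
theorem exists_mulBound_inl [Finite ι₁] [Finite ι₂] (h₁ : IsFaithfulBoundedTrace τ₁)
    (h₂ : IsFaithfulBoundedTrace τ₂) (h : IsFreeProduct τ₁ τ₂ τ) (hτ : IsPositive τ) {M : ℕ → ℝ}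
    (hM : IsBernsteinMarkovBound k τ₁ M) (hk : 1 ≤ k) (x : ι₁) :
    ∃ R : ℝ, 0 < R ∧ MulBound τ (monomial (FreeMonoid.of (Sum.inl x))) R := by
  obtain ⟨I₁, deg₁, e₁, he₁⟩ := exists_isOrthoSystem h₁
  obtain ⟨I₂, deg₂, e₂, he₂⟩ := exists_isOrthoSystem h₂
  have hd : monomial (FreeMonoid.of x) ∈ degLE ι₁ 1 := monomial_mem_degLE (by simp)
  have hd' : monomial (FreeMonoid.of x) ∉ degLE ι₁ (1 - 1) := by
    rw [mem_degLE]
    intro h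
    have := h (FreeMonoid.of x) (by simp [monomial])
    simp at this
  have hb := hM.mulBound h₁.isPositive hk le_rfl hd hd'
  set R := M 1 * √(τ₁ (ncStar (monomial (FreeMonoid.of x)) * monomial (FreeMonoid.of x))).re
  have hR : 0 ≤ R := mul_nonneg (hM 1 le_rfl).1 (Real.sqrt_nonneg _)
  -- Enlarging R by 1 makes the bound strictly positive, so that it can be divided by.
  have hb' : MulBound τ₁ (monomial (FreeMonoid.of x)) (R + 1) := fun f =>
    (hb f).trans (mul_le_mul_of_nonneg_right (pow_le_pow_left₀ hR (by linarith) 2)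
      (h₁.nonneg f).1)
  have hR' : 0 < R + 1 := by linarith
  have hv := he₁.vecL2Norm_map_inclLeft_le h₁ h₂ h he₂ hR'.le
    (hb'.vecL2Norm_le (k := k) h₁.isPositive hR'.le)
  have hmap : (scalarPoly k (monomial (FreeMonoid.of x))).map inclLeft
      = scalarPoly k (monomial (FreeMonoid.of (Sum.inl x : ι₁ ⊕ ι₂))) := by
    rw [scalarPoly, scalarPoly, Matrix.diagonal_map (map_zero _)]
    simp [inclLeft, monomial]
  rw [hmap] at hv
  exact ⟨R + 1, hR', mulBound_of_opNorm hτ hk hR'.le ((opNorm_le_ofReal_iff hR'.le).2 hv)⟩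

theorem max_sigmaInf_le [Finite ι₁] [Finite ι₂] (h₁ : IsFaithfulBoundedTrace τ₁)
    (h₂ : IsFaithfulBoundedTrace τ₂) (h : IsFreeProduct τ₁ τ₂ τ)
    (A : ι₁ ⊕ ι₂ → Matrix (Fin k) (Fin k) ℂ) :
    max (sigmaInf τ₁ (A ∘ Sum.inl)) (sigmaInf τ₂ (A ∘ Sum.inr)) ≤ sigmaInf τ A := by
  refine max_le (limsup_comp_le_of_isOpenMap isOpenMap_comp_inl _ _ (fun ζ => ?_) A)
    (limsup_comp_le_of_isOpenMap isOpenMap_comp_inr _ _ (fun ζ => ?_) A)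
  · exact iSup₂_mono fun d _ =>
      ENNReal.rpow_le_rpow (phiInfDeg_inl_le h₁ h₂ h d ζ) (by positivity)
  · exact iSup₂_mono fun d _ =>
      ENNReal.rpow_le_rpow (phiInfDeg_inr_le h₁ h₂ h d ζ) (by positivity)

theorem max_phiInf_le [Finite ι₁] [Finite ι₂] (h₁ : IsFaithfulBoundedTrace τ₁)
    (h₂ : IsFaithfulBoundedTrace τ₂) (h : IsFreeProduct τ₁ τ₂ τ)
    (A : ι₁ ⊕ ι₂ → Matrix (Fin k) (Fin k) ℂ) :
    max (phiInf τ₁ (A ∘ Sum.inl)) (phiInf τ₂ (A ∘ Sum.inr)) ≤ phiInf τ A := by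
  refine max_le (limsup_comp_le_of_isOpenMap isOpenMap_comp_inl _ _ (fun ζ => ?_) A)
    (limsup_comp_le_of_isOpenMap isOpenMap_comp_inr _ _ (fun ζ => ?_) A)
  · exact limsup_le_limsup (Eventually.of_forall fun d =>
      ENNReal.rpow_le_rpow (phiInfDeg_inl_le h₁ h₂ h d ζ) (by positivity))
  · exact limsup_le_limsup (Eventually.of_forall fun d =>
      ENNReal.rpow_le_rpow (phiInfDeg_inr_le h₁ h₂ h d ζ) (by positivity))

theorem IsOrthoSystem.sigmaInf_freeProduct_le [Fintype ι₁] [Fintype ι₂]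
    (hcard : 2 ≤ Fintype.card (ι₁ ⊕ ι₂)) (h₁ : IsFaithfulBoundedTrace τ₁)
    (h₂ : IsFaithfulBoundedTrace τ₂) (h : IsFreeProduct τ₁ τ₂ τ) (he₁ : IsOrthoSystem τ₁ deg₁ e₁)
    (he₂ : IsOrthoSystem τ₂ deg₂ e₂) {A₁ : ι₁ → Matrix (Fin k) (Fin k) ℂ}
    {A₂ : ι₂ → Matrix (Fin k) (Fin k) ℂ} {L : ℝ} (hL : 1 ≤ L)
    (hA₁ : ∀ᶠ ζ in 𝓝 A₁, ∀ i, matNorm (evalTuple ζ (e₁ i)) ^ 2 ≤ L ^ deg₁ i)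
    (hA₂ : ∀ᶠ ζ in 𝓝 A₂, ∀ i, matNorm (evalTuple ζ (e₂ i)) ^ 2 ≤ L ^ deg₂ i) :
    sigmaInf τ (Sum.elim A₁ A₂) ≤ (Fintype.card (ι₁ ⊕ ι₂) : ℝ≥0∞) ^ 2 * ENNReal.ofReal L := by
  have F := he₁.freeSystem h₁ h₂ h he₂
  have c₁ : Tendsto (fun ζ : ι₁ ⊕ ι₂ → Matrix (Fin k) (Fin k) ℂ => ζ ∘ Sum.inl)
      (𝓝 (Sum.elim A₁ A₂)) (𝓝 A₁) :=
    (Pi.continuous_precomp Sum.inl).tendsto' _ _ (Sum.elim_comp_inl _ _)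
  have c₂ : Tendsto (fun ζ : ι₁ ⊕ ι₂ → Matrix (Fin k) (Fin k) ℂ => ζ ∘ Sum.inr)
      (𝓝 (Sum.elim A₁ A₂)) (𝓝 A₂) :=
    (Pi.continuous_precomp Sum.inr).tendsto' _ _ (Sum.elim_comp_inr _ _)
  refine limsup_le_of_le (h := ?_)
  filter_upwards [c₁.eventually hA₁, c₂.eventually hA₂] with ζ hζ₁ hζ₂
  refine iSup₂_le fun d hd => rpow_le_of_le_pow hd ((F.phiInfDeg_le hcard hL ?_ hd).trans ?_)
  · rintro (i | i)
    · have := hζ₁ i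
      rwa [← evalTuple_mapDomain] at this
    · have := hζ₂ i
      rwa [← evalTuple_mapDomain] at this
  · have hL0 : 0 ≤ L := zero_le_one.trans hL
    rw [ENNReal.ofReal_pow (by positivity), ENNReal.ofReal_mul (by positivity),
      ENNReal.ofReal_pow (by positivity), ENNReal.ofReal_natCast]

/-- The numbers s₁, s₂ are left abstract so that the same argument serves Σ^∞ and, at selfadjoint
tuples, Φ^∞. A real y above both s_j · `bmSup` is tested with the rates y / `bmSup`, which exceed
s_j. -/
theorem sigmaInf_freeProduct_le_of_forall [Fintype ι₁] [Fintype ι₂]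
    (hcard : 2 ≤ Fintype.card (ι₁ ⊕ ι₂)) (h₁ : IsFaithfulBoundedTrace τ₁)
    (h₂ : IsFaithfulBoundedTrace τ₂) (h : IsFreeProduct τ₁ τ₂ τ) (he₁ : IsOrthoSystem τ₁ deg₁ e₁)
    (he₂ : IsOrthoSystem τ₂ deg₂ e₂) {A₁ : ι₁ → Matrix (Fin k) (Fin k) ℂ}
    {A₂ : ι₂ → Matrix (Fin k) (Fin k) ℂ} {M₁ M₂ : ℕ → ℝ} (hb₁ : 1 ≤ bmSup M₁)
    (hb₂ : 1 ≤ bmSup M₂) (hb₁' : bmSup M₁ < ⊤) (hb₂' : bmSup M₂ < ⊤) {s₁ s₂ : ℝ≥0∞} (hs₁ : 1 ≤ s₁)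
    (hA₁ : ∀ c, s₁ < c → ∀ᶠ ζ in 𝓝 A₁, ∀ i, ENNReal.ofReal (matNorm (evalTuple ζ (e₁ i)) ^ 2)
      ≤ ENNReal.ofReal (M₁ (deg₁ i)) ^ 2 * c ^ deg₁ i)
    (hA₂ : ∀ c, s₂ < c → ∀ᶠ ζ in 𝓝 A₂, ∀ i, ENNReal.ofReal (matNorm (evalTuple ζ (e₂ i)) ^ 2)
      ≤ ENNReal.ofReal (M₂ (deg₂ i)) ^ 2 * c ^ deg₂ i) :
    sigmaInf τ (Sum.elim A₁ A₂) ≤ (Fintype.card (ι₁ ⊕ ι₂) : ℝ≥0∞) ^ 2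
      * max (s₁ * bmSup M₁) (s₂ * bmSup M₂) := by
  have hcard0 : (Fintype.card (ι₁ ⊕ ι₂) : ℝ≥0∞) ^ 2 ≠ 0 :=
    pow_ne_zero 2 (by exact_mod_cast (by omega : Fintype.card (ι₁ ⊕ ι₂) ≠ 0))
  have hcardT : (Fintype.card (ι₁ ⊕ ι₂) : ℝ≥0∞) ^ 2 ≠ ⊤ :=
    ENNReal.pow_ne_top (ENNReal.natCast_ne_top _)
  rw [mul_comm, ← ENNReal.div_le_iff hcard0 hcardT]
  refine le_of_forall_gt_imp_ge_of_dense fun y hy => ?_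
  induction y using ENNReal.recTopCoe with
  | top => exact le_top
  | coe y =>
    obtain ⟨hy₁, hy₂⟩ := max_lt_iff.1 hy
    have hy1 : (1 : ℝ≥0∞) ≤ y :=
      (one_le_mul_of_one_le_of_one_le hs₁ hb₁).trans hy₁.le
    have hy1' : (1 : ℝ) ≤ y := by exact_mod_cast hy1
    have hcoe : (y : ℝ≥0∞) = ENNReal.ofReal (y : ℝ) := (ENNReal.ofReal_coe_nnreal).symm
    have hc : ∀ {b s : ℝ≥0∞}, 1 ≤ b → b < ⊤ → s * b < y →
        s < y / b ∧ b * (y / b) ≤ ENNReal.ofReal (y : ℝ) := by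
      intro b s hb hb' hs
      have hb0 : b ≠ 0 := (zero_lt_one.trans_le hb).ne'
      exact ⟨(ENNReal.lt_div_iff_mul_lt (Or.inl hb0) (Or.inl hb'.ne)).2 hs, by
        rw [ENNReal.mul_div_cancel hb0 hb'.ne, hcoe]⟩
    obtain ⟨l₁, r₁⟩ := hc hb₁ hb₁' hy₁
    obtain ⟨l₂, r₂⟩ := hc hb₂ hb₂' hy₂
    rw [ENNReal.div_le_iff hcard0 hcardT, mul_comm, hcoe]
    refine he₁.sigmaInf_freeProduct_le hcard h₁ h₂ h he₂ hy1' ?_ ?_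
    · filter_upwards [hA₁ _ l₁] with ζ hζ i
      exact ofReal_matNorm_sq_le_pow he₁ y.coe_nonneg r₁ (hζ i)
    · filter_upwards [hA₂ _ l₂] with ζ hζ i
      exact ofReal_matNorm_sq_le_pow he₂ y.coe_nonneg r₂ (hζ i)

end Product

end NCSiciak

end

/-! ### The main theorem -/

open NCSiciak in
theorem mainTheorem1 {n m : ℕ} (hn : 1 ≤ n) (hm : 1 ≤ m)
    (τ₁ : NCPoly (Fin n) →ₗ[ℂ] ℂ) (τ₂ : NCPoly (Fin m) →ₗ[ℂ] ℂ)
    (hτ₁ : IsFaithfulBoundedTrace τ₁) (hτ₂ : IsFaithfulBoundedTrace τ₂)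
    (τ : NCPoly (Fin n ⊕ Fin m) →ₗ[ℂ] ℂ)
    (hτ : τ = freeProduct τ₁ τ₂ hτ₁.map_one hτ₂.map_one)
    (C₁ C₂ : ℝ) (hC₁ : 1 ≤ C₁) (hC₂ : 1 ≤ C₂) (M₁ M₂ : ℕ → ℕ → ℝ)
    (hBM₁ : HasBernsteinMarkov τ₁ C₁ M₁) (hBM₂ : HasBernsteinMarkov τ₂ C₂ M₂)
    (k : ℕ) (hk : 1 ≤ k) :
    (∀ (A₁ : Fin n → Matrix (Fin k) (Fin k) ℂ) (A₂ : Fin m → Matrix (Fin k) (Fin k) ℂ),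
      max (sigmaInf τ₁ A₁) (sigmaInf τ₂ A₂) ≤ sigmaInf τ (Sum.elim A₁ A₂) ∧
      sigmaInf τ (Sum.elim A₁ A₂) ≤ ((m : ENNReal) + n) ^ 2 *
        max (sigmaInf τ₁ A₁ * bmSup (M₁ k)) (sigmaInf τ₂ A₂ * bmSup (M₂ k))) ∧
    (∀ (A₁ : Fin n → Matrix (Fin k) (Fin k) ℂ) (A₂ : Fin m → Matrix (Fin k) (Fin k) ℂ),
      (∀ i, (A₁ i).IsHermitian) → (∀ i, (A₂ i).IsHermitian) →
      max (phiInf τ₁ A₁) (phiInf τ₂ A₂) ≤ phiInf τ (Sum.elim A₁ A₂) ∧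
      phiInf τ (Sum.elim A₁ A₂) ≤ ((m : ENNReal) + n) ^ 2 *
        max (phiInf τ₁ A₁ * bmSup (M₁ k)) (phiInf τ₂ A₂ * bmSup (M₂ k))) ∧
    (∀ f ∈ ({sigmaInf τ, sigmaTwo τ, phiTwo τ, phiInf τ} :
        Set ((Fin n ⊕ Fin m → Matrix (Fin k) (Fin k) ℂ) → ENNReal)),
      (∃ A, 1 < f A) ∧
      (FiniteQE (phiInf (k := k) τ₁) → FiniteQE (phiInf (k := k) τ₂) → FiniteQE f)) := by
  have : Nonempty (Fin n) := ⟨⟨0, hn⟩⟩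
  have : Nonempty (Fin m) := ⟨⟨0, hm⟩⟩
  have h : IsFreeProduct τ₁ τ₂ τ := hτ ▸ isFreeProduct_freeProduct τ₁ τ₂ _ _
  have hcard : 2 ≤ Fintype.card (Fin n ⊕ Fin m) := by
    rw [Fintype.card_sum, Fintype.card_fin, Fintype.card_fin]; omega
  have hcast : ((Fintype.card (Fin n ⊕ Fin m) : ℕ) : ENNReal) = (m : ENNReal) + n := by
    rw [Fintype.card_sum, Fintype.card_fin, Fintype.card_fin]; push_cast; exact add_comm _ _
  have hM₁ : IsBernsteinMarkovBound k τ₁ (M₁ k) := (hBM₁ k hk).1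
  have hM₂ : IsBernsteinMarkovBound k τ₂ (M₂ k) := (hBM₂ k hk).1
  have hb₁ := one_le_bmSup hM₁ hτ₁ hk
  have hb₂ := one_le_bmSup hM₂ hτ₂ hk
  have hb₁' := bmSup_lt_top (hBM₁ k hk).2
  have hb₂' := bmSup_lt_top (hBM₂ k hk).2
  obtain ⟨I₁, deg₁, e₁, he₁⟩ := exists_isOrthoSystem hτ₁
  obtain ⟨I₂, deg₂, e₂, he₂⟩ := exists_isOrthoSystem hτ₂
  have upper : ∀ (A₁ : Fin n → Matrix (Fin k) (Fin k) ℂ) (A₂ : Fin m → Matrix (Fin k) (Fin k) ℂ),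
      sigmaInf τ (Sum.elim A₁ A₂) ≤ ((m : ENNReal) + n) ^ 2 *
        max (sigmaInf τ₁ A₁ * bmSup (M₁ k)) (sigmaInf τ₂ A₂ * bmSup (M₂ k)) := by
    intro A₁ A₂
    rw [← hcast]
    exact sigmaInf_freeProduct_le_of_forall hcard hτ₁ hτ₂ h he₁ he₂ hb₁ hb₂ hb₁' hb₂'
      ((one_le_phiInf hk hτ₁.isPositive A₁).trans (phiInf_le_sigmaInf A₁))
      (fun c hc => eventually_matNorm_sq_le_of_sigmaInf_lt he₁ hM₁ hτ₁ hk hc)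
      (fun c hc => eventually_matNorm_sq_le_of_sigmaInf_lt he₂ hM₂ hτ₂ hk hc)
  refine ⟨fun A₁ A₂ => ⟨?_, upper A₁ A₂⟩, fun A₁ A₂ hA₁ hA₂ => ⟨?_, ?_⟩, fun f hf => ?_⟩
  · simpa using max_sigmaInf_le hτ₁ hτ₂ h (Sum.elim A₁ A₂)
  · simpa using max_phiInf_le hτ₁ hτ₂ h (Sum.elim A₁ A₂)
  · rw [← hcast]
    -- More than required holds: even Σ^∞ of the free product is bounded by the Φ^∞ of the factors.
    exact (phiInf_le_sigmaInf _).trans <|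
      sigmaInf_freeProduct_le_of_forall hcard hτ₁ hτ₂ h he₁ he₂ hb₁ hb₂ hb₁' hb₂'
        (one_le_phiInf hk hτ₁.isPositive A₁)
        (fun c hc => eventually_matNorm_sq_le_of_phiInf_lt he₁ hM₁ hτ₁ hk hA₁ hc)
        (fun c hc => eventually_matNorm_sq_le_of_phiInf_lt he₂ hM₂ hτ₂ hk hA₂ hc)
  -- All four functions lie between Φ² and Σ^∞, so nontriviality is needed only for the first and
  -- finiteness only for the second.
  · have hbetween : ∀ A, phiTwo τ A ≤ f A ∧ f A ≤ sigmaInf τ A := by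
      intro A
      rcases hf with rfl | rfl | rfl | rfl
      · exact ⟨(phiTwo_le_phiInf A).trans (phiInf_le_sigmaInf A), le_rfl⟩
      · exact ⟨phiTwo_le_sigmaTwo A, sigmaTwo_le_sigmaInf A⟩
      · exact ⟨le_rfl, (phiTwo_le_phiInf A).trans (phiInf_le_sigmaInf A)⟩
      · exact ⟨phiTwo_le_phiInf A, phiInf_le_sigmaInf A⟩
    constructor
    · have hpos : IsPositive τ := (he₁.freeSystem hτ₁ hτ₂ h he₂).isPositive
      obtain ⟨R, hR, hX⟩ := exists_mulBound_inl hτ₁ hτ₂ h hpos hM₁ hk (⟨0, hn⟩ : Fin n)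
      obtain ⟨A, hA⟩ := exists_one_lt_phiTwo (k := k) hpos hk hX hR
      exact ⟨A, hA.trans_le (hbetween A).1⟩
    · intro hf₁ hf₂
      -- One finite value in each factor already gives finiteness everywhere, so the exceptional set
      -- may be taken empty.
      obtain ⟨z₁, hz₁⟩ := hf₁.exists_lt_top
      obtain ⟨z₂, hz₂⟩ := hf₂.exists_lt_top
      refine finiteQE_of_forall_lt_top fun A => (hbetween A).2.trans_lt ?_
      rw [← Sum.elim_comp_inl_inr A]
      refine (upper _ _).trans_lt (ENNReal.mul_lt_top (by simp) (max_lt ?_ ?_))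
      · exact ENNReal.mul_lt_top (sigmaInf_lt_top hz₁ _) hb₁'
      · exact ENNReal.mul_lt_top (sigmaInf_lt_top hz₂ _) hb₂'
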